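/- **Setting.** Let $D$ be a small category with pushouts and put $C:=D^{\circ}$. For $f\colon x\to y$ in $C$ a cross functor on $C$ with values in $\mathrm{Cat}$ consists of 2-functors (pseudofunctors) $H_\star,H_!$ (covariant on $C$) and $H^\star,H^!$ (contravariant on $C$), with the same values $H(x)$ on objects and values $f_*,f_!,f^*,f^!$ on morphisms, with adjunctions $f^*\dashv f_*$ and $f_!\dashv f^!$ compatible with identities and composition, and, for every cartesian square $$\begin{array}{ccc} a&\xrightarrow{\ f\ }&c\\ {\scriptstyle g}\downarrow&&\downarrow{\scriptstyle p}\\ b&\xrightarrow{\ h\ }&d\end{array}$$ in $C$, exchange morphisms $p_!f_*\to h_*g_!$ and $f^*p^!\to g^!h^*$, which are compatible with pasting of squares in both directions, are invertible when both vertical or both horizontal morphisms of the square are identities, and whose transposes $h^*p_!\to g_!f^*$ and $g_!f^*\to h^*p_!$ are inverse to each other (base change). A ringed $D$-topos $(E,A)$ is a category $E\to D$ bifibered in Grothendieck topoi such that for $m\colon i\to j$ in $D$ the cocartesian transport $m_*\colon E_i\to E_j$ preserves finite limits, together with ring objects $A_i\in E_i$ and ring morphisms $m_*A_i\to A_j$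 compatible with identities and composition. $\underline{\mathrm{Mod}}(E,A)\to D$ denotes the bifibration whose fiber over $i$ is the category of $A_i$-modules in $E_i$, a morphism $X\to Y$ over $m\colon i\to j$ being an $A_i$-linear morphism from $X$ to $m^*Y$. A *Grothendieck cross functor* associated with $(E,A)$ is a cross functor on $C=D^{\circ}$ with values in $\mathrm{Cat}$ such that the bifibration over $D$ defined by $(H_\star,H^\star)$ is equivalent over $D$ to $\underline{\mathrm{Mod}}(E,A)$, together with an isomorphism of 2-functors $H_!\cong H_\star$ which is the identity on objects. Let $\mathrm{cospan}(D)=\mathrm{span}(C)$ be the $(2,1)$-category with the objects of $C$, with spans $(l,z,r)\colon x\xleftarrow{l}z\xrightarrow{r}y$ in $C$ as 1-morphisms, composed by fibre products, and with isomorphisms of spans as 2-morphisms; $\mathrm i\colon C\to\mathrm{span}(C)\leftarrow C^{\circ}\colon\mathrm j$ are the embeddings $f\mapsto(\mathrm{id},x,f)$ and $f\mapsto(f,x,\mathrm{id})$. All four kinds of Mackey pseudo-functors are pseudofunctors $F$ on $\mathrm{span}(C)$ with values in $\mathrm{Cat}$ with given equivalences of $\mathrm i^*F$ and $\mathrm j^*F$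 with two of the 2-functors of $H$, which agree on objects (up to given invertible 2-morphisms) and carry, for every cartesian square of $C$, the base change isomorphism of $F$ (which comes from the isomorphism of spans between the composite of $\mathrm i(p)$ with $\mathrm j(h)$ and the composite of $\mathrm j(f)$ with $\mathrm i(g)$) to the indicated base change isomorphism of $H$: * a *Mackey $\star!$-functor* $H^{\star!}$ is covariant, with $\mathrm i^*H^{\star!}\simeq H_!$ and $\mathrm j^*H^{\star!}\simeq H^\star$ and base change $h^*p_!\cong g_!f^*$; it sends $(l,z,r)$ to $r_!l^*$ up to isomorphism; * a *Mackey $!\star$-functor* $H_{!\star}$ is contravariant, with $\mathrm i^*H_{!\star}\simeq H^!$ and $\mathrm j^*H_{!\star}\simeq H_\star$ and base change $p^!h_*\cong f_*g^!$ (obtained from $h^*p_!\cong g_!f^*$ by passing to right adjoints); * a *Mackey $\star\star$-functor* $H^{\star\star}$ is contravariant, with $\mathrm i^*H^{\star\star}\simeq H^\star$ and $\mathrm j^*H^{\star\star}\simeq H_\star$ and base change $p^*h_*\cong f_*g^*$ (obtained from $p^*h_!\cong f_!g^*$ through $H_!\cong H_\star$); * a *Mackey $!!$-functor* $H^{!!}$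 is covariant, with $\mathrm i^*H^{!!}\simeq H_!$ and $\mathrm j^*H^{!!}\simeq H^!$ and base change $h^!p_!\cong g_!f^!$ (obtained from $h^!p_*\cong g_*f^!$ through $H_!\cong H_\star$). **Proposition.** Let $(E,A)$ be a ringed $D$-topos and $H=(H_\star,H^\star,H_!,H^!)$ a Grothendieck cross functor associated with it. Then there exist a Mackey $\star!$-functor $H^{\star!}$ and a Mackey $!\star$-functor $H_{!\star}$ associated with $H$, and a Mackey $\star\star$-functor $H^{\star\star}$ and a Mackey $!!$-functor $H^{!!}$ associated with $H$. Each of the four is unique: any two Mackey functors of the same kind are related by an equivalence of pseudofunctors which is compatible with the given identifications of their restrictions along $\mathrm i$ and $\mathrm j$. -/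

import Mathlib

open CategoryTheory CategoryTheory.Limits CategoryTheory.Bicategory Opposite

universe w v₁ v₂ v₃ v₄ u₁ u₂ u₃ u₄

noncomputable section

namespace CrossFunctors

/-! ### Pseudofunctors with prescribed values on objects -/

section TwoFunctors

variable {C : Type u₁} [Category.{v₁} C] {K : Type u₂} [Bicategory.{w, v₂} K]

/-- A 2-functor (pseudofunctor) from an ordinary category `C` to a bicategory `K` whose value on
objects is the given function `obj`. The fields are the data and the coherence conditions of a
Mathlib pseudofunctor out of a locally discrete bicategory, see `TwoFunctor.toPseudofunctor`.
Fixing `obj` makes it possible to say that several 2-functors are equal on objects. -/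
structure TwoFunctor (C : Type u₁) [Category.{v₁} C] {K : Type u₂} [Bicategory.{w, v₂} K]
    (obj : C → K) where
  map {x y : C} (f : x ⟶ y) : obj x ⟶ obj y
  mapId (x : C) : map (𝟙 x) ≅ 𝟙 (obj x)
  mapComp {x y z : C} (f : x ⟶ y) (g : y ⟶ z) : map (f ≫ g) ≅ map f ≫ map g
  map₂_associator {x y z t : C} (f : x ⟶ y) (g : y ⟶ z) (h : z ⟶ t) :
    (mapComp (f ≫ g) h).hom ≫ (mapComp f g).hom ▷ map h ≫
      (α_ (map f) (map g) (map h)).hom ≫ map f ◁ (mapComp g h).inv ≫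
        (mapComp f (g ≫ h)).inv = eqToHom (by simp)
  map₂_left_unitor {x y : C} (f : x ⟶ y) :
    (mapComp (𝟙 x) f).hom ≫ (mapId x).hom ▷ map f ≫ (λ_ (map f)).hom = eqToHom (by simp)
  map₂_right_unitor {x y : C} (f : x ⟶ y) :
    (mapComp f (𝟙 y)).hom ≫ map f ◁ (mapId y).hom ≫ (ρ_ (map f)).hom = eqToHom (by simp)

namespace TwoFunctor

/-- The associated Mathlib pseudofunctor. -/
def toPseudofunctor {obj : C → K} (F : TwoFunctor C obj) : LocallyDiscrete C ⥤ᵖ K :=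
  LocallyDiscrete.mkPseudofunctor obj F.map F.mapId F.mapComp
    F.map₂_associator F.map₂_left_unitor F.map₂_right_unitor

theorem op2_eqToHom {a b : K} {f g : a ⟶ b} (h : f = g) :
    Bicategory.Opposite.op2 (eqToHom h) = eqToHom (congrArg Quiver.Hom.op h) := by
  subst h; rfl

/-- A covariant 2-functor `C → K`, seen as a 2-functor from `Cᵒᵖ` to the bicategory `Kᵒᵖ` in which
the 1-morphisms of `K` (and not the 2-morphisms) are reversed. -/
def opCov {obj : C → K} (F : TwoFunctor C obj) :
    TwoFunctor (K := Kᵒᵖ) Cᵒᵖ (fun x => op (obj x.unop)) where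
  map f := (F.map f.unop).op
  mapId x := (F.mapId x.unop).op2
  mapComp f g := (F.mapComp g.unop f.unop).op2
  map₂_associator {x y z t} f g h := by
    have e := F.map₂_associator h.unop g.unop f.unop
    have e2 := congrArg (fun u => Bicategory.Opposite.op2 u) ((IsIso.inv_eq_inv).mpr e)
    simp only [IsIso.inv_comp, inv_eqToHom, op2_eqToHom] at e2
    refine Eq.trans ?_ e2
    simp
  map₂_left_unitor f := by
    have e := congrArg (fun u => Bicategory.Opposite.op2 u) (F.map₂_right_unitor f.unop)
    rw [op2_eqToHom] at e
    exact e
  map₂_right_unitor f := by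
    have e := congrArg (fun u => Bicategory.Opposite.op2 u) (F.map₂_left_unitor f.unop)
    rw [op2_eqToHom] at e
    exact e

/-- A contravariant 2-functor `Cᵒᵖ → K`, seen as a 2-functor from `C` to the bicategory `Kᵒᵖ` in
which the 1-morphisms of `K` (and not the 2-morphisms) are reversed. -/
def opContra {obj : C → K} (F : TwoFunctor Cᵒᵖ (fun x => obj x.unop)) :
    TwoFunctor (K := Kᵒᵖ) C (fun x => op (obj x)) where
  map f := (F.map f.op).op
  mapId x := (F.mapId (op x)).op2
  mapComp f g := (F.mapComp g.op f.op).op2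
  map₂_associator {x y z t} f g h := by
    have e := F.map₂_associator h.op g.op f.op
    have e2 := congrArg (fun u => Bicategory.Opposite.op2 u) ((IsIso.inv_eq_inv).mpr e)
    simp only [IsIso.inv_comp, inv_eqToHom, op2_eqToHom] at e2
    refine Eq.trans ?_ e2
    simp
  map₂_left_unitor f := by
    have e := congrArg (fun u => Bicategory.Opposite.op2 u) (F.map₂_right_unitor f.op)
    rw [op2_eqToHom] at e
    exact e
  map₂_right_unitor f := by
    have e := congrArg (fun u => Bicategory.Opposite.op2 u) (F.map₂_left_unitor f.op)
    rw [op2_eqToHom] at e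
    exact e

end TwoFunctor

end TwoFunctors

/-! ### Cross functors -/

section CrossFunctor

/-- A class of commutative squares
```
  a --f--> c
  |        |
  g        p
  v        v
  b --h--> d
```
in `C`, as a predicate on `f`, `g`, `p`, `h`. -/
abbrev SquareClass (C : Type u₁) [Category.{v₁} C] :=
  ∀ ⦃a b c d : C⦄, (a ⟶ c) → (a ⟶ b) → (c ⟶ d) → (b ⟶ d) → Prop

/-- The class of cartesian squares. -/
def cartesianSquares (C : Type u₁) [Category.{v₁} C] : SquareClass C :=
  fun _ _ _ _ f g p h => IsPullback f g p h

/-- A cross functor from `C` to the bicategory `K`, relative to the class `B` of commutative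
squares. For `f : x ⟶ y` in `C`, the 1-morphisms `f_*`, `f^*`, `f_!`, `f^!` are
`lowerStar.map f`, `upperStar.map f.op`, `lowerShriek.map f`, `upperShriek.map f.op`.
Compositions in `K` are written in diagrammatic order, so that `p_! f_*` is
`lowerStar.map f ≫ lowerShriek.map p`. -/
structure CrossFunctor (C : Type u₁) [Category.{v₁} C] (K : Type u₂) [Bicategory.{w, v₂} K]
    (B : SquareClass C) where
  /-- The common value of the four 2-functors on objects. -/
  obj : C → K
  lowerStar : TwoFunctor C obj
  upperStar : TwoFunctor Cᵒᵖ (fun x => obj x.unop)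
  lowerShriek : TwoFunctor C obj
  upperShriek : TwoFunctor Cᵒᵖ (fun x => obj x.unop)
  /-- `f^*` is left adjoint to `f_*`. -/
  adjStar {x y : C} (f : x ⟶ y) : upperStar.map f.op ⊣ lowerStar.map f
  /-- `f_!` is left adjoint to `f^!`. -/
  adjShriek {x y : C} (f : x ⟶ y) : lowerShriek.map f ⊣ upperShriek.map f.op
  adjStar_id (x : C) :
    conjugateEquiv (Bicategory.Adjunction.id (obj x)) (adjStar (𝟙 x))
      (upperStar.mapId (op x)).hom = (lowerStar.mapId x).inv
  adjStar_comp {x y z : C} (f : x ⟶ y) (g : y ⟶ z) :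
    conjugateEquiv ((adjStar g).comp (adjStar f)) (adjStar (f ≫ g))
      (upperStar.mapComp g.op f.op).hom = (lowerStar.mapComp f g).inv
  adjShriek_id (x : C) :
    conjugateEquiv (Bicategory.Adjunction.id (obj x)) (adjShriek (𝟙 x))
      (lowerShriek.mapId x).hom = (upperShriek.mapId (op x)).inv
  adjShriek_comp {x y z : C} (f : x ⟶ y) (g : y ⟶ z) :
    conjugateEquiv ((adjShriek f).comp (adjShriek g)) (adjShriek (f ≫ g))
      (lowerShriek.mapComp f g).hom = (upperShriek.mapComp g.op f.op).inv
  /-- The exchange morphism `p_! f_* ⟶ h_* g_!` of the lower e-functor. -/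
  lowerExchange {a b c d : C} {f : a ⟶ c} {g : a ⟶ b} {p : c ⟶ d} {h : b ⟶ d}
    (Q : B f g p h) :
    lowerStar.map f ≫ lowerShriek.map p ⟶ lowerShriek.map g ≫ lowerStar.map h
  /-- The exchange morphism `f^* p^! ⟶ g^! h^*` of the upper e-functor. -/
  upperExchange {a b c d : C} {f : a ⟶ c} {g : a ⟶ b} {p : c ⟶ d} {h : b ⟶ d}
    (Q : B f g p h) :
    upperShriek.map p.op ≫ upperStar.map f.op ⟶ upperStar.map h.op ≫ upperShriek.map g.op
  /-- Compatibility of the lower exchange with pasting along `h : b ⟶ d`. -/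
  lowerExchange_vert {a b c d b' d' : C} {f : a ⟶ c} {g : a ⟶ b} {p : c ⟶ d} {h : b ⟶ d}
    {g' : b ⟶ b'} {p' : d ⟶ d'} {h' : b' ⟶ d'}
    (Q : B f g p h) (Q' : B h g' p' h') (R : B f (g ≫ g') (p ≫ p') h') :
    lowerExchange R =
      lowerStar.map f ◁ (lowerShriek.mapComp p p').hom ≫ (α_ _ _ _).inv ≫
        lowerExchange Q ▷ lowerShriek.map p' ≫ (α_ _ _ _).hom ≫
          lowerShriek.map g ◁ lowerExchange Q' ≫ (α_ _ _ _).inv ≫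
            (lowerShriek.mapComp g g').inv ▷ lowerStar.map h'
  /-- Compatibility of the lower exchange with pasting along `p : c ⟶ d`. -/
  lowerExchange_horiz {a b c d e e' : C} {f : a ⟶ c} {g : a ⟶ b} {p : c ⟶ d} {h : b ⟶ d}
    {f' : c ⟶ e} {q : e ⟶ e'} {h' : d ⟶ e'}
    (Q : B f g p h) (Q' : B f' p q h') (R : B (f ≫ f') g q (h ≫ h')) :
    lowerExchange R =
      (lowerStar.mapComp f f').hom ▷ lowerShriek.map q ≫ (α_ _ _ _).hom ≫
        lowerStar.map f ◁ lowerExchange Q' ≫ (α_ _ _ _).inv ≫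
          lowerExchange Q ▷ lowerStar.map h' ≫ (α_ _ _ _).hom ≫
            lowerShriek.map g ◁ (lowerStar.mapComp h h').inv
  /-- If both vertical morphisms are identities, the lower exchange is invertible. -/
  lowerExchange_isIso_vert {a c : C} {f : a ⟶ c} (Q : B f (𝟙 a) (𝟙 c) f) :
    IsIso (lowerExchange Q)
  /-- If both horizontal morphisms are identities, the lower exchange is invertible. -/
  lowerExchange_isIso_horiz {a b : C} {g : a ⟶ b} (Q : B (𝟙 a) g g (𝟙 b)) :
    IsIso (lowerExchange Q)
  /-- Compatibility of the upper exchange with pasting along `h : b ⟶ d`. -/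
  upperExchange_vert {a b c d b' d' : C} {f : a ⟶ c} {g : a ⟶ b} {p : c ⟶ d} {h : b ⟶ d}
    {g' : b ⟶ b'} {p' : d ⟶ d'} {h' : b' ⟶ d'}
    (Q : B f g p h) (Q' : B h g' p' h') (R : B f (g ≫ g') (p ≫ p') h') :
    upperExchange R =
      (upperShriek.mapComp p'.op p.op).hom ▷ upperStar.map f.op ≫ (α_ _ _ _).hom ≫
        upperShriek.map p'.op ◁ upperExchange Q ≫ (α_ _ _ _).inv ≫
          upperExchange Q' ▷ upperShriek.map g.op ≫ (α_ _ _ _).hom ≫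
            upperStar.map h'.op ◁ (upperShriek.mapComp g'.op g.op).inv
  /-- Compatibility of the upper exchange with pasting along `p : c ⟶ d`. -/
  upperExchange_horiz {a b c d e e' : C} {f : a ⟶ c} {g : a ⟶ b} {p : c ⟶ d} {h : b ⟶ d}
    {f' : c ⟶ e} {q : e ⟶ e'} {h' : d ⟶ e'}
    (Q : B f g p h) (Q' : B f' p q h') (R : B (f ≫ f') g q (h ≫ h')) :
    upperExchange R =
      upperShriek.map q.op ◁ (upperStar.mapComp f'.op f.op).hom ≫ (α_ _ _ _).inv ≫
        upperExchange Q' ▷ upperStar.map f.op ≫ (α_ _ _ _).hom ≫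
          upperStar.map h'.op ◁ upperExchange Q ≫ (α_ _ _ _).inv ≫
            (upperStar.mapComp h'.op h.op).inv ▷ upperShriek.map g.op
  /-- If both vertical morphisms are identities, the upper exchange is invertible. -/
  upperExchange_isIso_vert {a c : C} {f : a ⟶ c} (Q : B f (𝟙 a) (𝟙 c) f) :
    IsIso (upperExchange Q)
  /-- If both horizontal morphisms are identities, the upper exchange is invertible. -/
  upperExchange_isIso_horiz {a b : C} {g : a ⟶ b} (Q : B (𝟙 a) g g (𝟙 b)) :
    IsIso (upperExchange Q)
  /-- The two exchange morphisms transmute by adjunction into morphisms `h^* p_! ⟶ g_! f^*` and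
  `g_! f^* ⟶ h^* p_!` which are inverse to each other. -/
  transmute_hom_inv {a b c d : C} {f : a ⟶ c} {g : a ⟶ b} {p : c ⟶ d} {h : b ⟶ d}
    (Q : B f g p h) :
    (mateEquiv (adjStar f) (adjStar h)).symm (lowerExchange Q) ≫
      (mateEquiv (adjShriek p) (adjShriek g)).symm (upperExchange Q) = 𝟙 _
  transmute_inv_hom {a b c d : C} {f : a ⟶ c} {g : a ⟶ b} {p : c ⟶ d} {h : b ⟶ d}
    (Q : B f g p h) :
    (mateEquiv (adjShriek p) (adjShriek g)).symm (upperExchange Q) ≫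
      (mateEquiv (adjStar f) (adjStar h)).symm (lowerExchange Q) = 𝟙 _

namespace CrossFunctor

variable {C : Type u₁} [Category.{v₁} C] {K : Type u₂} [Bicategory.{w, v₂} K]
  {B : SquareClass C} (H : CrossFunctor C K B)
  {a b c d : C} {f : a ⟶ c} {g : a ⟶ b} {p : c ⟶ d} {h : b ⟶ d}

/-- The base change isomorphism `h^* p_! ≅ g_! f^*`. -/
def baseChange (Q : B f g p h) :
    H.lowerShriek.map p ≫ H.upperStar.map h.op ≅ H.upperStar.map f.op ≫ H.lowerShriek.map g where
  hom := (mateEquiv (H.adjStar f) (H.adjStar h)).symm (H.lowerExchange Q)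
  inv := (mateEquiv (H.adjShriek p) (H.adjShriek g)).symm (H.upperExchange Q)
  hom_inv_id := H.transmute_hom_inv Q
  inv_hom_id := H.transmute_inv_hom Q

/-- The base change isomorphism `p^! h_* ≅ f_* g^!` between the right adjoints of the two sides of
`baseChange`. -/
def baseChangeRight (Q : B f g p h) :
    H.lowerStar.map h ≫ H.upperShriek.map p.op ≅ H.upperShriek.map g.op ≫ H.lowerStar.map f :=
  conjugateIsoEquiv ((H.adjShriek p).comp (H.adjStar h)) ((H.adjStar f).comp (H.adjShriek g))
    (H.baseChange Q).symm

end CrossFunctor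

end CrossFunctor

/-! ### The (2,1)-category of spans -/

section Spans

/-- The objects of the (2,1)-category of spans in `C`: they are the objects of `C`. -/
structure SpanCat (C : Type u₁) where
  of : C

namespace SpanCat

variable {C : Type u₁} [Category.{v₁} C]

/-- A span `x ⟵ apex ⟶ y` in `C`, as a 1-morphism from `x` to `y`. -/
structure Roof (x y : SpanCat C) where
  apex : C
  l : apex ⟶ x.of
  r : apex ⟶ y.of

/-- A 2-morphism of spans is an isomorphism of their apexes which is compatible with the legs. -/
@[ext]
structure Roof.Hom {x y : SpanCat C} (S T : Roof x y) where
  hom : S.apex ⟶ T.apex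
  isIso : IsIso hom
  w_l : hom ≫ T.l = S.l
  w_r : hom ≫ T.r = S.r

attribute [simp] Roof.Hom.w_l Roof.Hom.w_r
attribute [instance] Roof.Hom.isIso

@[simp]
theorem Roof.Hom.w_l_assoc {x y : SpanCat C} {S T : Roof x y} (η : Roof.Hom S T) {u : C}
    (k : x.of ⟶ u) : η.hom ≫ T.l ≫ k = S.l ≫ k := by
  rw [← Category.assoc, η.w_l]

@[simp]
theorem Roof.Hom.w_r_assoc {x y : SpanCat C} {S T : Roof x y} (η : Roof.Hom S T) {u : C}
    (k : y.of ⟶ u) : η.hom ≫ T.r ≫ k = S.r ≫ k := by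
  rw [← Category.assoc, η.w_r]

instance {x y : SpanCat C} : Category (Roof x y) where
  Hom S T := Roof.Hom S T
  id S := ⟨𝟙 _, inferInstance, by simp, by simp⟩
  comp η θ := ⟨η.hom ≫ θ.hom, inferInstance, by simp, by simp⟩
  id_comp η := Roof.Hom.ext (Category.id_comp η.hom)
  comp_id η := Roof.Hom.ext (Category.comp_id η.hom)
  assoc η θ ι := Roof.Hom.ext (Category.assoc η.hom θ.hom ι.hom)

@[ext]
theorem hom₂_ext {x y : SpanCat C} {S T : Roof x y} {η θ : S ⟶ T} (e : η.hom = θ.hom) : η = θ :=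
  Roof.Hom.ext e

@[simp]
theorem id_hom {x y : SpanCat C} (S : Roof x y) : Roof.Hom.hom (𝟙 S) = 𝟙 S.apex := rfl

@[simp]
theorem comp_hom {x y : SpanCat C} {S T U : Roof x y} (η : S ⟶ T) (θ : T ⟶ U) :
    Roof.Hom.hom (η ≫ θ) = Roof.Hom.hom η ≫ Roof.Hom.hom θ := rfl

/-- An isomorphism of apexes which is compatible with the legs is an invertible 2-morphism. -/
@[simps]
def mkIso {x y : SpanCat C} {S T : Roof x y} (e : S.apex ≅ T.apex) (hl : e.hom ≫ T.l = S.l)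
    (hr : e.hom ≫ T.r = S.r) : S ≅ T where
  hom := ⟨e.hom, inferInstance, hl, hr⟩
  inv := ⟨e.inv, inferInstance, by simp [← hl], by simp [← hr]⟩
  hom_inv_id := hom₂_ext e.hom_inv_id
  inv_hom_id := hom₂_ext e.inv_hom_id

@[simp]
theorem eqToHom_hom {x y : SpanCat C} {S T : Roof x y} (e : S = T) :
    Roof.Hom.hom (eqToHom e) = eqToHom (congrArg Roof.apex e) := by
  subst e; rfl

variable [HasPullbacks C]

/-- Composition of spans by fibre products. -/
def Roof.comp {x y z : SpanCat C} (S : Roof x y) (T : Roof y z) : Roof x z where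
  apex := pullback S.r T.l
  l := pullback.fst S.r T.l ≫ S.l
  r := pullback.snd S.r T.l ≫ T.r

/-- The identity span. -/
abbrev Roof.id (x : SpanCat C) : Roof x x where
  apex := x.of
  l := 𝟙 _
  r := 𝟙 _

section

variable {x y z : SpanCat C} (S : Roof x y) (T : Roof y z)

/-- The first projection of the fibre product of apexes. -/
def Roof.fst : (S.comp T).apex ⟶ S.apex := pullback.fst S.r T.l

/-- The second projection of the fibre product of apexes. -/
def Roof.snd : (S.comp T).apex ⟶ T.apex := pullback.snd S.r T.l

@[simp]
theorem Roof.comp_l : (S.comp T).l = S.fst T ≫ S.l := rfl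

@[simp]
theorem Roof.comp_r : (S.comp T).r = S.snd T ≫ T.r := rfl

theorem Roof.isPullback : IsPullback (S.fst T) (S.snd T) S.r T.l :=
  IsPullback.of_hasPullback S.r T.l

theorem Roof.w : S.fst T ≫ S.r = S.snd T ≫ T.l := (S.isPullback T).w

theorem Roof.w_assoc {u : C} (k : y.of ⟶ u) : S.fst T ≫ S.r ≫ k = S.snd T ≫ T.l ≫ k := by
  rw [← Category.assoc, S.w T, Category.assoc]

variable {S T}

theorem Roof.hom_ext {u : C} {a b : u ⟶ (S.comp T).apex} (h₁ : a ≫ S.fst T = b ≫ S.fst T)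
    (h₂ : a ≫ S.snd T = b ≫ S.snd T) : a = b :=
  (S.isPullback T).hom_ext h₁ h₂

/-- The morphism to the fibre product of apexes with given components. -/
def Roof.lift {u : C} (a : u ⟶ S.apex) (b : u ⟶ T.apex) (e : a ≫ S.r = b ≫ T.l) :
    u ⟶ (S.comp T).apex :=
  (S.isPullback T).lift a b e

variable {u v : C} (a : u ⟶ S.apex) (b : u ⟶ T.apex) (e : a ≫ S.r = b ≫ T.l)

@[simp]
theorem Roof.lift_fst : Roof.lift a b e ≫ S.fst T = a := (S.isPullback T).lift_fst a b e

@[simp]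
theorem Roof.lift_snd : Roof.lift a b e ≫ S.snd T = b := (S.isPullback T).lift_snd a b e

@[simp]
theorem Roof.lift_fst_assoc (k : S.apex ⟶ v) : Roof.lift a b e ≫ S.fst T ≫ k = a ≫ k := by
  rw [← Category.assoc, Roof.lift_fst]

@[simp]
theorem Roof.lift_snd_assoc (k : T.apex ⟶ v) : Roof.lift a b e ≫ S.snd T ≫ k = b ≫ k := by
  rw [← Category.assoc, Roof.lift_snd]

end

/-- The isomorphism of fibre products induced by isomorphisms of spans. -/
def Roof.compIso {x y z : SpanCat C} {S S' : Roof x y} {T T' : Roof y z} (η : S ⟶ S')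
    (θ : T ⟶ T') : (S.comp T).apex ≅ (S'.comp T').apex where
  hom := Roof.lift (S.fst T ≫ Roof.Hom.hom η) (S.snd T ≫ Roof.Hom.hom θ) (by simp [S.w T])
  inv := Roof.lift (S'.fst T' ≫ inv (Roof.Hom.hom η)) (S'.snd T' ≫ inv (Roof.Hom.hom θ)) (by
    have h₁ : inv (Roof.Hom.hom η) ≫ S.r = S'.r := by simp
    have h₂ : inv (Roof.Hom.hom θ) ≫ T.l = T'.l := by simp
    rw [Category.assoc, Category.assoc, h₁, h₂, S'.w T'])
  hom_inv_id := by apply Roof.hom_ext <;> simp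
  inv_hom_id := by apply Roof.hom_ext <;> simp

/-- Whiskering of a 2-morphism of spans on the left. -/
def Roof.whiskerLeft {x y z : SpanCat C} (S : Roof x y) {T T' : Roof y z} (η : T ⟶ T') :
    S.comp T ⟶ S.comp T' :=
  (mkIso (Roof.compIso (𝟙 S) η) (by simp [Roof.compIso]) (by simp [Roof.compIso])).hom

/-- Whiskering of a 2-morphism of spans on the right. -/
def Roof.whiskerRight {x y z : SpanCat C} {S S' : Roof x y} (η : S ⟶ S') (T : Roof y z) :
    S.comp T ⟶ S'.comp T :=
  (mkIso (Roof.compIso η (𝟙 T)) (by simp [Roof.compIso]) (by simp [Roof.compIso])).hom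

/-- The left unitor of spans. -/
def Roof.leftUnitor {x y : SpanCat C} (S : Roof x y) : (Roof.id x).comp S ≅ S :=
  mkIso
    { hom := (Roof.id x).snd S
      inv := Roof.lift S.l (𝟙 _) (by simp)
      hom_inv_id := by
        have h := (Roof.id x).w S
        rw [Category.comp_id] at h
        apply Roof.hom_ext <;> simp [h]
      inv_hom_id := by simp }
    (by simp [← (Roof.id x).w S]) (by simp)

/-- The right unitor of spans. -/
def Roof.rightUnitor {x y : SpanCat C} (S : Roof x y) : S.comp (Roof.id y) ≅ S :=
  mkIso
    { hom := S.fst (Roof.id y)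
      inv := Roof.lift (𝟙 _) S.r (by simp)
      hom_inv_id := by
        have h := S.w (Roof.id y)
        rw [Category.comp_id] at h
        apply Roof.hom_ext <;> simp [h]
      inv_hom_id := by simp }
    (by simp) (by simp [S.w (Roof.id y)])

/-- The associator of spans. -/
def Roof.associator {x y z t : SpanCat C} (S : Roof x y) (T : Roof y z) (U : Roof z t) :
    (S.comp T).comp U ≅ S.comp (T.comp U) :=
  mkIso
    { hom := Roof.lift ((S.comp T).fst U ≫ S.fst T)
        (Roof.lift ((S.comp T).fst U ≫ S.snd T) ((S.comp T).snd U)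
          (by simpa using (S.comp T).w U))
        (by simp [S.w T])
      inv := Roof.lift
        (Roof.lift (S.fst (T.comp U)) (S.snd (T.comp U) ≫ T.fst U)
          (by simpa using S.w (T.comp U)))
        (S.snd (T.comp U) ≫ T.snd U)
        (by simp [T.w U])
      hom_inv_id := by
        apply Roof.hom_ext
        · apply Roof.hom_ext <;> simp
        · simp
      inv_hom_id := by
        apply Roof.hom_ext
        · simp
        · apply Roof.hom_ext <;> simp }
    (by simp) (by simp)

section

variable {x y z t : SpanCat C} (S S' : Roof x y) (T T' : Roof y z) (U : Roof z t)

@[simp]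
theorem Roof.whiskerLeft_fst (η : T ⟶ T') :
    Roof.Hom.hom (S.whiskerLeft η) ≫ S.fst T' = S.fst T := by
  simp [Roof.whiskerLeft, Roof.compIso]

@[simp]
theorem Roof.whiskerLeft_snd (η : T ⟶ T') :
    Roof.Hom.hom (S.whiskerLeft η) ≫ S.snd T' = S.snd T ≫ Roof.Hom.hom η := by
  simp [Roof.whiskerLeft, Roof.compIso]

@[simp]
theorem Roof.whiskerRight_fst (η : S ⟶ S') :
    Roof.Hom.hom (Roof.whiskerRight η T) ≫ S'.fst T = S.fst T ≫ Roof.Hom.hom η := by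
  simp [Roof.whiskerRight, Roof.compIso]

@[simp]
theorem Roof.whiskerRight_snd (η : S ⟶ S') :
    Roof.Hom.hom (Roof.whiskerRight η T) ≫ S'.snd T = S.snd T := by
  simp [Roof.whiskerRight, Roof.compIso]

@[simp]
theorem Roof.leftUnitor_hom : Roof.Hom.hom S.leftUnitor.hom = (Roof.id x).snd S := rfl

@[simp]
theorem Roof.rightUnitor_hom : Roof.Hom.hom S.rightUnitor.hom = S.fst (Roof.id y) := rfl

@[simp]
theorem Roof.associator_hom_fst : Roof.Hom.hom (S.associator T U).hom ≫ S.fst (T.comp U) =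
    (S.comp T).fst U ≫ S.fst T :=
  Roof.lift_fst _ _ _

theorem Roof.associator_hom_snd : Roof.Hom.hom (S.associator T U).hom ≫ S.snd (T.comp U) =
    Roof.lift ((S.comp T).fst U ≫ S.snd T) ((S.comp T).snd U) (by simpa using (S.comp T).w U) :=
  Roof.lift_snd _ _ _

@[simp]
theorem Roof.associator_hom_snd_fst :
    Roof.Hom.hom (S.associator T U).hom ≫ S.snd (T.comp U) ≫ T.fst U =
      (S.comp T).fst U ≫ S.snd T := by
  rw [← Category.assoc, Roof.associator_hom_snd, Roof.lift_fst]

@[simp]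
theorem Roof.associator_hom_snd_snd :
    Roof.Hom.hom (S.associator T U).hom ≫ S.snd (T.comp U) ≫ T.snd U = (S.comp T).snd U := by
  rw [← Category.assoc, Roof.associator_hom_snd, Roof.lift_snd]

variable {v : C}

@[simp]
theorem Roof.whiskerLeft_fst_assoc (η : T ⟶ T') (k : S.apex ⟶ v) :
    Roof.Hom.hom (S.whiskerLeft η) ≫ S.fst T' ≫ k = S.fst T ≫ k := by
  rw [← Category.assoc, Roof.whiskerLeft_fst]

@[simp]
theorem Roof.whiskerLeft_snd_assoc (η : T ⟶ T') (k : T'.apex ⟶ v) :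
    Roof.Hom.hom (S.whiskerLeft η) ≫ S.snd T' ≫ k = S.snd T ≫ Roof.Hom.hom η ≫ k := by
  rw [← Category.assoc, Roof.whiskerLeft_snd, Category.assoc]

@[simp]
theorem Roof.whiskerRight_fst_assoc (η : S ⟶ S') (k : S'.apex ⟶ v) :
    Roof.Hom.hom (Roof.whiskerRight η T) ≫ S'.fst T ≫ k = S.fst T ≫ Roof.Hom.hom η ≫ k := by
  rw [← Category.assoc, Roof.whiskerRight_fst, Category.assoc]

@[simp]
theorem Roof.whiskerRight_snd_assoc (η : S ⟶ S') (k : T.apex ⟶ v) :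
    Roof.Hom.hom (Roof.whiskerRight η T) ≫ S'.snd T ≫ k = S.snd T ≫ k := by
  rw [← Category.assoc, Roof.whiskerRight_snd]

@[simp]
theorem Roof.associator_hom_fst_assoc (k : S.apex ⟶ v) :
    Roof.Hom.hom (S.associator T U).hom ≫ S.fst (T.comp U) ≫ k =
      (S.comp T).fst U ≫ S.fst T ≫ k := by
  rw [← Category.assoc, Roof.associator_hom_fst, Category.assoc]

@[simp]
theorem Roof.associator_hom_snd_fst_assoc (k : T.apex ⟶ v) :
    Roof.Hom.hom (S.associator T U).hom ≫ S.snd (T.comp U) ≫ T.fst U ≫ k =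
      (S.comp T).fst U ≫ S.snd T ≫ k := by
  have h := S.associator_hom_snd_fst T U
  simpa only [Category.assoc] using congrArg (fun m => m ≫ k) h

@[simp]
theorem Roof.associator_hom_snd_snd_assoc (k : U.apex ⟶ v) :
    Roof.Hom.hom (S.associator T U).hom ≫ S.snd (T.comp U) ≫ T.snd U ≫ k =
      (S.comp T).snd U ≫ k := by
  have h := S.associator_hom_snd_snd T U
  simpa only [Category.assoc] using congrArg (fun m => m ≫ k) h

end

section

variable {x y z t s : SpanCat C}

theorem Roof.id_whiskerRight (S : Roof x y) (T : Roof y z) :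
    Roof.whiskerRight (𝟙 S) T = 𝟙 (S.comp T) := by
  apply hom₂_ext; apply Roof.hom_ext <;> simp

theorem Roof.whiskerLeft_id (S : Roof x y) (T : Roof y z) :
    S.whiskerLeft (𝟙 T) = 𝟙 (S.comp T) := by
  apply hom₂_ext; apply Roof.hom_ext <;> simp

theorem Roof.whiskerLeft_comp (S : Roof x y) {T T' T'' : Roof y z} (η : T ⟶ T') (θ : T' ⟶ T'') :
    S.whiskerLeft (η ≫ θ) = S.whiskerLeft η ≫ S.whiskerLeft θ := by
  apply hom₂_ext; apply Roof.hom_ext <;> simp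

theorem Roof.comp_whiskerRight {S S' S'' : Roof x y} (η : S ⟶ S') (θ : S' ⟶ S'')
    (T : Roof y z) :
    Roof.whiskerRight (η ≫ θ) T = Roof.whiskerRight η T ≫ Roof.whiskerRight θ T := by
  apply hom₂_ext; apply Roof.hom_ext <;> simp

theorem Roof.id_whiskerLeft {S S' : Roof x y} (η : S ⟶ S') :
    (Roof.id x).whiskerLeft η = S.leftUnitor.hom ≫ η ≫ S'.leftUnitor.inv := by
  rw [← Category.assoc, Iso.eq_comp_inv]
  apply hom₂_ext; simp

theorem Roof.whiskerRight_id {S S' : Roof x y} (η : S ⟶ S') :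
    Roof.whiskerRight η (Roof.id y) = S.rightUnitor.hom ≫ η ≫ S'.rightUnitor.inv := by
  rw [← Category.assoc, Iso.eq_comp_inv]
  apply hom₂_ext; simp

theorem Roof.comp_whiskerLeft (S : Roof x y) (T : Roof y z) {U U' : Roof z t} (η : U ⟶ U') :
    (S.comp T).whiskerLeft η = (S.associator T U).hom ≫ S.whiskerLeft (T.whiskerLeft η) ≫
      (S.associator T U').inv := by
  rw [← Category.assoc, Iso.eq_comp_inv]
  apply hom₂_ext; apply Roof.hom_ext
  · simp
  · apply Roof.hom_ext <;> simp

theorem Roof.whisker_assoc (S : Roof x y) {T T' : Roof y z} (η : T ⟶ T') (U : Roof z t) :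
    Roof.whiskerRight (S.whiskerLeft η) U = (S.associator T U).hom ≫
      S.whiskerLeft (Roof.whiskerRight η U) ≫ (S.associator T' U).inv := by
  rw [← Category.assoc, Iso.eq_comp_inv]
  apply hom₂_ext; apply Roof.hom_ext
  · simp
  · apply Roof.hom_ext <;> simp

theorem Roof.whiskerRight_comp {S S' : Roof x y} (η : S ⟶ S') (T : Roof y z) (U : Roof z t) :
    Roof.whiskerRight η (T.comp U) = (S.associator T U).inv ≫
      Roof.whiskerRight (Roof.whiskerRight η T) U ≫ (S'.associator T U).hom := by
  rw [Iso.eq_inv_comp]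
  apply hom₂_ext; apply Roof.hom_ext
  · simp
  · apply Roof.hom_ext <;> simp

theorem Roof.whisker_exchange {S S' : Roof x y} {T T' : Roof y z} (η : S ⟶ S') (θ : T ⟶ T') :
    S.whiskerLeft θ ≫ Roof.whiskerRight η T' = Roof.whiskerRight η T ≫ S'.whiskerLeft θ := by
  apply hom₂_ext; apply Roof.hom_ext <;> simp

theorem Roof.pentagon (S : Roof x y) (T : Roof y z) (U : Roof z t) (V : Roof t s) :
    Roof.whiskerRight (S.associator T U).hom V ≫ (S.associator (T.comp U) V).hom ≫
      S.whiskerLeft (T.associator U V).hom =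
    ((S.comp T).associator U V).hom ≫ (S.associator T (U.comp V)).hom := by
  apply hom₂_ext; apply Roof.hom_ext
  · simp
  · apply Roof.hom_ext
    · simp
    · apply Roof.hom_ext <;> simp

theorem Roof.triangle (S : Roof x y) (T : Roof y z) :
    (S.associator (Roof.id y) T).hom ≫ S.whiskerLeft T.leftUnitor.hom =
      Roof.whiskerRight S.rightUnitor.hom T := by
  apply hom₂_ext; apply Roof.hom_ext <;> simp

end

instance : CategoryStruct (SpanCat C) where
  Hom x y := Roof x y
  id x := Roof.id x
  comp S T := Roof.comp S T

instance : Bicategory (SpanCat C) where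
  homCategory x y := inferInstanceAs (Category (Roof x y))
  whiskerLeft S _ _ η := Roof.whiskerLeft S η
  whiskerRight η T := Roof.whiskerRight η T
  associator S T U := Roof.associator S T U
  leftUnitor S := Roof.leftUnitor S
  rightUnitor S := Roof.rightUnitor S
  whiskerLeft_id := Roof.whiskerLeft_id
  whiskerLeft_comp S _ _ _ η θ := Roof.whiskerLeft_comp S η θ
  id_whiskerLeft η := Roof.id_whiskerLeft η
  comp_whiskerLeft S T _ _ η := Roof.comp_whiskerLeft S T η
  id_whiskerRight := Roof.id_whiskerRight
  comp_whiskerRight η θ T := Roof.comp_whiskerRight η θ T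
  whiskerRight_id η := Roof.whiskerRight_id η
  whiskerRight_comp η T U := Roof.whiskerRight_comp η T U
  whisker_assoc S _ _ η U := Roof.whisker_assoc S η U
  whisker_exchange η θ := Roof.whisker_exchange η θ
  pentagon := Roof.pentagon
  triangle := Roof.triangle

/-- The 1-morphism `(𝟙, x, f)` of spans given by `f : x ⟶ y`. -/
abbrev forward {x y : C} (f : x ⟶ y) : Roof (⟨x⟩ : SpanCat C) ⟨y⟩ := ⟨x, 𝟙 x, f⟩

/-- The 1-morphism `(f, x, 𝟙)` of spans given by `f : x ⟶ y`. -/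
abbrev backward {x y : C} (f : x ⟶ y) : Roof (⟨y⟩ : SpanCat C) ⟨x⟩ := ⟨x, f, 𝟙 x⟩

/-- The canonical isomorphism between `(𝟙, x, f ≫ g)` and the composite of `(𝟙, x, f)` and
`(𝟙, y, g)`. -/
def forwardComp {x y z : C} (f : x ⟶ y) (g : y ⟶ z) :
    forward (f ≫ g) ≅ (forward f).comp (forward g) :=
  mkIso
    { hom := Roof.lift (S := forward f) (T := forward g) (𝟙 _) f (by simp)
      inv := Roof.fst (forward f) (forward g)
      hom_inv_id := by simp
      inv_hom_id := by
        have h := Roof.w (forward f) (forward g)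
        rw [Category.comp_id] at h
        apply Roof.hom_ext <;> simp [h] }
    (by simp) (by simp)

/-- The canonical isomorphism between `(f ≫ g, x, 𝟙)` and the composite of `(g, y, 𝟙)` and
`(f, x, 𝟙)`. -/
def backwardComp {x y z : C} (f : x ⟶ y) (g : y ⟶ z) :
    backward (f ≫ g) ≅ (backward g).comp (backward f) :=
  mkIso
    { hom := Roof.lift (S := backward g) (T := backward f) f (𝟙 _) (by simp)
      inv := Roof.snd (backward g) (backward f)
      hom_inv_id := by simp
      inv_hom_id := by
        have h := Roof.w (backward g) (backward f)
        rw [Category.comp_id] at h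
        apply Roof.hom_ext <;> simp [h] }
    (by simp) (by simp)

section

variable {x y z : C} (f : x ⟶ y) (g : y ⟶ z)

@[simp]
theorem forwardComp_hom_fst :
    Roof.Hom.hom (forwardComp f g).hom ≫ Roof.fst (forward f) (forward g) = 𝟙 x :=
  Roof.lift_fst _ _ _

@[simp]
theorem forwardComp_hom_snd :
    Roof.Hom.hom (forwardComp f g).hom ≫ Roof.snd (forward f) (forward g) = f :=
  Roof.lift_snd _ _ _

@[simp]
theorem backwardComp_hom_fst :
    Roof.Hom.hom (backwardComp f g).hom ≫ Roof.fst (backward g) (backward f) = f :=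
  Roof.lift_fst _ _ _

@[simp]
theorem backwardComp_hom_snd :
    Roof.Hom.hom (backwardComp f g).hom ≫ Roof.snd (backward g) (backward f) = 𝟙 x :=
  Roof.lift_snd _ _ _

@[simp]
theorem forwardComp_hom_fst_assoc {u : C} (k : x ⟶ u) :
    Roof.Hom.hom (forwardComp f g).hom ≫ Roof.fst (forward f) (forward g) ≫ k = k := by
  rw [← Category.assoc, forwardComp_hom_fst]; exact Category.id_comp k

@[simp]
theorem forwardComp_hom_snd_assoc {u : C} (k : y ⟶ u) :
    Roof.Hom.hom (forwardComp f g).hom ≫ Roof.snd (forward f) (forward g) ≫ k = f ≫ k := by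
  rw [← Category.assoc, forwardComp_hom_snd]

@[simp]
theorem backwardComp_hom_fst_assoc {u : C} (k : y ⟶ u) :
    Roof.Hom.hom (backwardComp f g).hom ≫ Roof.fst (backward g) (backward f) ≫ k = f ≫ k := by
  rw [← Category.assoc, backwardComp_hom_fst]

@[simp]
theorem backwardComp_hom_snd_assoc {u : C} (k : x ⟶ u) :
    Roof.Hom.hom (backwardComp f g).hom ≫ Roof.snd (backward g) (backward f) ≫ k = k := by
  rw [← Category.assoc, backwardComp_hom_snd]; exact Category.id_comp k

end

theorem forward_assoc {x y z t : C} (f : x ⟶ y) (g : y ⟶ z) (h : z ⟶ t) :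
    (forwardComp (f ≫ g) h).hom ≫ Roof.whiskerRight (forwardComp f g).hom (forward h) ≫
      (Roof.associator (forward f) (forward g) (forward h)).hom =
    eqToHom (by simp) ≫ (forwardComp f (g ≫ h)).hom ≫
      Roof.whiskerLeft (forward f) (forwardComp g h).hom := by
  apply hom₂_ext
  apply Roof.hom_ext
  · simp
  · apply Roof.hom_ext <;> simp

theorem backward_assoc {x y z t : C} (f : x ⟶ y) (g : y ⟶ z) (h : z ⟶ t) :
    (backwardComp f (g ≫ h)).hom ≫ Roof.whiskerRight (backwardComp g h).hom (backward f) ≫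
      (Roof.associator (backward h) (backward g) (backward f)).hom =
    eqToHom (by simp) ≫ (backwardComp (f ≫ g) h).hom ≫
      Roof.whiskerLeft (backward h) (backwardComp f g).hom := by
  apply hom₂_ext
  apply Roof.hom_ext
  · simp
  · apply Roof.hom_ext <;> simp

theorem forward_left {x y : C} (f : x ⟶ y) :
    (forwardComp (𝟙 x) f).hom ≫ (Roof.leftUnitor (forward f)).hom = eqToHom (by simp) := by
  apply hom₂_ext
  rw [eqToHom_hom]
  exact forwardComp_hom_snd (𝟙 x) f

theorem forward_right {x y : C} (f : x ⟶ y) :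
    (forwardComp f (𝟙 y)).hom ≫ (Roof.rightUnitor (forward f)).hom = eqToHom (by simp) := by
  apply hom₂_ext
  rw [eqToHom_hom]
  exact forwardComp_hom_fst f (𝟙 y)

theorem backward_left {x y : C} (f : x ⟶ y) :
    (backwardComp f (𝟙 y)).hom ≫ (Roof.leftUnitor (backward f)).hom = eqToHom (by simp) := by
  apply hom₂_ext
  rw [eqToHom_hom]
  exact backwardComp_hom_snd f (𝟙 y)

theorem backward_right {x y : C} (f : x ⟶ y) :
    (backwardComp (𝟙 x) f).hom ≫ (Roof.rightUnitor (backward f)).hom = eqToHom (by simp) := by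
  apply hom₂_ext
  rw [eqToHom_hom]
  exact backwardComp_hom_fst (𝟙 x) f

/-- The embedding of `C` into spans, `f ↦ (𝟙, x, f)`. -/
def i : TwoFunctor (K := SpanCat C) C (fun x => ⟨x⟩) where
  map f := forward f
  mapId x := Iso.refl _
  mapComp f g := forwardComp f g
  map₂_associator f g h := by
    have e := congrArg (fun u => u ≫ Roof.whiskerLeft (forward f) (forwardComp g h).inv ≫
      (forwardComp f (g ≫ h)).inv) (forward_assoc f g h)
    simp only [Category.assoc] at e
    refine e.trans ?_
    rw [← Category.assoc (Roof.whiskerLeft _ _), ← Roof.whiskerLeft_comp, Iso.hom_inv_id,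
      Roof.whiskerLeft_id, Category.id_comp, Iso.hom_inv_id]
    exact Category.comp_id _
  map₂_left_unitor f := by
    refine Eq.trans ?_ (forward_left f)
    exact congrArg (fun u => (forwardComp (𝟙 _) f).hom ≫ u ≫ (Roof.leftUnitor (forward f)).hom)
      (Roof.id_whiskerRight _ _) |>.trans (by simp)
  map₂_right_unitor f := by
    refine Eq.trans ?_ (forward_right f)
    exact congrArg (fun u => (forwardComp f (𝟙 _)).hom ≫ u ≫ (Roof.rightUnitor (forward f)).hom)
      (Roof.whiskerLeft_id _ _) |>.trans (by simp)

/-- The embedding of `Cᵒᵖ` into spans, `f ↦ (f, x, 𝟙)`. -/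
def j : TwoFunctor (K := SpanCat C) Cᵒᵖ (fun x => ⟨x.unop⟩) where
  map f := backward f.unop
  mapId x := Iso.refl _
  mapComp f g := backwardComp g.unop f.unop
  map₂_associator f g h := by
    have e := congrArg (fun u => u ≫ Roof.whiskerLeft (backward f.unop)
      (backwardComp h.unop g.unop).inv ≫ (backwardComp (h.unop ≫ g.unop) f.unop).inv)
      (backward_assoc h.unop g.unop f.unop)
    simp only [Category.assoc] at e
    refine e.trans ?_
    rw [← Category.assoc (Roof.whiskerLeft _ _), ← Roof.whiskerLeft_comp, Iso.hom_inv_id,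
      Roof.whiskerLeft_id, Category.id_comp, Iso.hom_inv_id]
    exact Category.comp_id _
  map₂_left_unitor f := by
    refine Eq.trans ?_ (backward_left f.unop)
    exact congrArg (fun u => (backwardComp f.unop (𝟙 _)).hom ≫ u ≫
      (Roof.leftUnitor (backward f.unop)).hom) (Roof.id_whiskerRight _ _) |>.trans (by simp)
  map₂_right_unitor f := by
    refine Eq.trans ?_ (backward_right f.unop)
    exact congrArg (fun u => (backwardComp (𝟙 _) f.unop).hom ≫ u ≫
      (Roof.rightUnitor (backward f.unop)).hom) (Roof.whiskerLeft_id _ _) |>.trans (by simp)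

/-- For a cartesian square, the canonical isomorphism between the composite of `(𝟙, c, p)` and
`(h, b, 𝟙)` and the composite of `(f, a, 𝟙)` and `(𝟙, a, g)`; both are isomorphic to
`(f, a, g)`. -/
def square {a b c d : C} {f : a ⟶ c} {g : a ⟶ b} {p : c ⟶ d} {h : b ⟶ d}
    (Q : IsPullback f g p h) :
    (i.map p ≫ j.map h.op : (⟨c⟩ : SpanCat C) ⟶ ⟨b⟩) ≅ j.map f.op ≫ i.map g :=
  (mkIso (T := (forward p).comp (backward h)) (S := ⟨a, f, g⟩)
    (Q.isoIsPullback _ _ ((forward p).isPullback (backward h)))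
    (by simp) (by simp)).symm ≪≫
  mkIso (T := (backward f).comp (forward g)) (S := ⟨a, f, g⟩)
    { hom := Roof.lift (S := backward f) (T := forward g) (𝟙 _) (𝟙 _) (by simp)
      inv := Roof.fst (backward f) (forward g)
      hom_inv_id := by simp
      inv_hom_id := by
        have h := Roof.w (backward f) (forward g)
        rw [Category.comp_id, Category.comp_id] at h
        apply Roof.hom_ext <;> simp [h] }
    (by simp) (by simp)

end SpanCat

end Spans

/-! ### Mackey functors -/

section Mackey

variable {C : Type u₁} [Category.{v₁} C] {K : Type u₂} [Bicategory.{w, v₂} K]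

/-- Base change isomorphisms `P p ≫ N h ≅ N f ≫ P g`, for all cartesian squares, between a
covariant 2-functor `P` and a contravariant 2-functor `N` on `C` which agree on objects. -/
abbrev BaseChangeData {obj : C → K} (P : TwoFunctor C obj)
    (N : TwoFunctor Cᵒᵖ (fun x => obj x.unop)) :=
  ∀ ⦃a b c d : C⦄ ⦃f : a ⟶ c⦄ ⦃g : a ⟶ b⦄ ⦃p : c ⟶ d⦄ ⦃h : b ⟶ d⦄, IsPullback f g p h →
    (P.map p ≫ N.map h.op ≅ N.map f.op ≫ P.map g)

variable [HasPullbacks C] {obj : C → K}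

/-- A pseudofunctor `F` on the (2,1)-category of spans in `C`, together with equivalences
`i^* F ≃ P` and `j^* F ≃ N` which agree on objects, where `i` and `j` are the embeddings of `C`
and `Cᵒᵖ`. -/
structure SpanExtension (P : TwoFunctor C obj) (N : TwoFunctor Cᵒᵖ (fun x => obj x.unop)) where
  functor : SpanCat C ⥤ᵖ K
  /-- The equivalence `i^* F ≃ P`. -/
  resP : Pseudofunctor.StrongTrans (SpanCat.i.toPseudofunctor.comp functor) P.toPseudofunctor
  resP_equivalence (x : C) : ∃ e : functor.obj ⟨x⟩ ≌ obj x, e.hom = resP.app ⟨x⟩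
  /-- The equivalence `j^* F ≃ N`. -/
  resN : Pseudofunctor.StrongTrans (SpanCat.j.toPseudofunctor.comp functor) N.toPseudofunctor
  resN_equivalence (x : C) : ∃ e : functor.obj ⟨x⟩ ≌ obj x, e.hom = resN.app ⟨op x⟩
  /-- The two equivalences agree on objects. -/
  appIso (x : C) : resN.app ⟨op x⟩ ≅ resP.app ⟨x⟩

namespace SpanExtension

variable {P : TwoFunctor C obj} {N : TwoFunctor Cᵒᵖ (fun x => obj x.unop)}
  (M : SpanExtension P N)

/-- The common value of the two equivalences on objects. -/
def app (x : C) : M.functor.obj ⟨x⟩ ⟶ obj x := M.resP.app ⟨x⟩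

/-- The identification of `F (𝟙, x, f)` with `P f`. -/
def isoP {x y : C} (f : x ⟶ y) :
    M.functor.map (SpanCat.i.map f) ≫ M.app y ≅ M.app x ≫ P.map f :=
  M.resP.naturality f.toLoc

/-- The identification of `F (f, x, 𝟙)` with `N f`. -/
def isoN {x y : C} (f : x ⟶ y) :
    M.functor.map (SpanCat.j.map f.op) ≫ M.app x ≅ M.app y ≫ N.map f.op :=
  whiskerLeftIso _ (M.appIso x).symm ≪≫ M.resN.naturality f.op.toLoc ≪≫
    whiskerRightIso (M.appIso y) (N.map f.op)

/-- The base change isomorphism of `F` for a cartesian square. -/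
def squareIso {a b c d : C} {f : a ⟶ c} {g : a ⟶ b} {p : c ⟶ d} {h : b ⟶ d}
    (Q : IsPullback f g p h) :
    M.functor.map (SpanCat.i.map p) ≫ M.functor.map (SpanCat.j.map h.op) ≅
      M.functor.map (SpanCat.j.map f.op) ≫ M.functor.map (SpanCat.i.map g) :=
  (M.functor.mapComp _ _).symm ≪≫ M.functor.map₂Iso (SpanCat.square Q) ≪≫ M.functor.mapComp _ _

/-- The identification of `F (𝟙, c, p) ≫ F (h, b, 𝟙)` with `P p ≫ N h`. -/
def isoPN {b c d : C} (p : c ⟶ d) (h : b ⟶ d) :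
    (M.functor.map (SpanCat.i.map p) ≫ M.functor.map (SpanCat.j.map h.op)) ≫ M.app b ≅
      M.app c ≫ P.map p ≫ N.map h.op :=
  α_ _ _ _ ≪≫ whiskerLeftIso _ (M.isoN h) ≪≫ (α_ _ _ _).symm ≪≫
    whiskerRightIso (M.isoP p) _ ≪≫ α_ _ _ _

/-- The identification of `F (f, a, 𝟙) ≫ F (𝟙, a, g)` with `N f ≫ P g`. -/
def isoNP {a b c : C} (f : a ⟶ c) (g : a ⟶ b) :
    (M.functor.map (SpanCat.j.map f.op) ≫ M.functor.map (SpanCat.i.map g)) ≫ M.app b ≅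
      M.app c ≫ N.map f.op ≫ P.map g :=
  α_ _ _ _ ≪≫ whiskerLeftIso _ (M.isoP g) ≪≫ (α_ _ _ _).symm ≪≫
    whiskerRightIso (M.isoN f) _ ≪≫ α_ _ _ _

end SpanExtension

/-- A Mackey functor associated with `P`, `N` and base change isomorphisms `β`: a pseudofunctor on
the (2,1)-category of spans which restricts to `P` and `N` along the two embeddings and whose base
change isomorphisms correspond to `β`. -/
structure MackeyFunctor (P : TwoFunctor C obj) (N : TwoFunctor Cᵒᵖ (fun x => obj x.unop))
    (β : BaseChangeData P N) extends SpanExtension P N where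
  baseChange {a b c d : C} {f : a ⟶ c} {g : a ⟶ b} {p : c ⟶ d} {h : b ⟶ d}
    (Q : IsPullback f g p h) :
    (toSpanExtension.squareIso Q).hom ▷ toSpanExtension.app b ≫
      (toSpanExtension.isoNP f g).hom =
    (toSpanExtension.isoPN p h).hom ≫ toSpanExtension.app c ◁ (β Q).hom

/-- An equivalence of Mackey functors: an equivalence of pseudofunctors which is compatible with
the identifications of the restrictions with `P` and `N`. -/
structure MackeyFunctor.Equiv {P : TwoFunctor C obj} {N : TwoFunctor Cᵒᵖ (fun x => obj x.unop)}
    {β : BaseChangeData P N} (M M' : MackeyFunctor P N β) where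
  trans : Pseudofunctor.StrongTrans M.functor M'.functor
  trans_equivalence (x : SpanCat C) :
    ∃ e : M.functor.obj x ≌ M'.functor.obj x, e.hom = trans.app x
  iso (x : C) : trans.app ⟨x⟩ ≫ M'.app x ≅ M.app x
  comm_P {x y : C} (f : x ⟶ y) :
    M.functor.map (SpanCat.i.map f) ◁ (iso y).hom ≫ (M.isoP f).hom =
      (α_ _ _ _).inv ≫ (trans.naturality (SpanCat.i.map f)).hom ▷ M'.app y ≫ (α_ _ _ _).hom ≫
        trans.app ⟨x⟩ ◁ (M'.isoP f).hom ≫ (α_ _ _ _).inv ≫ (iso x).hom ▷ P.map f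
  comm_N {x y : C} (f : x ⟶ y) :
    M.functor.map (SpanCat.j.map f.op) ◁ (iso x).hom ≫ (M.isoN f).hom =
      (α_ _ _ _).inv ≫ (trans.naturality (SpanCat.j.map f.op)).hom ▷ M'.app x ≫ (α_ _ _ _).hom ≫
        trans.app ⟨y⟩ ◁ (M'.isoN f).hom ≫ (α_ _ _ _).inv ≫ (iso y).hom ▷ N.map f.op

end Mackey

/-! ### Ringed `D`-topoi and their modules -/

section Topoi

/-- A category is a (Grothendieck) topos if it is equivalent to the category of sheaves of sets on
a small site. -/
def IsGrothendieckTopos (T : Type u₁) [Category.{v₁} T] : Prop :=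
  ∃ (S : Type w) (_ : SmallCategory S) (J : GrothendieckTopology S),
    Nonempty (T ≌ Sheaf J (Type w))

theorem IsGrothendieckTopos.hasFiniteProducts {T : Type u₁} [Category.{v₁} T]
    (h : IsGrothendieckTopos.{w} T) : HasFiniteProducts T := by
  obtain ⟨S, _, J, ⟨e⟩⟩ := h
  exact ⟨fun n => Adjunction.hasLimitsOfShape_of_equivalence e.functor⟩

/-- A `D`-topos: a category bifibered over `D` whose fibers are topoi, such that for every
`m : i ⟶ j` in `D` the direct image functor `m_*` from the fiber over `i` to the fiber over `j`
preserves finite limits. Hence `m_* = f^*` is the inverse image part of a morphism of topoi from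
the fiber over `j` to the fiber over `i`, whose direct image part is `m^* = f_*`. -/
structure DTopos (D : Type u₁) [Category.{v₁} D] where
  Total : Type u₂
  [category : Category.{v₂} Total]
  proj : Total ⥤ D
  isFibered : proj.IsFibered
  isTopos (i : D) : IsGrothendieckTopos.{w} (proj.Fiber i)
  exists_directImage {i j : D} (m : i ⟶ j) :
    ∃ (F : proj.Fiber i ⥤ proj.Fiber j)
      (κ : Functor.Fiber.fiberInclusion ⟶ F ⋙ Functor.Fiber.fiberInclusion),
      (∀ T, proj.IsStronglyCocartesian m (κ.app T)) ∧ PreservesFiniteLimits F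

attribute [instance] DTopos.category

namespace DTopos

variable {D : Type u₁} [Category.{v₁} D] (E : DTopos.{w, v₁, v₂, u₁, u₂} D)

/-- The fiber of a `D`-topos. -/
abbrev Fib (i : D) := E.proj.Fiber i

instance (i : D) : HasFiniteProducts (E.Fib i) := (E.isTopos i).hasFiniteProducts

instance (i : D) : CartesianMonoidalCategory (E.Fib i) := .ofHasFiniteProducts

instance (i : D) : BraidedCategory (E.Fib i) := .ofCartesianMonoidalCategory

variable {E}

/-- The square with horizontal sides `κ : T ⟶ T'` and `φ : X ⟶ Y` in the total category, and
vertical sides `x : T ⟶ X` and `y : T' ⟶ Y` in fibers, commutes. If `κ` is the cocartesian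
morphism from `T` to `T' = m_* T`, then `y` is the composite of `m_* x` and of the morphism
`m_* X ⟶ Y` given by `φ`. -/
def Sq {i j : D} {T X : E.Fib i} {T' Y : E.Fib j} (κ : T.1 ⟶ T'.1) (φ : X.1 ⟶ Y.1)
    (x : T ⟶ X) (y : T' ⟶ Y) : Prop :=
  κ ≫ y.1 = x.1 ≫ φ

theorem exists_factor {i j k : D} (m : i ⟶ j) (n : j ⟶ k) {T : E.Fib i} {T' : E.Fib k}
    (κ : T.1 ⟶ T'.1) [E.proj.IsHomLift (m ≫ n) κ] :
    ∃ (T₁ : E.Fib j) (κ₁ : T.1 ⟶ T₁.1) (κ₂ : T₁.1 ⟶ T'.1),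
      E.proj.IsStronglyCocartesian m κ₁ ∧ E.proj.IsHomLift n κ₂ ∧ κ₁ ≫ κ₂ = κ := by
  obtain ⟨F, c, hc, -⟩ := E.exists_directImage m
  obtain ⟨κ₁, h⟩ : ∃ κ₁ : T.1 ⟶ (F.obj T).1, E.proj.IsStronglyCocartesian m κ₁ := ⟨c.app T, hc T⟩
  obtain ⟨χ, ⟨h₁, h₂⟩, -⟩ := Functor.IsStronglyCocartesian.universal_property E.proj m κ₁ n
    (m ≫ n) rfl κ
  exact ⟨F.obj T, κ₁, χ, h, h₁, h₂⟩

theorem exists_sq {i j : D} (m : i ⟶ j) {T X : E.Fib i} {T' Y : E.Fib j} (κ : T.1 ⟶ T'.1)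
    [E.proj.IsStronglyCocartesian m κ] (φ : X.1 ⟶ Y.1) [E.proj.IsHomLift m φ] (x : T ⟶ X) :
    ∃ y : T' ⟶ Y, Sq κ φ x y := by
  have hx : E.proj.IsHomLift (𝟙 i) x.1 := x.2
  have hx' : E.proj.IsHomLift m (x.1 ≫ φ) := inferInstance
  obtain ⟨χ, ⟨h₁, h₂⟩, -⟩ := Functor.IsStronglyCocartesian.universal_property E.proj m κ (𝟙 j) m
    (Category.comp_id m).symm (x.1 ≫ φ)
  exact ⟨⟨χ, h₁⟩, h₂⟩

theorem Sq.comp {i j k : D} {T X : E.Fib i} {T₁ Y : E.Fib j} {T' Z : E.Fib k}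
    {κ₁ : T.1 ⟶ T₁.1} {κ₂ : T₁.1 ⟶ T'.1} {φ : X.1 ⟶ Y.1} {ψ : Y.1 ⟶ Z.1} {x : T ⟶ X}
    {y : T₁ ⟶ Y} {z : T' ⟶ Z} (h₁ : Sq κ₁ φ x y) (h₂ : Sq κ₂ ψ y z) :
    Sq (κ₁ ≫ κ₂) (φ ≫ ψ) x z := by
  unfold Sq at *
  rw [Category.assoc, h₂, ← Category.assoc, h₁, Category.assoc]

theorem Sq.of_comp {i j k : D} (m : i ⟶ j) (n : j ⟶ k) {T X : E.Fib i} {T₁ Y : E.Fib j}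
    {T' Z : E.Fib k} {κ₁ : T.1 ⟶ T₁.1} {κ₂ : T₁.1 ⟶ T'.1} {φ : X.1 ⟶ Y.1} {ψ : Y.1 ⟶ Z.1}
    {x : T ⟶ X} {y : T₁ ⟶ Y} {z : T' ⟶ Z} [E.proj.IsStronglyCocartesian m κ₁]
    [E.proj.IsHomLift n κ₂] [E.proj.IsHomLift n ψ]
    (h₁ : Sq κ₁ φ x y) (h : Sq (κ₁ ≫ κ₂) (φ ≫ ψ) x z) : Sq κ₂ ψ y z := by
  have hy : E.proj.IsHomLift (𝟙 j) y.1 := y.2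
  have hz : E.proj.IsHomLift (𝟙 k) z.1 := z.2
  have e₁ : E.proj.IsHomLift n (κ₂ ≫ z.1) := inferInstance
  have e₂ : E.proj.IsHomLift n (y.1 ≫ ψ) := inferInstance
  unfold Sq at *
  refine Functor.IsStronglyCocartesian.ext E.proj m κ₁ n ?_
  rw [← Category.assoc, h, ← Category.assoc, ← Category.assoc, h₁]

theorem exists_of_id {i : D} {T T' : E.Fib i} (κ : T.1 ⟶ T'.1) [h : E.proj.IsHomLift (𝟙 i) κ] :
    ∃ k : T ⟶ T', k.1 = κ := ⟨⟨κ, h⟩, rfl⟩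

theorem sq_id {i : D} {T T' X : E.Fib i} (k : T ⟶ T') (x : T ⟶ X) (y : T' ⟶ X) :
    Sq k.1 (𝟙 X.1) x y ↔ k ≫ y = x := by
  unfold Sq
  rw [Category.comp_id]
  exact (Subtype.ext_iff (a1 := k ≫ y) (a2 := x)).symm

end DTopos

open scoped MonObj AddMonObj RingObj

/-- A ringed `D`-topos: a `D`-topos with a ring object `A_i` in every fiber and a compatible family
of ring morphisms `m_* A_i ⟶ A_j`, which correspond to morphisms `A_i ⟶ A_j` over `m` in the total
category. -/
structure RingedDTopos (D : Type u₁) [Category.{v₁} D] where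
  topos : DTopos.{w, v₁, v₂, u₁, u₂} D
  ring (i : D) : topos.Fib i
  [ringObj (i : D) : RingObj (ring i)]
  ringMap {i j : D} (m : i ⟶ j) : (ring i).1 ⟶ (ring j).1
  ringMap_isHomLift {i j : D} (m : i ⟶ j) : topos.proj.IsHomLift m (ringMap m)
  ringMap_id (i : D) : ringMap (𝟙 i) = 𝟙 (ring i).1
  ringMap_comp {i j k : D} (m : i ⟶ j) (n : j ⟶ k) : ringMap (m ≫ n) = ringMap m ≫ ringMap n
  ringMap_add {i j : D} (m : i ⟶ j) {T : topos.Fib i} {T' : topos.Fib j} (κ : T.1 ⟶ T'.1)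
    [topos.proj.IsHomLift m κ] (a a' : T ⟶ ring i) (b b' : T' ⟶ ring j) :
    DTopos.Sq κ (ringMap m) a b → DTopos.Sq κ (ringMap m) a' b' →
      DTopos.Sq κ (ringMap m) (a + a') (b + b')
  ringMap_mul {i j : D} (m : i ⟶ j) {T : topos.Fib i} {T' : topos.Fib j} (κ : T.1 ⟶ T'.1)
    [topos.proj.IsHomLift m κ] (a a' : T ⟶ ring i) (b b' : T' ⟶ ring j) :
    DTopos.Sq κ (ringMap m) a b → DTopos.Sq κ (ringMap m) a' b' →
      DTopos.Sq κ (ringMap m) (a * a') (b * b')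
  ringMap_one {i j : D} (m : i ⟶ j) {T : topos.Fib i} {T' : topos.Fib j} (κ : T.1 ⟶ T'.1)
    [topos.proj.IsHomLift m κ] : DTopos.Sq κ (ringMap m) (1 : T ⟶ ring i) (1 : T' ⟶ ring j)

attribute [instance] RingedDTopos.ringObj

variable {D : Type u₁} [Category.{v₁} D] (E : RingedDTopos.{w, v₁, v₂, u₁, u₂} D)

/-- A module over the ring `A_i` in the fiber over `i`. -/
structure RModule (i : D) where
  carrier : E.topos.Fib i
  [addGrpObj : AddGrpObj carrier]
  [isComm : IsCommAddMonObj carrier]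
  [modObj : ModObj (E.ring i) carrier]
  smul_add {T : E.topos.Fib i} (a : T ⟶ E.ring i) (x y : T ⟶ carrier) : a • (x + y) = a • x + a • y
  add_smul {T : E.topos.Fib i} (a b : T ⟶ E.ring i) (x : T ⟶ carrier) : (a + b) • x = a • x + b • x

attribute [instance] RModule.addGrpObj RModule.isComm RModule.modObj

/-- The total category of the bifibration `Mod(E, A)`. Its objects are pairs of an object of `D` and
a module over the corresponding ring. -/
structure ModTotal where
  base : D
  mod : RModule E base

/-- A morphism from `(i, X)` to `(j, Y)` is a morphism `m : i ⟶ j` in `D` together with a morphism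
`X ⟶ Y` over `m` in the total category of `E` which is additive and semilinear over `A_i ⟶ A_j`;
equivalently, with an `A_i`-linear morphism from `X` to `m^* Y`. -/
@[ext]
structure ModTotal.Hom (X Y : ModTotal E) where
  base : X.base ⟶ Y.base
  hom : X.mod.carrier.1 ⟶ Y.mod.carrier.1
  isHomLift : E.topos.proj.IsHomLift base hom
  map_add {T : E.topos.Fib X.base} {T' : E.topos.Fib Y.base} (κ : T.1 ⟶ T'.1) [E.topos.proj.IsHomLift base κ]
    (x x' : T ⟶ X.mod.carrier) (y y' : T' ⟶ Y.mod.carrier) :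
    DTopos.Sq κ hom x y → DTopos.Sq κ hom x' y' → DTopos.Sq κ hom (x + x') (y + y')
  map_smul {T : E.topos.Fib X.base} {T' : E.topos.Fib Y.base} (κ : T.1 ⟶ T'.1) [E.topos.proj.IsHomLift base κ]
    (a : T ⟶ E.ring X.base) (b : T' ⟶ E.ring Y.base)
    (x : T ⟶ X.mod.carrier) (y : T' ⟶ Y.mod.carrier) :
    DTopos.Sq κ (E.ringMap base) a b → DTopos.Sq κ hom x y → DTopos.Sq κ hom (a • x) (b • y)

namespace ModTotal

variable {E}

/-- The identity morphism. -/
def id (X : ModTotal E) : Hom E X X where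
  base := 𝟙 _
  hom := 𝟙 _
  isHomLift := IsHomLift.id X.mod.carrier.2
  map_add κ _ x x' y y' h h' := by
    obtain ⟨k, rfl⟩ := DTopos.exists_of_id κ
    rw [DTopos.sq_id] at *
    rw [AddMonObj.comp_add, h, h']
  map_smul κ _ a b x y h h' := by
    obtain ⟨k, rfl⟩ := DTopos.exists_of_id κ
    rw [E.ringMap_id, DTopos.sq_id] at h
    rw [DTopos.sq_id] at *
    rw [ModObj.comp_smul, h, h']

/-- Composition of morphisms. -/
def comp {X Y Z : ModTotal E} (φ : Hom E X Y) (ψ : Hom E Y Z) : Hom E X Z where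
  base := φ.base ≫ ψ.base
  hom := φ.hom ≫ ψ.hom
  isHomLift := by
    have := φ.isHomLift
    have := ψ.isHomLift
    infer_instance
  map_add κ _ x x' y y' h h' := by
    have := φ.isHomLift
    have := ψ.isHomLift
    obtain ⟨T₁, κ₁, κ₂, _, _, rfl⟩ := DTopos.exists_factor φ.base ψ.base κ
    obtain ⟨z, hz⟩ := DTopos.exists_sq φ.base κ₁ φ.hom x
    obtain ⟨z', hz'⟩ := DTopos.exists_sq φ.base κ₁ φ.hom x'
    exact (φ.map_add κ₁ x x' z z' hz hz').comp (ψ.map_add κ₂ z z' y y'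
      (hz.of_comp φ.base ψ.base h) (hz'.of_comp φ.base ψ.base h'))
  map_smul κ _ a b x y h h' := by
    have := φ.isHomLift
    have := ψ.isHomLift
    have := E.ringMap_isHomLift φ.base
    have := E.ringMap_isHomLift ψ.base
    obtain ⟨T₁, κ₁, κ₂, _, _, rfl⟩ := DTopos.exists_factor φ.base ψ.base κ
    obtain ⟨c, hc⟩ := DTopos.exists_sq φ.base κ₁ (E.ringMap φ.base) a
    obtain ⟨z, hz⟩ := DTopos.exists_sq φ.base κ₁ φ.hom x
    rw [E.ringMap_comp] at h
    exact (φ.map_smul κ₁ a c x z hc hz).comp (ψ.map_smul κ₂ c b z y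
      (hc.of_comp φ.base ψ.base h) (hz.of_comp φ.base ψ.base h'))

instance : Category (ModTotal E) where
  Hom X Y := Hom E X Y
  id X := id X
  comp φ ψ := comp φ ψ
  id_comp φ := Hom.ext (Category.id_comp φ.base) (Category.id_comp φ.hom)
  comp_id φ := Hom.ext (Category.comp_id φ.base) (Category.comp_id φ.hom)
  assoc φ ψ χ := Hom.ext (Category.assoc φ.base ψ.base χ.base) (Category.assoc φ.hom ψ.hom χ.hom)

variable (E) in
/-- The projection of `Mod(E, A)` to `D`. -/
def proj : ModTotal E ⥤ D where
  obj X := X.base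
  map φ := Hom.base φ

end ModTotal

end Topoi

/-! ### Grothendieck cross functors and their Mackey functors -/

section GrothendieckCrossFunctors

/-- A Grothendieck cross functor associated with a ringed `D`-topos `(E, A)`: a cross functor from
`Dᵒᵖ` to `Cat`, relative to the cartesian squares of `Dᵒᵖ` (the cocartesian squares of `D`), such
that the bifibration over `D` which corresponds to `H_*` and `H^*` is equivalent to `Mod(E, A)`,
together with an isomorphism of 2-functors `H_! ≅ H_*` which is the identity on objects. -/
structure GrothendieckCrossFunctor {D : Type u₁} [Category.{v₁} D]
    (E : RingedDTopos.{w, v₁, v₂, u₁, u₂} D)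
    extends CrossFunctor Dᵒᵖ Cat.{v₃, u₃} (cartesianSquares Dᵒᵖ) where
  /-- The category obtained by gluing the categories `obj x` along the functors `f_*` is equivalent
  to `Mod(E, A)` over `D`. -/
  exists_equivalence :
    ∃ Φ : Pseudofunctor.CoGrothendieck lowerStar.toPseudofunctor ⥤ ModTotal E,
      Φ.IsEquivalence ∧ Φ ⋙ ModTotal.proj E = Pseudofunctor.CoGrothendieck.forget _
  lowerIso {x y : Dᵒᵖ} (f : x ⟶ y) : lowerShriek.map f ≅ lowerStar.map f
  lowerIso_id (x : Dᵒᵖ) :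
    (lowerIso (𝟙 x)).hom ≫ (lowerStar.mapId x).hom = (lowerShriek.mapId x).hom
  lowerIso_comp {x y z : Dᵒᵖ} (f : x ⟶ y) (g : y ⟶ z) :
    (lowerIso (f ≫ g)).hom ≫ (lowerStar.mapComp f g).hom =
      (lowerShriek.mapComp f g).hom ≫ (lowerIso f).hom ▷ lowerShriek.map g ≫
        lowerStar.map f ◁ (lowerIso g).hom

namespace GrothendieckCrossFunctor

variable {D : Type u₁} [Category.{v₁} D] [HasPullbacks Dᵒᵖ]
  {E : RingedDTopos.{w, v₁, v₂, u₁, u₂} D} (H : GrothendieckCrossFunctor.{w, v₁, v₂, v₃} E)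

/-- The isomorphism `h^* p_! ≅ g_! f^*`. -/
def baseChangeStarShriek : BaseChangeData H.lowerShriek H.upperStar :=
  fun _ _ _ _ _ _ _ _ Q => H.baseChange Q

/-- The isomorphism `p^! h_* ≅ f_* g^!`, as an isomorphism between contravariant functors. -/
def baseChangeShriekStar : BaseChangeData H.upperShriek.opContra H.lowerStar.opCov :=
  fun _ _ _ _ _ _ _ _ Q => (H.baseChangeRight Q).op2

/-- The isomorphism `p^* h_* ≅ f_* g^*`, as an isomorphism between contravariant functors. It is
`p^* h_! ≅ f_! g^*`, read through `H_! ≅ H_*`. -/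
def baseChangeStarStar : BaseChangeData H.upperStar.opContra H.lowerStar.opCov :=
  fun _ _ _ _ f g p h Q =>
    (whiskerRightIso (H.lowerIso h).symm (H.upperStar.map p.op) ≪≫ H.baseChange Q.flip ≪≫
      whiskerLeftIso (H.upperStar.map g.op) (H.lowerIso f)).op2

/-- The isomorphism `h^! p_! ≅ g_! f^!`. It is `h^! p_* ≅ g_* f^!`, read through `H_! ≅ H_*`. -/
def baseChangeShriekShriek : BaseChangeData H.lowerShriek H.upperShriek :=
  fun _ _ _ _ f g p h Q =>
    whiskerRightIso (H.lowerIso p) (H.upperShriek.map h.op) ≪≫ H.baseChangeRight Q.flip ≪≫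
      whiskerLeftIso (H.upperShriek.map f.op) (H.lowerIso g).symm

/-- A Mackey `*!`-functor: a pseudofunctor from spans in `Dᵒᵖ` to `Cat` which restricts to `H_!`
and `H^*`. It sends a span `(l, z, r)` to `r_! l^*`. -/
abbrev MackeyStarShriek := MackeyFunctor H.lowerShriek H.upperStar H.baseChangeStarShriek

/-- A Mackey `!*`-functor: a contravariant pseudofunctor from spans in `Dᵒᵖ` to `Cat` which
restricts to `H^!` and `H_*`. It sends a span `(l, z, r)` to `l_* r^!`. -/
abbrev MackeyShriekStar :=
  MackeyFunctor H.upperShriek.opContra H.lowerStar.opCov H.baseChangeShriekStar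

/-- A Mackey `**`-functor: a contravariant pseudofunctor from spans in `Dᵒᵖ` to `Cat` which
restricts to `H^*` and `H_*`. It sends a span `(l, z, r)` to `l_* r^*`. -/
abbrev MackeyStarStar :=
  MackeyFunctor H.upperStar.opContra H.lowerStar.opCov H.baseChangeStarStar

/-- A Mackey `!!`-functor: a pseudofunctor from spans in `Dᵒᵖ` to `Cat` which restricts to `H_!`
and `H^!`. It sends a span `(l, z, r)` to `r_! l^!`. -/
abbrev MackeyShriekShriek := MackeyFunctor H.lowerShriek H.upperShriek H.baseChangeShriekShriek

end GrothendieckCrossFunctor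

end GrothendieckCrossFunctors

end CrossFunctors

end

/-!
A span `(l, z, r)` is the composite of `j l` and `i r`, so a Mackey functor `F` has to send it to
`N l ≫ P r`, where `N` and `P` are its restrictions along `j` and `i`. The point is that the rest of
the structure of `F` on the spans is determined by the base change isomorphisms `β`, and that it
exists as soon as `β` is compatible with the pasting of cartesian squares in both directions
(`BaseChangeData.IsCoherent`). Nothing is used of the target besides its being a bicategory.

*Existence.* A 2-morphism `φ : U ⟶ S ≫ T` of spans is the same as two projections from the apex of
`U` to those of `S` and `T` which make a cartesian square. It yields a 2-morphism
`N U.l ≫ P U.r ⟶ (N S.l ≫ P S.r) ≫ (N T.l ≫ P T.r)`: split the legs of `U` and apply the inverse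
of `β` in the middle (`splitting`). Indexing these 2-morphisms by all the `φ`, rather than by the
chosen fibre products, makes the coherence conditions instances of a single computation:
`splitting_assoc` derives the associativity from the compatibility of `β` with pasting, and the unit
laws follow from the values of `β` on degenerate squares. Those values are forced: `β` of a square
with two opposite identities is an idempotent automorphism up to unitors, hence trivial
(`eq_unit_of_idempotent`). A family of 2-morphisms of this kind is the same as a pseudofunctor
(`CompositionSystem.toPseudofunctor`), and restricting it to the two embeddings gives back `P`, `N`
and `β` (`BaseChangeData.IsCoherent.mackeyFunctor`).

*Uniqueness.* Every Mackey functor `F` maps by an equivalence to the canonical one just described: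
the component at a span is the identification of `F (l, z, r)` with `N l ≫ P r`, transported along
the isomorphism of `(l, z, r)` with the composite of `j l` and `i r`. That these components are
natural comes down to `SpanCat.comp_factor`, which expresses an arbitrary `φ : U ⟶ S ≫ T` through
the structure 2-morphisms of `i` and `j` and the 2-morphism of a single cartesian square; each of
these is known to correspond to its counterpart for `P`, `N`, `β`. Two Mackey functors are then
related by the quotient of their equivalences with the canonical one (`quotientTrans`).

*Coherence.* The compatibility with pasting of `h^* p_! ≅ g_! f^*` is the mate of that of the lower
exchange. The isomorphism `p^! h_* ≅ f_* g^!` is conjugate to the inverse of the former, hence it is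
the mate of the upper exchange (`CrossFunctor.baseChangeRight_hom`), from which it inherits its
compatibility. The four cases are obtained from these two by reversing the 1-morphisms, which
exchanges the two directions of pasting (`BaseChangeData.flipOp`), and by transport along
`H_! ≅ H_*` (`BaseChangeData.transport`).
-/

noncomputable section

namespace CrossFunctors

/-! ### Splitting a composite of two 1-morphisms -/

section
variable {K : Type u₂} [Bicategory.{w, v₂} K]

/-- The 2-morphism from `n ≫ p` to `(n₁ ≫ p₁) ≫ (n₂ ≫ p₂)` which splits `n` into `n₁ ≫ n'` and `p`
into `p' ≫ p₂`, and then exchanges `n'` and `p'` by means of `β`. -/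
def splitting {a b c d e f : K} {n : a ⟶ d} {p : d ⟶ f} {n₁ : a ⟶ b} {p₁ : b ⟶ c} {n₂ : c ⟶ e}
    {p₂ : e ⟶ f} {n' : b ⟶ d} {p' : d ⟶ e} (μ : n ⟶ n₁ ≫ n') (π : p ⟶ p' ≫ p₂)
    (β : n' ≫ p' ⟶ p₁ ≫ n₂) : n ≫ p ⟶ (n₁ ≫ p₁) ≫ (n₂ ≫ p₂) :=
  μ ▷ p ≫ (n₁ ≫ n') ◁ π ≫ (α_ _ _ _).hom ≫ n₁ ◁ (α_ _ _ _).inv ≫ n₁ ◁ β ▷ p₂ ≫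
    n₁ ◁ (α_ _ _ _).hom ≫ (α_ _ _ _).inv

theorem splitting_eq {a b c d e f : K} {n : a ⟶ d} {p : d ⟶ f} {n₁ : a ⟶ b} {p₁ : b ⟶ c}
    {n₂ : c ⟶ e} {p₂ : e ⟶ f} {n' : b ⟶ d} {p' : d ⟶ e} (μ : n ⟶ n₁ ≫ n') (π : p ⟶ p' ≫ p₂)
    (β : n' ≫ p' ⟶ p₁ ≫ n₂) :
    splitting μ π β = (μ ▷ p ≫ (n₁ ≫ n') ◁ π) ⊗≫ n₁ ◁ β ▷ p₂ ⊗≫ 𝟙 _ := by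
  unfold splitting; bicategory

/-- Splitting a composite in three, starting from the left or from the right, gives the same result.
The 2-morphism `βZ` is the exchange which both ways have in common; `hN` and `hP` say that the two
ways of splitting the outer 1-morphisms in three agree, and `hV` and `hH` decompose the two
remaining exchanges `βUW` and `βSV` by pasting. -/
theorem splitting_assoc {x s y t y' w x' u v z : K}
    {n₁ : x ⟶ s} {p₁ : s ⟶ y} {n₂ : y ⟶ t} {p₂ : t ⟶ y'} {n₃ : y' ⟶ w} {p₃ : w ⟶ x'}
    {nu : s ⟶ u} {pu : u ⟶ t} {nv : t ⟶ v} {pv : v ⟶ w} {na : u ⟶ z} {pb : z ⟶ v}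
    {nU : x ⟶ u} {pU : u ⟶ y'} {nV : y ⟶ v} {pV : v ⟶ x'}
    {nZ : x ⟶ z} {pZ : z ⟶ x'} {pbv : z ⟶ w} {nua : s ⟶ z}
    (βU : nu ≫ pu ⟶ p₁ ≫ n₂) (βV : nv ≫ pv ⟶ p₂ ≫ n₃) (βZ : na ≫ pb ⟶ pu ≫ nv)
    (βUW : na ≫ pbv ⟶ pU ≫ n₃) (βSV : nua ≫ pb ⟶ p₁ ≫ nV)
    (μ : nU ⟶ n₁ ≫ nu) (π : pU ⟶ pu ≫ p₂) (ν : nV ⟶ n₂ ≫ nv) (σ : pV ⟶ pv ≫ p₃)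
    (ω : pbv ⟶ pb ≫ pv) (θ : nua ⟶ nu ≫ na)
    (μ' : nZ ⟶ nU ≫ na) (π' : pZ ⟶ pbv ≫ p₃) (θ' : nZ ⟶ n₁ ≫ nua) (σ' : pZ ⟶ pb ≫ pV)
    (hN : μ' ≫ μ ▷ na ≫ (α_ _ _ _).hom = θ' ≫ n₁ ◁ θ)
    (hP : π' ≫ ω ▷ p₃ ≫ (α_ _ _ _).hom = σ' ≫ pb ◁ σ)
    (hV : βUW ≫ π ▷ n₃ = na ◁ ω ≫ (α_ _ _ _).inv ≫ βZ ▷ pv ≫ (α_ _ _ _).hom ≫ pu ◁ βV ≫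
      (α_ _ _ _).inv)
    (hH : βSV ≫ p₁ ◁ ν = θ ▷ pb ≫ (α_ _ _ _).hom ≫ nu ◁ βZ ≫ (α_ _ _ _).inv ≫ βU ▷ nv ≫
      (α_ _ _ _).hom) :
    splitting μ' π' βUW ≫ splitting μ π βU ▷ (n₃ ≫ p₃) ≫ (α_ _ _ _).hom =
      splitting θ' σ' βSV ≫ (n₁ ≫ p₁) ◁ splitting ν σ βV := by
  have hN' : μ' ≫ μ ▷ na = θ' ≫ n₁ ◁ θ ≫ (α_ _ _ _).inv := by
    rw [← Category.assoc, ← hN]; simp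
  have hP' : π' ≫ ω ▷ p₃ = σ' ≫ pb ◁ σ ≫ (α_ _ _ _).inv := by
    rw [← Category.assoc, ← hP]; simp
  have h₁ : μ ▷ pU ≫ (n₁ ≫ nu) ◁ π = nU ◁ π ≫ μ ▷ (pu ≫ p₂) := (whisker_exchange _ _).symm
  have h₂ : nU ◁ (na ◁ (π' ≫ ω ▷ p₃) ⊗≫ βZ ▷ (pv ≫ p₃) ⊗≫ pu ◁ βV ▷ p₃ ⊗≫ 𝟙 (pu ≫ p₂ ≫ n₃ ≫ p₃)) ≫
      μ ▷ _ = μ ▷ _ ≫ (n₁ ≫ nu) ◁ (na ◁ (π' ≫ ω ▷ p₃) ⊗≫ βZ ▷ (pv ≫ p₃) ⊗≫ pu ◁ βV ▷ p₃ ⊗≫ 𝟙 _) :=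
    whisker_exchange _ _
  have h₃ : nua ◁ σ' ≫ θ ▷ (pb ≫ pV) = θ ▷ pZ ≫ (nu ≫ na) ◁ σ' := whisker_exchange _ _
  have h₄ : βZ ▷ pV ≫ (pu ≫ nv) ◁ σ = (na ≫ pb) ◁ σ ≫ βZ ▷ (pv ≫ p₃) :=
    (whisker_exchange _ _).symm
  have h₅ : βU ▷ (nv ≫ pV) ≫ (p₁ ≫ n₂) ◁ (nv ◁ σ ⊗≫ βV ▷ p₃) =
      (nu ≫ pu) ◁ (nv ◁ σ ⊗≫ βV ▷ p₃) ≫ βU ▷ _ := (whisker_exchange _ _).symm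
  simp only [splitting_eq]
  rw [h₁]
  calc
    _ = μ' ▷ pZ ⊗≫ nU ◁ na ◁ π' ⊗≫ (nU ◁ (βUW ≫ π ▷ n₃) ▷ p₃) ⊗≫
          μ ▷ (pu ≫ p₂ ≫ n₃ ≫ p₃) ⊗≫ n₁ ◁ βU ▷ (p₂ ≫ n₃ ≫ p₃) ⊗≫ 𝟙 _ := by
      bicategory
    _ = μ' ▷ pZ ⊗≫ (nU ◁ (na ◁ (π' ≫ ω ▷ p₃) ⊗≫ βZ ▷ (pv ≫ p₃) ⊗≫ pu ◁ βV ▷ p₃ ⊗≫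
          𝟙 (pu ≫ p₂ ≫ n₃ ≫ p₃)) ≫ μ ▷ _) ⊗≫ n₁ ◁ βU ▷ (p₂ ≫ n₃ ≫ p₃) ⊗≫ 𝟙 _ := by
      rw [hV]; bicategory
    _ = (μ' ≫ μ ▷ na) ▷ pZ ⊗≫ n₁ ◁ nu ◁ (na ◁ (π' ≫ ω ▷ p₃) ⊗≫ βZ ▷ (pv ≫ p₃) ⊗≫
          pu ◁ βV ▷ p₃) ⊗≫ n₁ ◁ βU ▷ (p₂ ≫ n₃ ≫ p₃) ⊗≫ 𝟙 _ := by
      rw [h₂]; bicategory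
    _ = θ' ▷ pZ ⊗≫ n₁ ◁ (θ ▷ pZ ≫ (nu ≫ na) ◁ σ') ⊗≫ n₁ ◁ nu ◁ ((na ≫ pb) ◁ σ ≫
          βZ ▷ (pv ≫ p₃)) ⊗≫ n₁ ◁ nu ◁ pu ◁ βV ▷ p₃ ⊗≫ n₁ ◁ βU ▷ (p₂ ≫ n₃ ≫ p₃) ⊗≫ 𝟙 _ := by
      rw [hN', hP']; bicategory
    _ = θ' ▷ pZ ⊗≫ n₁ ◁ (nua ◁ σ' ≫ θ ▷ (pb ≫ pV)) ⊗≫ n₁ ◁ nu ◁ (βZ ▷ pV) ⊗≫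
          n₁ ◁ ((nu ≫ pu) ◁ (nv ◁ σ ⊗≫ βV ▷ p₃) ≫ βU ▷ _) ⊗≫ 𝟙 _ := by
      rw [h₃, ← h₄]; bicategory
    _ = θ' ▷ pZ ⊗≫ n₁ ◁ nua ◁ σ' ⊗≫ n₁ ◁ (βSV ≫ p₁ ◁ ν) ▷ pV ⊗≫
          n₁ ◁ p₁ ◁ n₂ ◁ (nv ◁ σ ⊗≫ βV ▷ p₃) ⊗≫ 𝟙 _ := by
      rw [← h₅, hH]; bicategory
    _ = _ := by
      bicategory

/-! ### Pseudofunctors from systems of composition 2-morphisms -/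

/-- A pseudofunctor presented by 2-morphisms `map U ⟶ map S ≫ map T` for all `φ : U ⟶ S ≫ T`,
instead of only for `𝟙 (S ≫ T)`. The action on 2-morphisms and its functoriality need not be given:
they are recovered from the splittings of `S ≫ 𝟙` and the unit laws. -/
structure CompositionSystem (B : Type u₁) [Bicategory.{v₃, v₁} B] (K : Type u₂)
    [Bicategory.{w, v₂} K] where
  obj : B → K
  map {a b : B} (S : a ⟶ b) : obj a ⟶ obj b
  mapId (a : B) : map (𝟙 a) ≅ 𝟙 (obj a)
  split {a b c : B} {U : a ⟶ c} {S : a ⟶ b} {T : b ⟶ c} (φ : U ⟶ S ≫ T) : map U ⟶ map S ≫ map T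
  isIso_split {a b c : B} (S : a ⟶ b) (T : b ⟶ c) : IsIso (split (𝟙 (S ≫ T)))
  split_assoc {a b c d : B} {S : a ⟶ b} {T : b ⟶ c} {W : c ⟶ d} {U : a ⟶ c} {V : b ⟶ d}
    {Z : a ⟶ d} (φ : U ⟶ S ≫ T) (ψ : V ⟶ T ≫ W) (ζ : Z ⟶ U ≫ W) (ζ' : Z ⟶ S ≫ V)
    (h : ζ ≫ φ ▷ W ≫ (α_ S T W).hom = ζ' ≫ S ◁ ψ) :
    split ζ ≫ split φ ▷ map W ≫ (α_ _ _ _).hom = split ζ' ≫ map S ◁ split ψ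
  split_left {a b : B} (S : a ⟶ b) :
    split (λ_ S).inv ≫ (mapId a).hom ▷ map S ≫ (λ_ _).hom = 𝟙 _
  split_right {a b : B} (S : a ⟶ b) :
    split (ρ_ S).inv ≫ map S ◁ (mapId b).hom ≫ (ρ_ _).hom = 𝟙 _

namespace CompositionSystem

variable {B : Type u₁} [Bicategory.{v₃, v₁} B] (F : CompositionSystem B K)

/-- The action on 2-morphisms, which is the splitting of `S ⟶ T ≅ T ≫ 𝟙` followed by a unitor. -/
def map₂ {a b : B} {S T : a ⟶ b} (η : S ⟶ T) : F.map S ⟶ F.map T :=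
  F.split (η ≫ (ρ_ T).inv) ≫ F.map T ◁ (F.mapId b).hom ≫ (ρ_ _).hom

theorem split_leftUnitor_inv {a b : B} (S : a ⟶ b) :
    F.split (λ_ S).inv = (λ_ _).inv ≫ (F.mapId a).inv ▷ F.map S := by
  have := F.split_left S
  rw [← Category.assoc, ← IsIso.eq_comp_inv, ← IsIso.eq_comp_inv] at this
  simpa using this

theorem split_rightUnitor_inv {a b : B} (S : a ⟶ b) :
    F.split (ρ_ S).inv = (ρ_ _).inv ≫ F.map S ◁ (F.mapId b).inv := by
  have := F.split_right S
  rw [← Category.assoc, ← IsIso.eq_comp_inv, ← IsIso.eq_comp_inv] at this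
  simpa using this

theorem split_comp_rightUnitor_inv {a b : B} {S T : a ⟶ b} (η : S ⟶ T) :
    F.split (η ≫ (ρ_ T).inv) = F.map₂ η ≫ (ρ_ _).inv ≫ F.map T ◁ (F.mapId b).inv := by
  simp [map₂]

theorem split_precomp {a b c : B} {U' U : a ⟶ c} {S : a ⟶ b} {T : b ⟶ c} (η : U' ⟶ U)
    (φ : U ⟶ S ≫ T) : F.split (η ≫ φ) = F.map₂ η ≫ F.split φ := by
  have h := F.split_assoc φ (ρ_ T).inv (η ≫ (ρ_ U).inv) (η ≫ φ) (by simp)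
  rw [split_rightUnitor_inv, split_comp_rightUnitor_inv] at h
  calc
    _ = (F.split (η ≫ φ) ≫ F.map S ◁ ((ρ_ _).inv ≫ F.map T ◁ (F.mapId c).inv)) ≫
          F.map S ◁ (F.map T ◁ (F.mapId c).hom ≫ (ρ_ _).hom) := by
      rw [Category.assoc, ← whiskerLeft_comp]; simp
    _ = F.map₂ η ⊗≫ (F.map U ◁ (F.mapId c).inv ≫ F.split φ ▷ F.map (𝟙 c)) ⊗≫
          F.map S ◁ F.map T ◁ (F.mapId c).hom ⊗≫ 𝟙 _ := by
      rw [← h]; bicategory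
    _ = F.map₂ η ⊗≫ F.split φ ⊗≫ F.map S ◁ F.map T ◁ ((F.mapId c).inv ≫ (F.mapId c).hom) ⊗≫
          𝟙 _ := by
      rw [whisker_exchange]; bicategory
    _ = _ := by
      rw [Iso.inv_hom_id]; bicategory

theorem split_whiskerLeft {a b c : B} {U : a ⟶ c} {S : a ⟶ b} {T T' : b ⟶ c}
    (φ : U ⟶ S ≫ T) (θ : T ⟶ T') : F.split (φ ≫ S ◁ θ) = F.split φ ≫ F.map S ◁ F.map₂ θ := by
  have h := F.split_assoc (φ ≫ S ◁ θ) (θ ≫ (ρ_ T').inv) (ρ_ U).inv φ (by simp)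
  rw [split_rightUnitor_inv, split_comp_rightUnitor_inv] at h
  calc
    _ = ((ρ_ _).inv ≫ F.map U ◁ (F.mapId c).inv) ≫ F.split (φ ≫ S ◁ θ) ▷ F.map (𝟙 c) ≫
          (α_ _ _ _).hom ≫ F.map S ◁ (F.map T' ◁ (F.mapId c).hom ≫ (ρ_ _).hom) := by
      rw [Category.assoc, whisker_exchange_assoc]; simp
    _ = F.split φ ≫ F.map S ◁ F.map₂ θ ⊗≫
          F.map S ◁ F.map T' ◁ ((F.mapId c).inv ≫ (F.mapId c).hom) ⊗≫ 𝟙 _ := by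
      simp only [← Category.assoc] at h ⊢
      rw [h]; bicategory
    _ = _ := by
      rw [Iso.inv_hom_id]; bicategory

theorem split_whiskerRight {a b c : B} {U : a ⟶ c} {S S' : a ⟶ b} {T : b ⟶ c}
    (φ : U ⟶ S ≫ T) (θ : S ⟶ S') : F.split (φ ≫ θ ▷ T) = F.split φ ≫ F.map₂ θ ▷ F.map T := by
  have h := F.split_assoc (θ ≫ (ρ_ S').inv) (λ_ T).inv φ (φ ≫ θ ▷ T) (by simp)
  rw [split_leftUnitor_inv, split_comp_rightUnitor_inv] at h
  calc
    _ = (F.split (φ ≫ θ ▷ T) ≫ F.map S' ◁ ((λ_ _).inv ≫ (F.mapId b).inv ▷ F.map T)) ≫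
          F.map S' ◁ ((F.mapId b).hom ▷ F.map T ≫ (λ_ _).hom) := by
      rw [Category.assoc, ← whiskerLeft_comp]; simp
    _ = F.split φ ≫ F.map₂ θ ▷ F.map T ⊗≫
          F.map S' ◁ ((F.mapId b).inv ≫ (F.mapId b).hom) ▷ F.map T ⊗≫ 𝟙 _ := by
      rw [← h]; bicategory
    _ = _ := by
      rw [Iso.inv_hom_id]; bicategory

/-- The composition constraint, which is the splitting of the identity of `S ≫ T`. -/
def mapComp {a b c : B} (S : a ⟶ b) (T : b ⟶ c) : F.map (S ≫ T) ≅ F.map S ≫ F.map T :=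
  haveI := F.isIso_split S T
  asIso (F.split (𝟙 (S ≫ T)))

theorem map₂_id {a b : B} (S : a ⟶ b) : F.map₂ (𝟙 S) = 𝟙 _ := by
  simp [map₂, split_right]

theorem split_eq {a b c : B} {U : a ⟶ c} {S : a ⟶ b} {T : b ⟶ c} (φ : U ⟶ S ≫ T) :
    F.split φ = F.map₂ φ ≫ (F.mapComp S T).hom := by
  have := F.split_precomp φ (𝟙 _)
  rwa [Category.comp_id] at this

theorem map₂_comp {a b : B} {S T U : a ⟶ b} (η : S ⟶ T) (θ : T ⟶ U) :
    F.map₂ (η ≫ θ) = F.map₂ η ≫ F.map₂ θ := by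
  rw [map₂, Category.assoc, split_precomp, map₂, map₂]; simp

/-- The pseudofunctor presented by a composition system. -/
@[simps]
def toPseudofunctor : B ⥤ᵖ K where
  obj := F.obj
  map := F.map
  map₂ := F.map₂
  map₂_id := F.map₂_id
  map₂_comp := F.map₂_comp
  mapId := F.mapId
  mapComp := F.mapComp
  map₂_whisker_left S T T' η := by
    rw [← Category.assoc, Iso.eq_comp_inv, ← split_eq]
    simpa [mapComp] using F.split_whiskerLeft (𝟙 _) η
  map₂_whisker_right η T := by
    rw [← Category.assoc, Iso.eq_comp_inv, ← split_eq]
    simpa [mapComp] using F.split_whiskerRight (𝟙 _) η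
  map₂_associator S T W := by
    have := F.split_assoc (𝟙 (S ≫ T)) (𝟙 (T ≫ W)) (𝟙 _) (α_ S T W).hom (by simp)
    rw [split_eq F (α_ _ _ _).hom] at this
    simp only [← Category.assoc, Iso.eq_comp_inv] at this ⊢
    rw [← cancel_mono (F.map S ◁ (F.mapComp T W).hom)]
    simp only [Category.assoc, whiskerLeft_inv_hom] at this ⊢
    simpa [mapComp] using this.symm
  map₂_left_unitor S := by
    have h := F.split_left S
    rw [split_eq] at h
    have h' : F.map₂ (λ_ S).hom ≫ F.map₂ (λ_ S).inv = 𝟙 _ := by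
      rw [← map₂_comp, Iso.hom_inv_id, map₂_id]
    have := congrArg (fun u => F.map₂ (λ_ S).hom ≫ u) h
    simpa [reassoc_of% h'] using this.symm
  map₂_right_unitor S := by
    have h := F.split_right S
    rw [split_eq] at h
    have h' : F.map₂ (ρ_ S).hom ≫ F.map₂ (ρ_ S).inv = 𝟙 _ := by
      rw [← map₂_comp, Iso.hom_inv_id, map₂_id]
    have := congrArg (fun u => F.map₂ (ρ_ S).hom ≫ u) h
    simpa [reassoc_of% h'] using this.symm

end CompositionSystem
end

/-! ### Splittings with identities -/

section
variable {K : Type u₂} [Bicategory.{w, v₂} K]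

/-- Splitting off an identity on the left, when `β` is the canonical exchange with an identity, is
inverse to the left unitor. -/
theorem splitting_left {a b c : K} {n : a ⟶ b} {p : b ⟶ c} {n₁ p₁ : a ⟶ a} {p₁' : b ⟶ b}
    (ιn : n₁ ≅ 𝟙 a) (ιp : p₁ ≅ 𝟙 a) (ιp' : p₁' ≅ 𝟙 b) (μ : n ⟶ n₁ ≫ n) (π : p ⟶ p₁' ≫ p)
    (β : n ≫ p₁' ⟶ p₁ ≫ n) (hμ : μ ≫ ιn.hom ▷ n ≫ (λ_ n).hom = 𝟙 n)
    (hπ : π ≫ ιp'.hom ▷ p ≫ (λ_ p).hom = 𝟙 p)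
    (hβ : β = n ◁ ιp'.hom ≫ (ρ_ n).hom ≫ (λ_ n).inv ≫ ιp.inv ▷ n) :
    splitting μ π β ≫ (ιn.hom ▷ p₁ ≫ 𝟙 a ◁ ιp.hom ≫ (λ_ _).hom) ▷ (n ≫ p) ≫ (λ_ _).hom = 𝟙 _ := by
  have hμ' : μ = (λ_ n).inv ≫ ιn.inv ▷ n := by
    rw [← Category.assoc, ← IsIso.eq_comp_inv, ← IsIso.eq_comp_inv] at hμ
    simpa using hμ
  have hπ' : π = (λ_ p).inv ≫ ιp'.inv ▷ p := by
    rw [← Category.assoc, ← IsIso.eq_comp_inv, ← IsIso.eq_comp_inv] at hπ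
    simpa using hπ
  subst hμ' hπ' hβ
  unfold splitting
  calc
    _ = 𝟙 _ ⊗≫ ιn.inv ▷ n ▷ p ⊗≫ n₁ ◁ n ◁ (ιp'.inv ≫ ιp'.hom) ▷ p ⊗≫
      (n₁ ◁ ιp.inv ≫ ιn.hom ▷ p₁) ▷ (n ≫ p) ⊗≫ ιp.hom ▷ (n ≫ p) ⊗≫ 𝟙 _ := by bicategory
    _ = 𝟙 _ ⊗≫ (ιn.inv ≫ ιn.hom) ▷ n ▷ p ⊗≫ (ιp.inv ≫ ιp.hom) ▷ (n ≫ p) ⊗≫ 𝟙 _ := by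
      rw [whisker_exchange, Iso.inv_hom_id]; bicategory
    _ = _ := by
      simp only [Iso.inv_hom_id]; bicategory

/-- Splitting off an identity on the right, when `β` is the canonical exchange with an identity, is
inverse to the right unitor. -/
theorem splitting_right {a b c : K} {n : a ⟶ b} {p : b ⟶ c} {n₂ p₂ : c ⟶ c} {n₂' : b ⟶ b}
    (ιn : n₂ ≅ 𝟙 c) (ιp : p₂ ≅ 𝟙 c) (ιn' : n₂' ≅ 𝟙 b) (μ : n ⟶ n ≫ n₂') (π : p ⟶ p ≫ p₂)
    (β : n₂' ≫ p ⟶ p ≫ n₂) (hμ : μ ≫ n ◁ ιn'.hom ≫ (ρ_ n).hom = 𝟙 n)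
    (hπ : π ≫ p ◁ ιp.hom ≫ (ρ_ p).hom = 𝟙 p)
    (hβ : β = ιn'.hom ▷ p ≫ (λ_ p).hom ≫ (ρ_ p).inv ≫ p ◁ ιn.inv) :
    splitting μ π β ≫ (n ≫ p) ◁ (ιn.hom ▷ p₂ ≫ 𝟙 c ◁ ιp.hom ≫ (λ_ _).hom) ≫ (ρ_ _).hom = 𝟙 _ := by
  have hμ' : μ = (ρ_ n).inv ≫ n ◁ ιn'.inv := by
    rw [← Category.assoc, ← IsIso.eq_comp_inv, ← IsIso.eq_comp_inv] at hμ
    simpa using hμ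
  have hπ' : π = (ρ_ p).inv ≫ p ◁ ιp.inv := by
    rw [← Category.assoc, ← IsIso.eq_comp_inv, ← IsIso.eq_comp_inv] at hπ
    simpa using hπ
  subst hμ' hπ' hβ
  unfold splitting
  calc
    _ = 𝟙 _ ⊗≫ n ◁ (ιn'.inv ▷ p ≫ n₂' ◁ ((ρ_ p).inv ≫ p ◁ ιp.inv) ≫ ιn'.hom ▷ (p ≫ p₂)) ⊗≫
      n ◁ p ◁ (ιn.inv ≫ ιn.hom) ▷ p₂ ⊗≫ n ◁ p ◁ ιp.hom ⊗≫ 𝟙 _ := by bicategory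
    _ = 𝟙 _ ⊗≫ n ◁ (ιn'.inv ≫ ιn'.hom) ▷ p ⊗≫ n ◁ p ◁ (ιp.inv ≫ ιp.hom) ⊗≫ 𝟙 _ := by
      rw [whisker_exchange, Iso.inv_hom_id]; bicategory
    _ = _ := by
      simp only [Iso.inv_hom_id]; bicategory

/-- An exchange `β` of `n` with two 1-morphisms isomorphic to identities is the canonical one as
soon as it is equal to its own pasting: up to unitors it is an automorphism `γ` of `n` with `γ ≫ γ =
γ`. -/
theorem eq_unit_of_idempotent {a b : K} {p : a ⟶ a} {p' : b ⟶ b} {n : a ⟶ b} (ι : p ≅ 𝟙 a)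
    (ι' : p' ≅ 𝟙 b) (β : p ≫ n ≅ n ≫ p')
    (h : β.hom = ((λ_ p).inv ≫ ι.inv ▷ p) ▷ n ≫ (α_ _ _ _).hom ≫ p ◁ β.hom ≫ (α_ _ _ _).inv ≫
      β.hom ▷ p' ≫ (α_ _ _ _).hom ≫ n ◁ (ι'.hom ▷ p' ≫ (λ_ _).hom)) :
    β.hom = ι.hom ▷ n ≫ (λ_ n).hom ≫ (ρ_ n).inv ≫ n ◁ ι'.inv := by
  set γ : n ⟶ n := (λ_ n).inv ≫ ι.inv ▷ n ≫ β.hom ≫ n ◁ ι'.hom ≫ (ρ_ n).hom with hγ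
  -- Pasting `β` with itself amounts to composing it with `γ`, so that `γ` is cancelled.
  have h₁ : β.hom = β.hom ≫ γ ▷ p' := by
    calc
      _ = 𝟙 _ ⊗≫ (ι.inv ▷ (p ≫ n) ≫ p ◁ β.hom) ⊗≫ β.hom ▷ p' ⊗≫ n ◁ ι'.hom ▷ p' ⊗≫ 𝟙 _ :=
        h.trans (by bicategory)
      _ = _ := by
        rw [← whisker_exchange, hγ]; bicategory
  have h₂ : γ ▷ p' = 𝟙 _ := by
    rw [← cancel_epi β.hom, ← h₁, Category.comp_id]
  have h₃ : γ = 𝟙 n := by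
    have e : γ ▷ p' ≫ n ◁ ι'.hom = n ◁ ι'.hom ≫ γ ▷ _ := (whisker_exchange _ _).symm
    rw [h₂, Category.id_comp] at e
    have e' : n ◁ ι'.hom ≫ (𝟙 n) ▷ (𝟙 b) = n ◁ ι'.hom ≫ γ ▷ (𝟙 b) := by simpa using e
    rw [cancel_epi] at e'
    rw [← cancel_epi (ρ_ n).hom, ← cancel_mono (ρ_ n).inv]
    simpa using e'.symm
  rw [hγ] at h₃
  rw [← cancel_epi (ι.inv ▷ n), ← cancel_epi (λ_ n).inv, ← cancel_mono (n ◁ ι'.hom),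
    ← cancel_mono (ρ_ n).hom]
  simpa using h₃

/-! ### Composition constraints of a 2-functor, along an equality -/

namespace TwoFunctor

variable {C : Type u₁} [Category.{v₁} C] {obj : C → K} (F : TwoFunctor C obj)

/-- The composition constraint `F k ≅ F f ≫ F g` for a morphism `k` which is equal to `f ≫ g`. -/
def mapComp' {x y z : C} (f : x ⟶ y) (g : y ⟶ z) (k : x ⟶ z) (h : f ≫ g = k := by cat_disch) :
    F.map k ≅ F.map f ≫ F.map g :=
  eqToIso (by rw [h]) ≪≫ F.mapComp f g

theorem mapComp'_eq {x y z : C} (f : x ⟶ y) (g : y ⟶ z) :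
    F.mapComp' f g (f ≫ g) = F.mapComp f g := by
  simp [mapComp']

theorem mapComp'_assoc {x y z t : C} (f : x ⟶ y) (g : y ⟶ z) (h : z ⟶ t) (fg : x ⟶ z) (gh : y ⟶ t)
    (k : x ⟶ t) (e₁ : f ≫ g = fg) (e₂ : g ≫ h = gh) (e₃ : fg ≫ h = k) (e₄ : f ≫ gh = k) :
    (F.mapComp' fg h k).hom ≫ (F.mapComp' f g fg).hom ▷ F.map h ≫ (α_ _ _ _).hom =
      (F.mapComp' f gh k).hom ≫ F.map f ◁ (F.mapComp' g h gh).hom := by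
  subst e₁ e₂ e₃
  have := F.map₂_associator f g h
  simp only [← Category.assoc, Iso.comp_inv_eq] at this
  rw [← cancel_mono (F.map f ◁ (F.mapComp g h).inv)]
  simp only [mapComp', Category.assoc] at this ⊢
  simpa using this

theorem mapComp'_id_left {x y : C} (f : x ⟶ y) :
    (F.mapComp' (𝟙 x) f f).hom ≫ (F.mapId x).hom ▷ F.map f ≫ (λ_ _).hom = 𝟙 _ := by
  simp [mapComp', F.map₂_left_unitor]

theorem mapComp'_id_right {x y : C} (f : x ⟶ y) :
    (F.mapComp' f (𝟙 y) f).hom ≫ F.map f ◁ (F.mapId y).hom ≫ (ρ_ _).hom = 𝟙 _ := by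
  simp [mapComp', F.map₂_right_unitor]

theorem mapComp'_id_left_hom {x y : C} (f : x ⟶ y) :
    (F.mapComp' (𝟙 x) f f).hom = (λ_ _).inv ≫ (F.mapId x).inv ▷ F.map f := by
  have := F.mapComp'_id_left f
  rw [← Category.assoc, ← IsIso.eq_comp_inv, ← IsIso.eq_comp_inv] at this
  simpa using this

theorem mapComp'_id_left_inv {x y : C} (f : x ⟶ y) :
    (F.mapComp' (𝟙 x) f f).inv = (F.mapId x).hom ▷ F.map f ≫ (λ_ _).hom := by
  rw [← cancel_epi (F.mapComp' (𝟙 x) f f).hom, mapComp'_id_left, Iso.hom_inv_id]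

theorem mapComp'_id_right_hom {x y : C} (f : x ⟶ y) :
    (F.mapComp' f (𝟙 y) f).hom = (ρ_ _).inv ≫ F.map f ◁ (F.mapId y).inv := by
  have := F.mapComp'_id_right f
  rw [← Category.assoc, ← IsIso.eq_comp_inv, ← IsIso.eq_comp_inv] at this
  simpa using this

end TwoFunctor

/-! ### Coherent base change isomorphisms -/

variable {C : Type u₁} [Category.{v₁} C] {obj : C → K} {P : TwoFunctor C obj}
  {N : TwoFunctor Cᵒᵖ (fun x => obj x.unop)}

/-- Compatibility of base change isomorphisms with the pasting of cartesian squares, along `h` and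
along `p`, in the notation of `CrossFunctor.lowerExchange_vert` and
`CrossFunctor.lowerExchange_horiz`. The values on squares with two opposite identities are not
prescribed, see `vert_id` and `horiz_id`. -/
structure BaseChangeData.IsCoherent (β : BaseChangeData P N) : Prop where
  vert {a b c d b' d' : C} {f : a ⟶ c} {g : a ⟶ b} {p : c ⟶ d} {h : b ⟶ d}
    {g' : b ⟶ b'} {p' : d ⟶ d'} {h' : b' ⟶ d'} (Q : IsPullback f g p h)
    (Q' : IsPullback h g' p' h') (R : IsPullback f (g ≫ g') (p ≫ p') h') :
    (β R).hom = (P.mapComp p p').hom ▷ N.map h'.op ≫ (α_ _ _ _).hom ≫ P.map p ◁ (β Q').hom ≫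
      (α_ _ _ _).inv ≫ (β Q).hom ▷ P.map g' ≫ (α_ _ _ _).hom ≫
        N.map f.op ◁ (P.mapComp g g').inv
  horiz {a b c d e e' : C} {f : a ⟶ c} {g : a ⟶ b} {p : c ⟶ d} {h : b ⟶ d}
    {f' : c ⟶ e} {q : e ⟶ e'} {h' : d ⟶ e'} (Q : IsPullback f g p h)
    (Q' : IsPullback f' p q h') (R : IsPullback (f ≫ f') g q (h ≫ h')) :
    (β R).hom = P.map q ◁ (N.mapComp h'.op h.op).hom ≫ (α_ _ _ _).inv ≫
      (β Q').hom ▷ N.map h.op ≫ (α_ _ _ _).hom ≫ N.map f'.op ◁ (β Q).hom ≫ (α_ _ _ _).inv ≫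
        (N.mapComp f'.op f.op).inv ▷ P.map g

namespace BaseChangeData.IsCoherent

variable {β : BaseChangeData P N} (hβ : β.IsCoherent)
include hβ

theorem vert' {a b c d b' d' : C} {f : a ⟶ c} {g : a ⟶ b} {p : c ⟶ d} {h : b ⟶ d}
    {g' : b ⟶ b'} {p' : d ⟶ d'} {h' : b' ⟶ d'} {gg' : a ⟶ b'} {pp' : c ⟶ d'}
    (Q : IsPullback f g p h) (Q' : IsPullback h g' p' h') (R : IsPullback f gg' pp' h')
    (hg : g ≫ g' = gg') (hp : p ≫ p' = pp') :
    (β R).hom = (P.mapComp' p p' pp').hom ▷ N.map h'.op ≫ (α_ _ _ _).hom ≫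
      P.map p ◁ (β Q').hom ≫ (α_ _ _ _).inv ≫ (β Q).hom ▷ P.map g' ≫ (α_ _ _ _).hom ≫
        N.map f.op ◁ (P.mapComp' g g' gg').inv := by
  subst hg hp
  simpa only [TwoFunctor.mapComp'_eq] using hβ.vert Q Q' R

theorem horiz' {a b c d e e' : C} {f : a ⟶ c} {g : a ⟶ b} {p : c ⟶ d} {h : b ⟶ d}
    {f' : c ⟶ e} {q : e ⟶ e'} {h' : d ⟶ e'} {ff' : a ⟶ e} {hh' : b ⟶ e'} (Q : IsPullback f g p h)
    (Q' : IsPullback f' p q h') (R : IsPullback ff' g q hh') (hf : f ≫ f' = ff')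
    (hh : h ≫ h' = hh') :
    (β R).hom = P.map q ◁ (N.mapComp' h'.op h.op hh'.op (by rw [← hh]; rfl)).hom ≫
      (α_ _ _ _).inv ≫ (β Q').hom ▷ N.map h.op ≫ (α_ _ _ _).hom ≫ N.map f'.op ◁ (β Q).hom ≫
        (α_ _ _ _).inv ≫ (N.mapComp' f'.op f.op ff'.op (by rw [← hf]; rfl)).inv ▷ P.map g := by
  subst hf hh
  simpa only [TwoFunctor.mapComp'_eq, op_comp] using hβ.horiz Q Q' R

/-- The square pasted with itself along `f` is itself again, so that `eq_unit_of_idempotent`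
applies. -/
theorem vert_id {a c : C} {f : a ⟶ c} (Q : IsPullback f (𝟙 a) (𝟙 c) f) :
    (β Q).hom = (P.mapId c).hom ▷ N.map f.op ≫ (λ_ _).hom ≫ (ρ_ _).inv ≫
      N.map f.op ◁ (P.mapId a).inv := by
  apply eq_unit_of_idempotent (P.mapId c) (P.mapId a) (β Q)
  rw [← TwoFunctor.mapComp'_id_left_hom, ← TwoFunctor.mapComp'_id_left_inv]
  exact hβ.vert' Q Q Q (by simp) (by simp)

theorem horiz_id {a b : C} {g : a ⟶ b} (Q : IsPullback (𝟙 a) g g (𝟙 b)) :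
    (β Q).inv = (N.mapId (op a)).hom ▷ P.map g ≫ (λ_ _).hom ≫ (ρ_ _).inv ≫
      P.map g ◁ (N.mapId (op b)).inv := by
  apply eq_unit_of_idempotent (N.mapId (op a)) (N.mapId (op b)) (β Q).symm
  have := hβ.horiz' Q Q Q (by simp) (by simp)
  rw [← TwoFunctor.mapComp'_id_left_hom, ← TwoFunctor.mapComp'_id_left_inv]
  rw [← cancel_mono (β Q).hom, Iso.symm_hom, Iso.inv_hom_id]
  conv_rhs => rw [this]
  simp

end BaseChangeData.IsCoherent
end

/-! ### Decompositions of spans, and the canonical pseudofunctor on spans -/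

section
variable {K : Type u₂} [Bicategory.{w, v₂} K]
variable {C : Type u₁} [Category.{v₁} C] {obj : C → K} {P : TwoFunctor C obj}
  {N : TwoFunctor Cᵒᵖ (fun x => obj x.unop)} [HasPullbacks C]

namespace SpanCat

section

variable {x y z : SpanCat C} {U : x ⟶ z} {S : x ⟶ y} {T : y ⟶ z} (φ : U ⟶ S ≫ T)

/-- The projection from the apex of `U` to that of `S` which belongs to `φ : U ⟶ S ≫ T`. -/
def splitFst : U.apex ⟶ S.apex := φ.hom ≫ Roof.fst S T

/-- The projection from the apex of `U` to that of `T` which belongs to `φ : U ⟶ S ≫ T`. -/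
def splitSnd : U.apex ⟶ T.apex := φ.hom ≫ Roof.snd S T

theorem splitFst_l : splitFst φ ≫ S.l = U.l := by
  rw [splitFst, Category.assoc]; exact φ.w_l

theorem splitSnd_r : splitSnd φ ≫ T.r = U.r := by
  rw [splitSnd, Category.assoc]; exact φ.w_r

theorem isPullback_split : IsPullback (splitFst φ) (splitSnd φ) S.r T.l :=
  IsPullback.of_iso (Roof.isPullback S T) (asIso φ.hom).symm (Iso.refl _) (Iso.refl _)
    (Iso.refl _) (by simp [splitFst]) (by simp [splitSnd]) (by simp) (by simp)

/-- The 2-morphism `U ⟶ S ≫ T` with given projections, which have to form a cartesian square. -/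
def ofIsPullback (u : U.apex ⟶ S.apex) (v : U.apex ⟶ T.apex) (h : IsPullback u v S.r T.l)
    (hl : u ≫ S.l = U.l) (hr : v ≫ T.r = U.r) : U ⟶ S ≫ T :=
  (mkIso (T := Roof.comp S T) (h.isoIsPullback _ _ (Roof.isPullback S T)) (by simp [hl])
    (by simp [hr])).hom

theorem splitFst_ofIsPullback (u : U.apex ⟶ S.apex) (v : U.apex ⟶ T.apex)
    (h : IsPullback u v S.r T.l) (hl : u ≫ S.l = U.l) (hr : v ≫ T.r = U.r) :
    splitFst (ofIsPullback u v h hl hr) = u := by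
  simp [splitFst, ofIsPullback]

theorem splitSnd_ofIsPullback (u : U.apex ⟶ S.apex) (v : U.apex ⟶ T.apex)
    (h : IsPullback u v S.r T.l) (hl : u ≫ S.l = U.l) (hr : v ≫ T.r = U.r) :
    splitSnd (ofIsPullback u v h hl hr) = v := by
  simp [splitSnd, ofIsPullback]

end

section

variable {x y z t : SpanCat C} {S : x ⟶ y} {T : y ⟶ z} {W : z ⟶ t} {U : x ⟶ z} {V : y ⟶ t}
  {Z : x ⟶ t} {φ : U ⟶ S ≫ T} {ψ : V ⟶ T ≫ W} {ζ : Z ⟶ U ≫ W} {ζ' : Z ⟶ S ≫ V}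

theorem splitFst_splitFst (h : ζ ≫ φ ▷ W ≫ (α_ S T W).hom = ζ' ≫ S ◁ ψ) :
    splitFst ζ ≫ splitFst φ = splitFst ζ' := by
  have e := congrArg (fun η => Roof.Hom.hom η ≫ Roof.fst S (Roof.comp T W)) h
  have e₁ : Roof.Hom.hom (ζ ≫ φ ▷ W ≫ (α_ S T W).hom) =
    ζ.hom ≫ (Roof.whiskerRight φ W).hom ≫ (Roof.associator S T W).hom.hom := rfl
  have e₂ : Roof.Hom.hom (ζ' ≫ S ◁ ψ) = ζ'.hom ≫ (Roof.whiskerLeft S ψ).hom := rfl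
  simp only [e₁, e₂, Category.assoc, Roof.associator_hom_fst] at e
  rw [Roof.whiskerRight_fst_assoc U (Roof.comp S T) W φ,
    Roof.whiskerLeft_fst S V (Roof.comp T W) ψ] at e
  simpa [splitFst, splitSnd] using e

theorem splitFst_splitSnd (h : ζ ≫ φ ▷ W ≫ (α_ S T W).hom = ζ' ≫ S ◁ ψ) :
    splitFst ζ ≫ splitSnd φ = splitSnd ζ' ≫ splitFst ψ := by
  have e := congrArg (fun η => Roof.Hom.hom η ≫ Roof.snd S (Roof.comp T W) ≫ Roof.fst T W) h
  have e₁ : Roof.Hom.hom (ζ ≫ φ ▷ W ≫ (α_ S T W).hom) =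
    ζ.hom ≫ (Roof.whiskerRight φ W).hom ≫ (Roof.associator S T W).hom.hom := rfl
  have e₂ : Roof.Hom.hom (ζ' ≫ S ◁ ψ) = ζ'.hom ≫ (Roof.whiskerLeft S ψ).hom := rfl
  simp only [e₁, e₂, Category.assoc, Roof.associator_hom_snd_fst] at e
  rw [Roof.whiskerRight_fst_assoc U (Roof.comp S T) W φ,
    Roof.whiskerLeft_snd_assoc S V (Roof.comp T W) ψ] at e
  simpa [splitFst, splitSnd] using e

theorem splitSnd_eq (h : ζ ≫ φ ▷ W ≫ (α_ S T W).hom = ζ' ≫ S ◁ ψ) :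
    splitSnd ζ = splitSnd ζ' ≫ splitSnd ψ := by
  have e := congrArg (fun η => Roof.Hom.hom η ≫ Roof.snd S (Roof.comp T W) ≫ Roof.snd T W) h
  have e₁ : Roof.Hom.hom (ζ ≫ φ ▷ W ≫ (α_ S T W).hom) =
    ζ.hom ≫ (Roof.whiskerRight φ W).hom ≫ (Roof.associator S T W).hom.hom := rfl
  have e₂ : Roof.Hom.hom (ζ' ≫ S ◁ ψ) = ζ'.hom ≫ (Roof.whiskerLeft S ψ).hom := rfl
  simp only [e₁, e₂, Category.assoc, Roof.associator_hom_snd_snd] at e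
  rw [Roof.whiskerRight_snd U (Roof.comp S T) W φ,
    Roof.whiskerLeft_snd_assoc S V (Roof.comp T W) ψ] at e
  simpa [splitFst, splitSnd] using e

/-- The apex of a composite of three spans is the fibre product of those of the composites of the
first two and of the last two, over the apex of the one in the middle. -/
theorem isPullback_splitFst_splitSnd (h : ζ ≫ φ ▷ W ≫ (α_ S T W).hom = ζ' ≫ S ◁ ψ) :
    IsPullback (splitFst ζ) (splitSnd ζ') (splitSnd φ) (splitFst ψ) := by
  have h₁ := isPullback_split ζ
  rw [splitSnd_eq h, ← splitSnd_r φ] at h₁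
  exact IsPullback.of_bot h₁ (splitFst_splitSnd h) (isPullback_split ψ)

theorem splitFst_leftUnitor_inv {x y : SpanCat C} (S : x ⟶ y) : splitFst (λ_ S).inv = S.l :=
  Roof.lift_fst _ _ _

theorem splitSnd_leftUnitor_inv {x y : SpanCat C} (S : x ⟶ y) :
    splitSnd (λ_ S).inv = 𝟙 S.apex :=
  Roof.lift_snd _ _ _

theorem splitFst_rightUnitor_inv {x y : SpanCat C} (S : x ⟶ y) :
    splitFst (ρ_ S).inv = 𝟙 S.apex :=
  Roof.lift_fst _ _ _

theorem splitSnd_rightUnitor_inv {x y : SpanCat C} (S : x ⟶ y) : splitSnd (ρ_ S).inv = S.r :=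
  Roof.lift_snd _ _ _

end

end SpanCat

open SpanCat

namespace BaseChangeData

variable (β : BaseChangeData P N)

/-- The composition 2-morphism for a span `U` over the composite of `S` and `T`, with projections
`u` and `v`. Base change is applied in the inverse direction, from `N u ≫ P v` to `P S.r ≫ N T.l`.
-/
def split {x y z : SpanCat C} {U : x ⟶ z} {S : x ⟶ y} {T : y ⟶ z} (u : U.apex ⟶ S.apex)
    (v : U.apex ⟶ T.apex) (h : IsPullback u v S.r T.l) (hl : u ≫ S.l = U.l) (hr : v ≫ T.r = U.r) :
    N.map U.l.op ≫ P.map U.r ⟶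
      (N.map S.l.op ≫ P.map S.r) ≫ N.map T.l.op ≫ P.map T.r :=
  splitting (N.mapComp' S.l.op u.op U.l.op (by rw [← hl]; rfl)).hom
    (P.mapComp' v T.r U.r hr).hom (β h).inv

theorem split_congr {x y z : SpanCat C} {U : x ⟶ z} {S : x ⟶ y} {T : y ⟶ z}
    {u u' : U.apex ⟶ S.apex} {v v' : U.apex ⟶ T.apex} (h : IsPullback u v S.r T.l)
    (hl : u ≫ S.l = U.l) (hr : v ≫ T.r = U.r) (e₁ : u = u') (e₂ : v = v') :
    β.split u v h hl hr = β.split u' v' (by rwa [← e₁, ← e₂]) (by rw [← e₁, hl])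
      (by rw [← e₂, hr]) := by
  subst e₁ e₂; rfl

instance {x y z : SpanCat C} {U : x ⟶ z} {S : x ⟶ y} {T : y ⟶ z} (u : U.apex ⟶ S.apex)
    (v : U.apex ⟶ T.apex) (h : IsPullback u v S.r T.l) (hl : u ≫ S.l = U.l) (hr : v ≫ T.r = U.r) :
    IsIso (β.split u v h hl hr) := by
  unfold split splitting
  infer_instance

variable {β} (hβ : β.IsCoherent)
include hβ

/-- The canonical pseudofunctor on spans, which sends `(l, z, r)` to `N l ≫ P r`, presented as a
composition system. -/
def IsCoherent.compositionSystem : CompositionSystem (SpanCat C) K where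
  obj x := obj x.of
  map S := N.map S.l.op ≫ P.map S.r
  mapId x := whiskerRightIso (N.mapId (op x.of)) (P.map (𝟙 x.of)) ≪≫
    whiskerLeftIso _ (P.mapId x.of) ≪≫ λ_ _
  split φ := β.split (splitFst φ) (splitSnd φ) (isPullback_split φ) (splitFst_l φ) (splitSnd_r φ)
  isIso_split S T := inferInstance
  split_assoc {a b c d S T W U V Z} φ ψ ζ ζ' h := by
    have e₁ := splitFst_splitFst h
    have e₂ := splitFst_splitSnd h
    have e₃ := splitSnd_eq h
    have Q := isPullback_splitFst_splitSnd h
    have hV := hβ.vert' Q (isPullback_split ψ) (isPullback_split ζ) e₃.symm (splitSnd_r φ)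
    have hH := hβ.horiz' Q (isPullback_split φ) (isPullback_split ζ') e₁ (splitFst_l ψ)
    refine splitting_assoc (βZ := (β Q).inv)
      (θ := (N.mapComp' (splitFst φ).op (splitFst ζ).op (splitFst ζ').op
        (by rw [← e₁]; rfl)).hom)
      (ω := (P.mapComp' (splitSnd ζ') (splitSnd ψ) (splitSnd ζ) e₃.symm).hom)
      _ _ _ _ _ _ _ _ _ _ _ _ ?_ ?_ ?_ ?_
    · exact N.mapComp'_assoc S.l.op (splitFst φ).op (splitFst ζ).op U.l.op (splitFst ζ').op Z.l.op
        (congrArg Quiver.Hom.op (splitFst_l φ)) (congrArg Quiver.Hom.op e₁)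
        (congrArg Quiver.Hom.op (splitFst_l ζ)) (congrArg Quiver.Hom.op (splitFst_l ζ'))
    · exact P.mapComp'_assoc (splitSnd ζ') (splitSnd ψ) W.r (splitSnd ζ) V.r Z.r e₃.symm
        (splitSnd_r ψ) (splitSnd_r ζ) (splitSnd_r ζ')
    · rw [← cancel_epi (β (isPullback_split ζ)).hom, Iso.hom_inv_id_assoc, hV]
      simp
    · rw [← cancel_epi (β (isPullback_split ζ')).hom, Iso.hom_inv_id_assoc, hH]
      simp
  split_left S := by
    rw [β.split_congr _ _ _ (splitFst_leftUnitor_inv S) (splitSnd_leftUnitor_inv S)]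
    refine splitting_left _ _ (P.mapId S.apex) _ _ _ ?_ ?_ ?_
    · exact N.mapComp'_id_left S.l.op
    · exact P.mapComp'_id_left S.r
    · have Q : IsPullback S.l (𝟙 S.apex) (𝟙 _) S.l := IsPullback.of_vert_isIso ⟨by simp⟩
      rw [← cancel_epi (β Q).hom, Iso.hom_inv_id, hβ.vert_id Q]
      simp
  split_right S := by
    rw [β.split_congr _ _ _ (splitFst_rightUnitor_inv S) (splitSnd_rightUnitor_inv S)]
    refine splitting_right _ _ (N.mapId (op S.apex)) _ _ _ ?_ ?_ ?_
    · exact N.mapComp'_id_right S.l.op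
    · exact P.mapComp'_id_right S.r
    · exact hβ.horiz_id (IsPullback.of_horiz_isIso ⟨by simp⟩)

end BaseChangeData
end

/-! ### Comparing the values of a pseudofunctor with given 1-morphisms -/

section
variable {K : Type u₂} [Bicategory.{w, v₂} K]
variable {B : Type u₁} [Bicategory.{v₃, v₁} B] {M : B ⥤ᵖ K} {X : B → K}

/-- An identification, through 1-morphisms `app x : M x ⟶ X x`, of the value of the pseudofunctor
`M` at `S` with a given 1-morphism `s`. -/
abbrev Comparison (M : B ⥤ᵖ K) {X : B → K} (app : ∀ x, M.obj x ⟶ X x) {x y : B} (S : x ⟶ y)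
    (s : X x ⟶ X y) :=
  M.map S ≫ app y ≅ app x ≫ s

namespace Comparison

variable {app : ∀ x, M.obj x ⟶ X x}

/-- The comparison of the value of `M` at an identity with an identity. -/
def id (app : ∀ x, M.obj x ⟶ X x) (x : B) : Comparison M app (𝟙 x) (𝟙 (X x)) :=
  whiskerRightIso (M.mapId x) _ ≪≫ λ_ _ ≪≫ (ρ_ _).symm

/-- The composite of two comparisons. -/
def comp {x y z : B} {S : x ⟶ y} {T : y ⟶ z} {s : X x ⟶ X y} {t : X y ⟶ X z}
    (e : Comparison M app S s) (e' : Comparison M app T t) : Comparison M app (S ≫ T) (s ≫ t) :=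
  whiskerRightIso (M.mapComp S T) _ ≪≫ α_ _ _ _ ≪≫ whiskerLeftIso _ e' ≪≫ (α_ _ _ _).symm ≪≫
    whiskerRightIso e _ ≪≫ α_ _ _ _

/-- The 2-morphism `M.map₂ φ` corresponds to `ψ` under the comparisons `e` and `e'`. -/
def Compat {x y : B} {S S' : x ⟶ y} {s s' : X x ⟶ X y} (e : Comparison M app S s)
    (e' : Comparison M app S' s') (φ : S ⟶ S') (ψ : s ⟶ s') : Prop :=
  M.map₂ φ ▷ app y ≫ e'.hom = e.hom ≫ app x ◁ ψ

namespace Compat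

theorem id {x y : B} {S : x ⟶ y} {s : X x ⟶ X y} (e : Comparison M app S s) :
    Compat e e (𝟙 S) (𝟙 s) := by
  simp [Compat]

theorem comp {x y : B} {S S' S'' : x ⟶ y} {s s' s'' : X x ⟶ X y} {e : Comparison M app S s}
    {e' : Comparison M app S' s'} {e'' : Comparison M app S'' s''} {φ : S ⟶ S'} {ψ : s ⟶ s'}
    {φ' : S' ⟶ S''} {ψ' : s' ⟶ s''} (h : Compat e e' φ ψ) (h' : Compat e' e'' φ' ψ') :
    Compat e e'' (φ ≫ φ') (ψ ≫ ψ') := by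
  unfold Compat at *
  rw [M.map₂_comp, comp_whiskerRight, Category.assoc, h', ← Category.assoc, h, whiskerLeft_comp,
    Category.assoc]

theorem inv {x y : B} {S S' : x ⟶ y} {s s' : X x ⟶ X y} {e : Comparison M app S s}
    {e' : Comparison M app S' s'} {φ : S ≅ S'} {ψ : s ≅ s'} (h : Compat e e' φ.hom ψ.hom) :
    Compat e' e φ.inv ψ.inv := by
  unfold Compat at *
  rw [← cancel_mono (app x ◁ ψ.hom), Category.assoc, ← h, ← Category.assoc, ← comp_whiskerRight,
    ← M.map₂_comp]
  simp

variable {x y z t : B}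

theorem whiskerLeft {S : x ⟶ y} {T T' : y ⟶ z} {s : X x ⟶ X y} {t t' : X y ⟶ X z}
    (e : Comparison M app S s) {e' : Comparison M app T t} {e'' : Comparison M app T' t'}
    {φ : T ⟶ T'} {ψ : t ⟶ t'} (h : Compat e' e'' φ ψ) :
    Compat (e.comp e') (e.comp e'') (S ◁ φ) (s ◁ ψ) := by
  unfold Compat Comparison.comp at *
  simp only [Iso.trans_hom, whiskerRightIso_hom, whiskerLeftIso_hom, Iso.symm_hom,
    M.map₂_whisker_left]
  calc
    _ = (M.mapComp S T).hom ▷ app z ⊗≫ M.map S ◁ (M.map₂ φ ▷ app z ≫ e''.hom) ⊗≫ e.hom ▷ t' ⊗≫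
        𝟙 _ := by
      simp [bicategoricalComp]
    _ = (M.mapComp S T).hom ▷ app z ⊗≫ M.map S ◁ e'.hom ⊗≫ ((M.map S ≫ app y) ◁ ψ ≫ e.hom ▷ t') ⊗≫
        𝟙 _ := by
      rw [h]; bicategory
    _ = _ := by
      rw [whisker_exchange]; bicategory

theorem whiskerRight {S S' : x ⟶ y} {T : y ⟶ z} {s s' : X x ⟶ X y} {t : X y ⟶ X z}
    {e : Comparison M app S s} {e' : Comparison M app S' s'} {φ : S ⟶ S'} {ψ : s ⟶ s'}
    (h : Compat e e' φ ψ) (e'' : Comparison M app T t) :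
    Compat (e.comp e'') (e'.comp e'') (φ ▷ T) (ψ ▷ t) := by
  unfold Compat Comparison.comp at *
  simp only [Iso.trans_hom, whiskerRightIso_hom, whiskerLeftIso_hom, Iso.symm_hom,
    M.map₂_whisker_right]
  calc
    _ = (M.mapComp S T).hom ▷ app z ⊗≫ (M.map₂ φ ▷ (M.map T ≫ app z) ≫ M.map S' ◁ e''.hom) ⊗≫
        e'.hom ▷ t ⊗≫ 𝟙 _ := by
      simp [bicategoricalComp]
    _ = (M.mapComp S T).hom ▷ app z ⊗≫ M.map S ◁ e''.hom ⊗≫ (M.map₂ φ ▷ app y ≫ e'.hom) ▷ t ⊗≫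
        𝟙 _ := by
      rw [← whisker_exchange]; bicategory
    _ = _ := by
      rw [h]; bicategory

theorem associator {S : x ⟶ y} {T : y ⟶ z} {U : z ⟶ t} {s : X x ⟶ X y} {s' : X y ⟶ X z}
    {s'' : X z ⟶ X t} (e : Comparison M app S s) (e' : Comparison M app T s')
    (e'' : Comparison M app U s'') :
    Compat ((e.comp e').comp e'') (e.comp (e'.comp e'')) (α_ S T U).hom (α_ s s' s'').hom := by
  unfold Compat Comparison.comp
  simp only [Iso.trans_hom, whiskerRightIso_hom, whiskerLeftIso_hom, Iso.symm_hom,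
    M.map₂_associator]
  calc
    _ = (M.mapComp (S ≫ T) U).hom ▷ app t ⊗≫ ((M.mapComp S T).hom ▷ (M.map U ≫ app t) ≫
        (M.map S ≫ M.map T) ◁ e''.hom) ⊗≫ M.map S ◁ e'.hom ▷ s'' ⊗≫ e.hom ▷ s' ▷ s'' ⊗≫ 𝟙 _ := by
      simp [bicategoricalComp]
    _ = _ := by
      rw [← whisker_exchange]; bicategory

theorem leftUnitor {S : x ⟶ y} {s : X x ⟶ X y} (e : Comparison M app S s) :
    Compat ((Comparison.id app x).comp e) e (λ_ S).hom (λ_ s).hom := by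
  unfold Compat Comparison.comp Comparison.id
  simp only [Iso.trans_hom, whiskerRightIso_hom, whiskerLeftIso_hom, Iso.symm_hom,
    M.map₂_left_unitor]
  calc
    _ = (M.mapComp (𝟙 x) S).hom ▷ app y ⊗≫ ((M.mapId x).hom ▷ (M.map S ≫ app y) ≫
        𝟙 _ ◁ e.hom) ⊗≫ 𝟙 _ := by
      bicategory
    _ = _ := by
      rw [← whisker_exchange]; bicategory

theorem rightUnitor {S : x ⟶ y} {s : X x ⟶ X y} (e : Comparison M app S s) :
    Compat (e.comp (Comparison.id app y)) e (ρ_ S).hom (ρ_ s).hom := by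
  unfold Compat Comparison.comp Comparison.id
  simp only [Iso.trans_hom, whiskerRightIso_hom, whiskerLeftIso_hom, Iso.symm_hom,
    M.map₂_right_unitor]
  bicategory

theorem splitting {a b c d e f : B} {n : a ⟶ d} {p : d ⟶ f} {n₁ : a ⟶ b} {p₁ : b ⟶ c} {n₂ : c ⟶ e}
    {p₂ : e ⟶ f} {n' : b ⟶ d} {p' : d ⟶ e} {μ : n ⟶ n₁ ≫ n'} {π : p ⟶ p' ≫ p₂}
    {β : n' ≫ p' ⟶ p₁ ≫ n₂}
    {m : X a ⟶ X d} {q : X d ⟶ X f} {m₁ : X a ⟶ X b} {q₁ : X b ⟶ X c} {m₂ : X c ⟶ X e}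
    {q₂ : X e ⟶ X f} {m' : X b ⟶ X d} {q' : X d ⟶ X e} {ν : m ⟶ m₁ ≫ m'} {ω : q ⟶ q' ≫ q₂}
    {γ : m' ≫ q' ⟶ q₁ ≫ m₂} {en : Comparison M app n m} {ep : Comparison M app p q}
    {en₁ : Comparison M app n₁ m₁} {ep₁ : Comparison M app p₁ q₁} {en₂ : Comparison M app n₂ m₂}
    {ep₂ : Comparison M app p₂ q₂} {en' : Comparison M app n' m'} {ep' : Comparison M app p' q'}
    (hμ : Compat en (en₁.comp en') μ ν) (hπ : Compat ep (ep'.comp ep₂) π ω)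
    (hβ : Compat (en'.comp ep') (ep₁.comp en₂) β γ) :
    Compat (en.comp ep) ((en₁.comp ep₁).comp (en₂.comp ep₂)) (CrossFunctors.splitting μ π β)
      (CrossFunctors.splitting ν ω γ) :=
  (hμ.whiskerRight ep).comp <| (hπ.whiskerLeft (en₁.comp en')).comp <|
    (associator _ _ _).comp <| (whiskerLeft en₁ (inv (associator _ _ _))).comp <|
      (whiskerLeft en₁ (hβ.whiskerRight ep₂)).comp <|
        (whiskerLeft en₁ (associator _ _ _)).comp (inv (associator _ _ _))

end Compat

section Conj

variable {app' : ∀ x, M.obj x ⟶ X x} (θ : ∀ x, app' x ≅ app x)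

/-- Transport of a comparison along isomorphisms of the 1-morphisms `app x`. -/
def conj {x y : B} {S : x ⟶ y} {s : X x ⟶ X y} (e : Comparison M app' S s) :
    Comparison M app S s :=
  whiskerLeftIso _ (θ y).symm ≪≫ e ≪≫ whiskerRightIso (θ x) s

theorem conj_id (x : B) : conj θ (id app' x) = id app x := by
  apply Iso.ext
  simp only [conj, id, Iso.trans_hom, whiskerRightIso_hom, whiskerLeftIso_hom, Iso.symm_hom]
  calc
    _ = (M.map (𝟙 x) ◁ (θ x).inv ≫ (M.mapId x).hom ▷ app' x) ⊗≫ (θ x).hom ⊗≫ 𝟙 _ := by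
      bicategory
    _ = (M.mapId x).hom ▷ app x ⊗≫ ((θ x).inv ≫ (θ x).hom) ⊗≫ 𝟙 _ := by
      rw [whisker_exchange]; bicategory
    _ = _ := by
      rw [Iso.inv_hom_id]; bicategory

theorem conj_comp {x y z : B} {S : x ⟶ y} {T : y ⟶ z} {s : X x ⟶ X y} {t : X y ⟶ X z}
    (e : Comparison M app' S s) (e' : Comparison M app' T t) :
    conj θ (e.comp e') = (conj θ e).comp (conj θ e') := by
  apply Iso.ext
  simp only [conj, comp, Iso.trans_hom, whiskerRightIso_hom, whiskerLeftIso_hom, Iso.symm_hom]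
  symm
  calc
    _ = ((M.mapComp S T).hom ▷ app z ≫ (M.map S ≫ M.map T) ◁ (θ z).inv) ⊗≫ M.map S ◁ e'.hom ⊗≫
        M.map S ◁ ((θ y).hom ≫ (θ y).inv) ▷ t ⊗≫ e.hom ▷ t ⊗≫ (θ x).hom ▷ s ▷ t ⊗≫ 𝟙 _ := by
      bicategory
    _ = _ := by
      rw [← whisker_exchange, Iso.hom_inv_id]; bicategory

theorem Compat.conj {x y : B} {S S' : x ⟶ y} {s s' : X x ⟶ X y} {e : Comparison M app' S s}
    {e' : Comparison M app' S' s'} {φ : S ⟶ S'} {ψ : s ⟶ s'} (h : Compat e e' φ ψ) :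
    Compat (Comparison.conj θ e) (Comparison.conj θ e') φ ψ := by
  unfold Compat Comparison.conj at *
  simp only [Iso.trans_hom, whiskerRightIso_hom, whiskerLeftIso_hom, Iso.symm_hom, Category.assoc]
  rw [← whisker_exchange_assoc, reassoc_of% h, whisker_exchange]

end Conj

end Comparison
end

/-! ### The comparisons of a Mackey functor with its restrictions -/

section
variable {K : Type u₂} [Bicategory.{w, v₂} K]
variable {C : Type u₁} [Category.{v₁} C] {obj : C → K} {P : TwoFunctor C obj}
  {N : TwoFunctor Cᵒᵖ (fun x => obj x.unop)} [HasPullbacks C]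

namespace SpanExtension
open Comparison
variable (M : SpanExtension P N)

/-- `SpanExtension.isoP` as a comparison. -/
abbrev compP {x y : C} (f : x ⟶ y) :
    Comparison M.functor (X := fun x : SpanCat C => obj x.of) (fun x => M.app x.of)
      (SpanCat.i.map f) (P.map f) :=
  M.isoP f

/-- `SpanExtension.isoN` as a comparison. -/
abbrev compN {x y : Cᵒᵖ} (f : x ⟶ y) :
    Comparison M.functor (X := fun x : SpanCat C => obj x.of) (fun x => M.app x.of)
      (SpanCat.j.map f) (N.map f) :=
  M.isoN f.unop

theorem compat_mapId_P (x : C) :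
    Compat (M.compP (𝟙 x))
      (Comparison.id (X := fun x : SpanCat C => obj x.of) (fun x => M.app x.of) ⟨x⟩)
      (SpanCat.i.mapId x).hom (P.mapId x).hom := by
  have h : (M.isoP (𝟙 x)).hom ≫ M.app x ◁ (P.mapId x).hom =
      (M.functor.map₂ (SpanCat.i.mapId x).hom ≫ (M.functor.mapId ⟨x⟩).hom) ▷ M.app x ≫
        (λ_ (M.app x)).hom ≫ (ρ_ (M.app x)).inv := M.resP.naturality_id ⟨x⟩
  unfold Compat
  refine Eq.trans ?_ h.symm
  simp [Comparison.id]

theorem compat_mapComp_P {x y z : C} (f : x ⟶ y) (g : y ⟶ z) :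
    Compat (M.compP (f ≫ g)) ((M.compP f).comp (M.compP g))
      (SpanCat.i.mapComp f g).hom (P.mapComp f g).hom := by
  have h : (M.isoP (f ≫ g)).hom ≫ M.app x ◁ (P.mapComp f g).hom =
      (M.functor.map₂ (SpanCat.i.mapComp f g).hom ≫
        (M.functor.mapComp (SpanCat.i.map f) (SpanCat.i.map g)).hom) ▷ M.app z ≫
        (α_ _ _ _).hom ≫ M.functor.map (SpanCat.i.map f) ◁ (M.isoP g).hom ≫ (α_ _ _ _).inv ≫
          (M.isoP f).hom ▷ P.map g ≫ (α_ _ _ _).hom :=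
    M.resP.naturality_comp f.toLoc g.toLoc
  unfold Compat
  refine Eq.trans ?_ h.symm
  simp [Comparison.comp]

/-- The value on objects of the equivalence `j^* F ≃ N`, before its identification with that of `i^*
F ≃ P`. -/
def appN (x : SpanCat C) : M.functor.obj x ⟶ obj x.of := M.resN.app ⟨op x.of⟩

/-- The identification of `appN` with the value on objects of `i^* F ≃ P`. -/
def appNIso (x : SpanCat C) : M.appN x ≅ M.app x.of := M.appIso x.of

/-- The comparison with `N` which belongs to the equivalence `j^* F ≃ N`. The comparison `compN` is
its transport along `appNIso`. -/
def natN {x y : Cᵒᵖ} (f : x ⟶ y) :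
    Comparison M.functor (X := fun x : SpanCat C => obj x.of) M.appN
      (SpanCat.j.map f) (N.map f) :=
  M.resN.naturality f.toLoc

theorem compat_mapId_N (x : Cᵒᵖ) :
    Compat (M.compN (𝟙 x))
      (Comparison.id (X := fun x : SpanCat C => obj x.of) (fun x => M.app x.of) ⟨x.unop⟩)
      (SpanCat.j.mapId x).hom (N.mapId x).hom := by
  have h : (M.natN (𝟙 x)).hom ≫ M.appN ⟨x.unop⟩ ◁ (N.mapId x).hom =
      (M.functor.map₂ (SpanCat.j.mapId x).hom ≫ (M.functor.mapId ⟨x.unop⟩).hom) ▷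
        M.appN ⟨x.unop⟩ ≫ (λ_ (M.appN ⟨x.unop⟩)).hom ≫ (ρ_ (M.appN ⟨x.unop⟩)).inv :=
    M.resN.naturality_id ⟨x⟩
  have h' : Compat (M.natN (𝟙 x)) (Comparison.id M.appN ⟨x.unop⟩) (SpanCat.j.mapId x).hom
      (N.mapId x).hom := by
    unfold Compat
    refine Eq.trans ?_ h.symm
    simp [Comparison.id]
  have h'' := h'.conj (app := fun x => M.app x.of) M.appNIso
  rw [conj_id] at h''
  exact h''

theorem compat_mapComp_N {x y z : Cᵒᵖ} (f : x ⟶ y) (g : y ⟶ z) :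
    Compat (M.compN (f ≫ g)) ((M.compN f).comp (M.compN g))
      (SpanCat.j.mapComp f g).hom (N.mapComp f g).hom := by
  have h : (M.natN (f ≫ g)).hom ≫ M.appN ⟨x.unop⟩ ◁ (N.mapComp f g).hom =
      (M.functor.map₂ (SpanCat.j.mapComp f g).hom ≫
        (M.functor.mapComp (SpanCat.j.map f) (SpanCat.j.map g)).hom) ▷ M.appN ⟨z.unop⟩ ≫
        (α_ _ _ _).hom ≫ M.functor.map (SpanCat.j.map f) ◁ (M.natN g).hom ≫ (α_ _ _ _).inv ≫
          (M.natN f).hom ▷ N.map g ≫ (α_ _ _ _).hom :=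
    M.resN.naturality_comp f.toLoc g.toLoc
  have h' : Compat (M.natN (f ≫ g)) ((M.natN f).comp (M.natN g)) (SpanCat.j.mapComp f g).hom
      (N.mapComp f g).hom := by
    unfold Compat
    refine Eq.trans ?_ h.symm
    simp [Comparison.comp]
  have h'' := h'.conj (app := fun x => M.app x.of) M.appNIso
  rw [conj_comp] at h''
  exact h''

theorem compat_mapComp'_P {x y z : C} (f : x ⟶ y) (g : y ⟶ z) (k : x ⟶ z) (e : f ≫ g = k) :
    Compat (M.compP k) ((M.compP f).comp (M.compP g))
      (SpanCat.i.mapComp' f g k e).hom (P.mapComp' f g k e).hom := by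
  subst e
  simpa only [TwoFunctor.mapComp'_eq] using M.compat_mapComp_P f g

theorem compat_mapComp'_N {x y z : Cᵒᵖ} (f : x ⟶ y) (g : y ⟶ z) (k : x ⟶ z) (e : f ≫ g = k) :
    Compat (M.compN k) ((M.compN f).comp (M.compN g))
      (SpanCat.j.mapComp' f g k e).hom (N.mapComp' f g k e).hom := by
  subst e
  simpa only [TwoFunctor.mapComp'_eq] using M.compat_mapComp_N f g

end SpanExtension

open Comparison

/-- The condition `MackeyFunctor.baseChange`, as a statement about comparisons. -/
theorem MackeyFunctor.compat_baseChange {β : BaseChangeData P N} (M : MackeyFunctor P N β)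
    {a b c d : C} {f : a ⟶ c} {g : a ⟶ b} {p : c ⟶ d} {h : b ⟶ d} (Q : IsPullback f g p h) :
    Compat ((M.compP p).comp (M.compN h.op)) ((M.compN f.op).comp (M.compP g))
      (SpanCat.square Q).hom (β Q).hom := by
  have e := M.baseChange Q
  unfold Compat
  simp only [SpanExtension.squareIso, SpanExtension.isoPN, SpanExtension.isoNP] at e
  rw [← cancel_epi ((M.functor.mapComp (SpanCat.i.map p) (SpanCat.j.map h.op)).inv ▷ M.app b)]
  simp only [Comparison.comp]
  simp at e ⊢
  exact e
end

/-! ### The factorization of a span and its compatibility with composition -/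

section
variable {C : Type u₁} [Category.{v₁} C] [HasPullbacks C]

namespace SpanCat

instance {x y : SpanCat C} {S T : x ⟶ y} (φ : S ⟶ T) : IsIso φ :=
  (mkIso (asIso φ.hom) φ.w_l φ.w_r).isIso_hom

/-- The canonical 2-morphism from `(l, z, r)` to the composite of `(l, z, 𝟙)` and `(𝟙, z, r)`. -/
def factor {x y : SpanCat C} (S : x ⟶ y) :
    S ⟶ ((j.map S.l.op : x ⟶ ⟨S.apex⟩) ≫ (i.map S.r : _ ⟶ y)) :=
  ofIsPullback (S := backward S.l) (T := forward S.r) (𝟙 _) (𝟙 _) (IsPullback.of_id_fst)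
    (Category.id_comp _) (Category.id_comp _)

theorem splitFst_factor {x y : SpanCat C} (S : x ⟶ y) : splitFst (factor S) = 𝟙 S.apex :=
  splitFst_ofIsPullback _ _ _ _ _

theorem splitSnd_factor {x y : SpanCat C} (S : x ⟶ y) : splitSnd (factor S) = 𝟙 S.apex :=
  splitSnd_ofIsPullback _ _ _ _ _

/-- `Roof.fst`, stated for the composition of the bicategory `SpanCat C`. -/
def pfst {x y z : SpanCat C} (S : x ⟶ y) (T : y ⟶ z) : (S ≫ T).apex ⟶ S.apex := Roof.fst S T

/-- `Roof.snd`, stated for the composition of the bicategory `SpanCat C`. -/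
def psnd {x y z : SpanCat C} (S : x ⟶ y) (T : y ⟶ z) : (S ≫ T).apex ⟶ T.apex := Roof.snd S T

section

variable {x y z t : SpanCat C}

theorem pfst_psnd_ext {S : x ⟶ y} {T : y ⟶ z} {u : C} {a b : u ⟶ (S ≫ T).apex}
    (h₁ : a ≫ pfst S T = b ≫ pfst S T) (h₂ : a ≫ psnd S T = b ≫ psnd S T) : a = b :=
  Roof.hom_ext h₁ h₂

theorem comp₂_hom {S T U : x ⟶ y} (η : S ⟶ T) (θ : T ⟶ U) :
    Roof.Hom.hom (η ≫ θ) = Roof.Hom.hom η ≫ Roof.Hom.hom θ := rfl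

variable (S : x ⟶ y) {S' : x ⟶ y} (T : y ⟶ z) {T' : y ⟶ z} (W : z ⟶ t)

@[simp]
theorem whiskerRight_pfst (η : S ⟶ S') : (η ▷ T).hom ≫ pfst S' T = pfst S T ≫ η.hom :=
  Roof.whiskerRight_fst _ _ T η

@[simp]
theorem whiskerRight_pfst_assoc (η : S ⟶ S') {u : C} (k : Roof.apex S' ⟶ u) :
    (η ▷ T).hom ≫ pfst S' T ≫ k = pfst S T ≫ η.hom ≫ k := by
  simpa only [Category.assoc] using congrArg (· ≫ k) (whiskerRight_pfst S T η)

@[simp]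
theorem whiskerRight_psnd (η : S ⟶ S') : (η ▷ T).hom ≫ psnd S' T = psnd S T :=
  Roof.whiskerRight_snd _ _ T η

@[simp]
theorem whiskerRight_psnd_assoc (η : S ⟶ S') {u : C} (k : Roof.apex T ⟶ u) :
    (η ▷ T).hom ≫ psnd S' T ≫ k = psnd S T ≫ k := by
  simpa only [Category.assoc] using congrArg (· ≫ k) (whiskerRight_psnd S T η)

@[simp]
theorem whiskerLeft_pfst (η : T ⟶ T') : (S ◁ η).hom ≫ pfst S T' = pfst S T :=
  Roof.whiskerLeft_fst S _ _ η

@[simp]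
theorem whiskerLeft_pfst_assoc (η : T ⟶ T') {u : C} (k : Roof.apex S ⟶ u) :
    (S ◁ η).hom ≫ pfst S T' ≫ k = pfst S T ≫ k := by
  simpa only [Category.assoc] using congrArg (· ≫ k) (whiskerLeft_pfst S T η)

@[simp]
theorem whiskerLeft_psnd (η : T ⟶ T') : (S ◁ η).hom ≫ psnd S T' = psnd S T ≫ η.hom :=
  Roof.whiskerLeft_snd S _ _ η

@[simp]
theorem whiskerLeft_psnd_assoc (η : T ⟶ T') {u : C} (k : Roof.apex T' ⟶ u) :
    (S ◁ η).hom ≫ psnd S T' ≫ k = psnd S T ≫ η.hom ≫ k := by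
  simpa only [Category.assoc] using congrArg (· ≫ k) (whiskerLeft_psnd S T η)

@[simp]
theorem associator_hom_pfst : (α_ S T W).hom.hom ≫ pfst S (T ≫ W) = pfst (S ≫ T) W ≫ pfst S T :=
  Roof.associator_hom_fst S T W

@[simp]
theorem associator_hom_psnd_pfst :
    (α_ S T W).hom.hom ≫ psnd S (T ≫ W) ≫ pfst T W = pfst (S ≫ T) W ≫ psnd S T :=
  Roof.associator_hom_snd_fst S T W

@[simp]
theorem associator_hom_psnd_psnd :
    (α_ S T W).hom.hom ≫ psnd S (T ≫ W) ≫ psnd T W = psnd (S ≫ T) W :=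
  Roof.associator_hom_snd_snd S T W

@[simp]
theorem associator_hom_psnd_psnd_assoc {u : C} (k : Roof.apex W ⟶ u) :
    (α_ S T W).hom.hom ≫ psnd S (T ≫ W) ≫ psnd T W ≫ k = psnd (S ≫ T) W ≫ k := by
  simpa only [Category.assoc] using congrArg (· ≫ k) (associator_hom_psnd_psnd S T W)

theorem inv_hom_hom {S T : x ⟶ y} (e : S ≅ T) :
    Roof.Hom.hom e.inv ≫ Roof.Hom.hom e.hom = 𝟙 T.apex :=
  congrArg Roof.Hom.hom e.inv_hom_id

theorem inv_hom_hom_assoc {S T : x ⟶ y} (e : S ≅ T) {u : C} (k : T.apex ⟶ u) :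
    Roof.Hom.hom e.inv ≫ Roof.Hom.hom e.hom ≫ k = k := by
  rw [← Category.assoc, inv_hom_hom, Category.id_comp]

@[simp]
theorem associator_inv_pfst_pfst :
    (α_ S T W).inv.hom ≫ pfst (S ≫ T) W ≫ pfst S T = pfst S (T ≫ W) := by
  rw [← associator_hom_pfst, inv_hom_hom_assoc]

@[simp]
theorem associator_inv_pfst_psnd :
    (α_ S T W).inv.hom ≫ pfst (S ≫ T) W ≫ psnd S T = psnd S (T ≫ W) ≫ pfst T W := by
  rw [← associator_hom_psnd_pfst, inv_hom_hom_assoc]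

@[simp]
theorem associator_inv_psnd :
    (α_ S T W).inv.hom ≫ psnd (S ≫ T) W = psnd S (T ≫ W) ≫ psnd T W := by
  rw [← associator_hom_psnd_psnd, inv_hom_hom_assoc]

@[simp]
theorem associator_inv_psnd_assoc {u : C} (k : Roof.apex W ⟶ u) :
    (α_ S T W).inv.hom ≫ psnd (S ≫ T) W ≫ k = psnd S (T ≫ W) ≫ psnd T W ≫ k := by
  simpa only [Category.assoc] using congrArg (· ≫ k) (associator_inv_psnd S T W)

end

section

variable {a b c d e f : SpanCat C} {n : a ⟶ d} {p : d ⟶ f} {n₁ : a ⟶ b} {p₁ : b ⟶ c}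
  {n₂ : c ⟶ e} {p₂ : e ⟶ f} {n' : b ⟶ d} {p' : d ⟶ e} (μ : n ⟶ n₁ ≫ n') (π : p ⟶ p' ≫ p₂)
  (β : n' ≫ p' ⟶ p₁ ≫ n₂)

theorem splitting_pfst_pfst :
    Roof.Hom.hom (splitting μ π β) ≫ pfst (n₁ ≫ p₁) (n₂ ≫ p₂) ≫ pfst n₁ p₁ =
      pfst n p ≫ μ.hom ≫ pfst n₁ n' := by
  simp only [splitting, comp₂_hom, Category.assoc, whiskerRight_pfst_assoc, whiskerLeft_pfst,
    whiskerLeft_pfst_assoc, associator_hom_pfst, associator_inv_pfst_pfst]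

theorem splitting_psnd_psnd :
    Roof.Hom.hom (splitting μ π β) ≫ psnd (n₁ ≫ p₁) (n₂ ≫ p₂) ≫ psnd n₂ p₂ =
      psnd n p ≫ π.hom ≫ psnd p' p₂ := by
  simp only [splitting, comp₂_hom, Category.assoc, whiskerRight_psnd, whiskerRight_psnd_assoc,
    whiskerLeft_psnd_assoc, associator_hom_psnd_psnd, associator_hom_psnd_psnd_assoc,
    associator_inv_psnd, associator_inv_psnd_assoc]

variable {u : C} (q : u ⟶ (n ≫ p).apex) (t : u ⟶ (n' ≫ p').apex)
  (h₁ : t ≫ pfst n' p' = q ≫ pfst n p ≫ μ.hom ≫ psnd n₁ n')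
  (h₂ : t ≫ psnd n' p' = q ≫ psnd n p ≫ π.hom ≫ pfst p' p₂)
include h₁ h₂

/-- The morphism to the apex of `n' ≫ p'` which `splitting μ π β` passes through before `β` is
applied is characterized by its two projections. -/
theorem eq_lift_of_splitting :
    t = q ≫ (μ ▷ p).hom ≫ ((n₁ ≫ n') ◁ π).hom ≫ (α_ n₁ n' (p' ≫ p₂)).hom.hom ≫
    (n₁ ◁ (α_ n' p' p₂).inv).hom ≫ psnd _ _ ≫ pfst _ _ := by
  apply pfst_psnd_ext
  · rw [h₁]
    simp only [Category.assoc, whiskerRight_pfst_assoc, whiskerLeft_pfst_assoc,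
      whiskerLeft_psnd_assoc, associator_hom_psnd_pfst, associator_inv_pfst_pfst]
  · rw [h₂]
    simp only [Category.assoc, whiskerRight_psnd_assoc, whiskerLeft_psnd_assoc,
      associator_hom_psnd_psnd_assoc, associator_inv_pfst_psnd]

theorem splitting_pfst_psnd :
    q ≫ Roof.Hom.hom (splitting μ π β) ≫ pfst (n₁ ≫ p₁) (n₂ ≫ p₂) ≫ psnd n₁ p₁ =
      t ≫ β.hom ≫ pfst p₁ n₂ := by
  rw [eq_lift_of_splitting μ π q t h₁ h₂]
  simp only [splitting, comp₂_hom, Category.assoc, whiskerRight_pfst_assoc, whiskerLeft_psnd_assoc,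
    associator_hom_pfst, associator_inv_pfst_psnd]

theorem splitting_psnd_pfst :
    q ≫ Roof.Hom.hom (splitting μ π β) ≫ psnd (n₁ ≫ p₁) (n₂ ≫ p₂) ≫ pfst n₂ p₂ =
      t ≫ β.hom ≫ psnd p₁ n₂ := by
  rw [eq_lift_of_splitting μ π q t h₁ h₂]
  simp only [splitting, comp₂_hom, Category.assoc, whiskerRight_pfst_assoc, whiskerLeft_psnd_assoc,
    associator_hom_psnd_pfst, associator_inv_psnd_assoc]

end

section

variable {a b c d : C} {f : a ⟶ c} {g : a ⟶ b} {p : c ⟶ d} {h : b ⟶ d} (Q : IsPullback f g p h)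

theorem square_inv_pfst :
    (square Q).inv.hom ≫ pfst (i.map p) (j.map h.op) = pfst (j.map f.op) (i.map g) ≫ f := by
  refine (Category.assoc (Roof.fst (backward f) (forward g)) _ _).trans ?_
  exact congrArg (Roof.fst (backward f) (forward g) ≫ ·) (IsPullback.isoIsPullback_hom_fst c b Q
    ((forward p).isPullback (backward h)))

theorem square_inv_psnd :
    (square Q).inv.hom ≫ psnd (i.map p) (j.map h.op) = pfst (j.map f.op) (i.map g) ≫ g := by
  refine (Category.assoc (Roof.fst (backward f) (forward g)) _ _).trans ?_
  exact congrArg (Roof.fst (backward f) (forward g) ≫ ·) (IsPullback.isoIsPullback_hom_snd c b Q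
    ((forward p).isPullback (backward h)))

end

theorem factor_pfst {x y : SpanCat C} (S : x ⟶ y) :
    (factor S).hom ≫ pfst (j.map S.l.op) (i.map S.r) = 𝟙 S.apex := splitFst_factor S

theorem factor_pfst_assoc {x y : SpanCat C} (S : x ⟶ y) {u : C} (k : S.apex ⟶ u) :
    (factor S).hom ≫ pfst (j.map S.l.op) (i.map S.r) ≫ k = k :=
  (Category.assoc _ _ _).symm.trans
    ((congrArg (· ≫ k) (factor_pfst S)).trans (Category.id_comp k))

theorem factor_psnd {x y : SpanCat C} (S : x ⟶ y) :
    (factor S).hom ≫ psnd (j.map S.l.op) (i.map S.r) = 𝟙 S.apex := splitSnd_factor S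

theorem factor_psnd_assoc {x y : SpanCat C} (S : x ⟶ y) {u : C} (k : S.apex ⟶ u) :
    (factor S).hom ≫ psnd (j.map S.l.op) (i.map S.r) ≫ k = k :=
  (Category.assoc _ _ _).symm.trans
    ((congrArg (· ≫ k) (factor_psnd S)).trans (Category.id_comp k))

theorem j_mapComp'_fst {x y z : Cᵒᵖ} (f : x ⟶ y) (g : y ⟶ z) (k : x ⟶ z) (e : f ≫ g = k) :
    splitFst (j.mapComp' f g k e).hom = g.unop := by
  subst e
  rw [TwoFunctor.mapComp'_eq]
  exact backwardComp_hom_fst _ _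

theorem j_mapComp'_snd {x y z : Cᵒᵖ} (f : x ⟶ y) (g : y ⟶ z) (k : x ⟶ z) (e : f ≫ g = k) :
    splitSnd (j.mapComp' f g k e).hom = 𝟙 _ := by
  subst e
  rw [TwoFunctor.mapComp'_eq]
  exact backwardComp_hom_snd _ _

theorem i_mapComp'_fst {x y z : C} (f : x ⟶ y) (g : y ⟶ z) (k : x ⟶ z) (e : f ≫ g = k) :
    splitFst (i.mapComp' f g k e).hom = 𝟙 _ := by
  subst e
  rw [TwoFunctor.mapComp'_eq]
  exact forwardComp_hom_fst _ _

theorem i_mapComp'_snd {x y z : C} (f : x ⟶ y) (g : y ⟶ z) (k : x ⟶ z) (e : f ≫ g = k) :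
    splitSnd (i.mapComp' f g k e).hom = f := by
  subst e
  rw [TwoFunctor.mapComp'_eq]
  exact forwardComp_hom_snd _ _

variable {x y z : SpanCat C} {U : x ⟶ z} {S : x ⟶ y} {T : y ⟶ z} (φ : U ⟶ S ≫ T)

/-- A 2-morphism `φ : U ⟶ S ≫ T`, followed by the factorizations of `S` and `T`, is the
factorization of `U` followed by a splitting which is made of the structure 2-morphisms of `i` and
`j` and of the 2-morphism of a cartesian square. -/
theorem comp_factor :
    φ ≫ factor S ▷ T ≫ (j.map S.l.op ≫ i.map S.r) ◁ factor T =
      factor U ≫ splitting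
        (j.mapComp' S.l.op (splitFst φ).op U.l.op (congrArg Quiver.Hom.op (splitFst_l φ))).hom
        (i.mapComp' (splitSnd φ) T.r U.r (splitSnd_r φ)).hom (square (isPullback_split φ)).inv := by
  -- The factorization of this span is the `t` of `splitting_pfst_psnd` and `splitting_psnd_pfst`.
  let V : (⟨S.apex⟩ : SpanCat C) ⟶ ⟨T.apex⟩ := Roof.mk U.apex (splitFst φ) (splitSnd φ)
  have e₁ := j_mapComp'_fst S.l.op (splitFst φ).op U.l.op (congrArg Quiver.Hom.op (splitFst_l φ))
  have e₂ := j_mapComp'_snd S.l.op (splitFst φ).op U.l.op (congrArg Quiver.Hom.op (splitFst_l φ))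
  have e₃ := i_mapComp'_fst (splitSnd φ) T.r U.r (splitSnd_r φ)
  have e₄ := i_mapComp'_snd (splitSnd φ) T.r U.r (splitSnd_r φ)
  have hV₁ := factor_pfst V
  have hV₂ := factor_psnd V
  set μ := (j.mapComp' S.l.op (splitFst φ).op U.l.op (congrArg Quiver.Hom.op (splitFst_l φ))).hom
    with hμ
  set π := (i.mapComp' (splitSnd φ) T.r U.r (splitSnd_r φ)).hom with hπ
  have h₁ : (factor V).hom ≫ pfst (j.map (splitFst φ).op) (i.map (splitSnd φ)) =
      (factor U).hom ≫ pfst _ _ ≫ μ.hom ≫ psnd _ _ :=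
    hV₁.trans (e₂.symm.trans (factor_pfst_assoc U (μ.hom ≫ psnd _ _)).symm)
  have h₂ : (factor V).hom ≫ psnd (j.map (splitFst φ).op) (i.map (splitSnd φ)) =
      (factor U).hom ≫ psnd _ _ ≫ π.hom ≫ pfst _ _ :=
    hV₂.trans (e₃.symm.trans (factor_psnd_assoc U (π.hom ≫ pfst _ _)).symm)
  apply hom₂_ext
  apply pfst_psnd_ext <;> apply pfst_psnd_ext
  · simp only [comp₂_hom, Category.assoc, whiskerLeft_pfst_assoc, whiskerRight_pfst_assoc,
      splitting_pfst_pfst, factor_pfst]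
    exact (congrArg (φ.hom ≫ ·) (Category.comp_id (pfst S T))).trans
      (e₁.symm.trans (factor_pfst_assoc U (μ.hom ≫ pfst _ _)).symm)
  · simp only [comp₂_hom, Category.assoc, whiskerLeft_pfst_assoc, whiskerRight_pfst_assoc,
      factor_psnd]
    rw [splitting_pfst_psnd μ π _ _ _ h₁ h₂, square_inv_pfst]
    exact (congrArg (φ.hom ≫ ·) (Category.comp_id (pfst S T))).trans
      (factor_pfst_assoc V _).symm
  · simp only [comp₂_hom, Category.assoc, whiskerLeft_psnd_assoc,
      factor_pfst]
    rw [splitting_psnd_pfst μ π _ _ _ h₁ h₂, square_inv_psnd]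
    exact ((congrArg (φ.hom ≫ (factor S ▷ T).hom ≫ ·) (Category.comp_id
      (psnd (j.map S.l.op ≫ i.map S.r) T))).trans
        (congrArg (φ.hom ≫ ·) (whiskerRight_psnd S T _))).trans
      (factor_pfst_assoc V _).symm
  · simp only [comp₂_hom, Category.assoc, whiskerLeft_psnd_assoc,
      splitting_psnd_psnd, factor_psnd]
    exact ((congrArg (φ.hom ≫ (factor S ▷ T).hom ≫ ·) (Category.comp_id
      (psnd (j.map S.l.op ≫ i.map S.r) T))).trans
        (congrArg (φ.hom ≫ ·) (whiskerRight_psnd S T _))).trans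
      (e₄.symm.trans (factor_psnd_assoc U (π.hom ≫ psnd _ _)).symm)

end SpanCat

end

/-! ### Comparison of a Mackey functor with the canonical pseudofunctor -/

section
variable {K : Type u₂} [Bicategory.{w, v₂} K]

namespace Comparison

variable {B : Type u₁} [Bicategory.{v₃, v₁} B] {M : B ⥤ᵖ K} {X : B → K}
  {app : ∀ x, M.obj x ⟶ X x}

/-- A comparison for `S'` gives one for every isomorphic 1-morphism `S`. -/
def precomp {x y : B} {S S' : x ⟶ y} {s : X x ⟶ X y} (φ : S ≅ S') (e : Comparison M app S' s) :
    Comparison M app S s :=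
  whiskerRightIso (M.map₂Iso φ) _ ≪≫ e

theorem compat_precomp {x y : B} {S S' : x ⟶ y} {s : X x ⟶ X y} (φ : S ≅ S')
    (e : Comparison M app S' s) : Compat (precomp φ e) e φ.hom (𝟙 s) := by
  simp [Compat, precomp]

theorem Compat.congr {x y : B} {S S' : x ⟶ y} {s s' : X x ⟶ X y} {e : Comparison M app S s}
    {e' : Comparison M app S' s'} {φ φ' : S ⟶ S'} {ψ ψ' : s ⟶ s'} (h : Compat e e' φ ψ)
    (hφ : φ = φ') (hψ : ψ = ψ') : Compat e e' φ' ψ' := by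
  subst hφ hψ; exact h

end Comparison

open Comparison

variable {C : Type u₁} [Category.{v₁} C] {obj : C → K} {P : TwoFunctor C obj}
  {N : TwoFunctor Cᵒᵖ (fun x => obj x.unop)} [HasPullbacks C]

theorem SpanCat.factor_one (x : SpanCat C) :
    factor (𝟙 x) ≫ (j.mapId (op x.of)).hom ▷ i.map (𝟙 x.of) ≫ 𝟙 x ◁ (i.mapId x.of).hom ≫
      (λ_ (𝟙 x)).hom = 𝟙 (𝟙 x) := by
  -- The 2-morphisms `mapId` of `i` and `j` are identities by definition, but not syntactically, so
  -- that the equations have to be composed as terms.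
  have h₁ : (j.mapId (op x.of)).hom ▷ i.map (𝟙 x.of) = 𝟙 _ := id_whiskerRight (𝟙 x) _
  have h₂ : 𝟙 x ◁ (i.mapId x.of).hom = 𝟙 _ := whiskerLeft_id (𝟙 x) (𝟙 x)
  refine (congrArg (factor (𝟙 x) ≫ ·) ((congrArg (· ≫ 𝟙 x ◁ (i.mapId x.of).hom ≫ (λ_ (𝟙 x)).hom)
    h₁).trans ((Category.id_comp _).trans ((congrArg (· ≫ (λ_ (𝟙 x)).hom) h₂).trans
      (Category.id_comp _))))).trans ?_
  exact hom₂_ext (factor_psnd (𝟙 x))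

theorem SpanCat.factor_i {x y : C} (f : x ⟶ y) :
    factor (i.map f) ≫ (j.mapId (op x)).hom ▷ i.map f ≫ (λ_ (i.map f)).hom = 𝟙 (i.map f) := by
  have h : (j.mapId (op x)).hom ▷ i.map f = 𝟙 _ := id_whiskerRight (i.map (𝟙 x)) (i.map f)
  refine (congrArg (factor (i.map f) ≫ ·) ((congrArg (· ≫ (λ_ (i.map f)).hom) h).trans
    (Category.id_comp _))).trans ?_
  exact hom₂_ext (factor_psnd (i.map f))

theorem SpanCat.factor_j {x y : C} (f : x ⟶ y) :
    factor (j.map f.op) ≫ j.map f.op ◁ (i.mapId x).hom ≫ (ρ_ (j.map f.op)).hom =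
      𝟙 (j.map f.op) := by
  have h : j.map f.op ◁ (i.mapId x).hom = 𝟙 _ := whiskerLeft_id (j.map f.op) (j.map (𝟙 (op x)))
  refine (congrArg (factor (j.map f.op) ≫ ·) ((congrArg (· ≫ (ρ_ (j.map f.op)).hom) h).trans
    (Category.id_comp _))).trans ?_
  exact hom₂_ext (factor_pfst (j.map f.op))

variable (P N) in
/-- The canonical isomorphism between `P f` and the value `N 𝟙 ≫ P f` of a span `(𝟙, x, f)`. -/
def forwardIso {x y : C} (f : x ⟶ y) : N.map (𝟙 (op x)) ≫ P.map f ≅ P.map f :=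
  whiskerRightIso (N.mapId (op x)) _ ≪≫ λ_ _

variable (P N) in
/-- The canonical isomorphism between `N f` and the value `N f ≫ P 𝟙` of a span `(f, x, 𝟙)`. -/
def backwardIso {x y : C} (f : x ⟶ y) : N.map f.op ≫ P.map (𝟙 x) ≅ N.map f.op :=
  whiskerLeftIso _ (P.mapId x) ≪≫ ρ_ _

namespace MackeyFunctor

variable {β : BaseChangeData P N} (M : MackeyFunctor P N β)

/-- The identification of `F (l, z, r)` with `N l ≫ P r`. -/
def compSpan {x y : SpanCat C} (S : x ⟶ y) :
    Comparison M.functor (X := fun x : SpanCat C => obj x.of) (fun x => M.app x.of) S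
      (N.map S.l.op ≫ P.map S.r) :=
  precomp (asIso (SpanCat.factor S)) ((M.compN S.l.op).comp (M.compP S.r))

theorem compat_factor {x y : SpanCat C} (S : x ⟶ y) :
    Compat (M.compSpan S) ((M.compN S.l.op).comp (M.compP S.r)) (SpanCat.factor S) (𝟙 _) :=
  compat_precomp (asIso (SpanCat.factor S)) ((M.compN S.l.op).comp (M.compP S.r))

/-- The comparisons `compSpan` are compatible with composition: by `SpanCat.comp_factor` this
reduces to the compatibilities of the comparisons with `P`, with `N` and with base change. -/
theorem compat_split (hβ : β.IsCoherent) {x y z : SpanCat C} {U : x ⟶ z} {S : x ⟶ y} {T : y ⟶ z}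
    (φ : U ⟶ S ≫ T) :
    Compat (M.compSpan U) ((M.compSpan S).comp (M.compSpan T)) φ
      (hβ.compositionSystem.split φ) := by
  have h₁ : Compat (M.compSpan U) _ _ _ := (M.compat_factor U).comp <| Compat.splitting
    (M.compat_mapComp'_N S.l.op (SpanCat.splitFst φ).op U.l.op
      (congrArg Quiver.Hom.op (SpanCat.splitFst_l φ)))
    (M.compat_mapComp'_P (SpanCat.splitSnd φ) T.r U.r (SpanCat.splitSnd_r φ))
    (Compat.inv (M.compat_baseChange (SpanCat.isPullback_split φ)))
  have h₂ := Compat.inv (φ := whiskerRightIso (asIso (SpanCat.factor S)) T ≪≫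
      whiskerLeftIso _ (asIso (SpanCat.factor T)))
    (ψ := whiskerRightIso (Iso.refl (N.map S.l.op ≫ P.map S.r)) (N.map T.l.op ≫ P.map T.r) ≪≫
      whiskerLeftIso (N.map S.l.op ≫ P.map S.r) (Iso.refl (N.map T.l.op ≫ P.map T.r)))
    ((((M.compat_factor S).whiskerRight (M.compSpan T)).comp
      (Compat.whiskerLeft _ (M.compat_factor T))).congr (by simp) (by simp))
  refine (h₁.comp h₂).congr ?_ ?_
  · rw [Iso.comp_inv_eq]
    exact (SpanCat.comp_factor φ).symm
  · refine (congrArg (_ ≫ ·) ?_).trans ((Category.comp_id _).trans (Category.id_comp _))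
    simp

theorem compat_one (hβ : β.IsCoherent) (x : SpanCat C) :
    Compat (M.compSpan (𝟙 x)) (Comparison.id (X := fun x : SpanCat C => obj x.of)
      (fun x => M.app x.of) x) (𝟙 _) (hβ.compositionSystem.mapId x).hom := by
  have h := (M.compat_factor (𝟙 x)).comp <|
    ((M.compat_mapId_N (op x.of)).whiskerRight (M.compP (𝟙 x.of))).comp <|
      (Compat.whiskerLeft _ (M.compat_mapId_P x.of)).comp <| Compat.leftUnitor _
  exact h.congr (SpanCat.factor_one x) (Category.id_comp _)

theorem compat_map₂ (hβ : β.IsCoherent) {x y : SpanCat C} {S T : x ⟶ y} (η : S ⟶ T) :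
    Compat (M.compSpan S) (M.compSpan T) η (hβ.compositionSystem.map₂ η) := by
  have h := (M.compat_split hβ (η ≫ (ρ_ T).inv)).comp <|
    (Compat.whiskerLeft (M.compSpan T) (M.compat_one hβ y)).comp <| Compat.rightUnitor _
  exact h.congr (by simp) rfl

theorem compat_forward {x y : C} (f : x ⟶ y) :
    Compat (M.compSpan (SpanCat.i.map f)) (M.compP f) (𝟙 _) (forwardIso P N f).hom := by
  have h := (M.compat_factor (SpanCat.i.map f)).comp <|
    ((M.compat_mapId_N (op x)).whiskerRight (M.compP f)).comp <| Compat.leftUnitor _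
  exact h.congr (SpanCat.factor_i f) (Category.id_comp _)

theorem compat_backward {x y : C} (f : x ⟶ y) :
    Compat (M.compSpan (SpanCat.j.map f.op)) (M.compN f.op) (𝟙 _) (backwardIso P N f).hom := by
  have h := (M.compat_factor (SpanCat.j.map f.op)).comp <|
    (Compat.whiskerLeft (M.compN f.op) (M.compat_mapId_P x)).comp <| Compat.rightUnitor _
  exact h.congr (SpanCat.factor_j f) (Category.id_comp _)

/-- The comparisons `compSpan` make up a transformation from a Mackey functor to the canonical
pseudofunctor on spans. -/
def toCanonical (hβ : β.IsCoherent) :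
    Pseudofunctor.StrongTrans M.functor hβ.compositionSystem.toPseudofunctor where
  app x := M.app x.of
  naturality S := M.compSpan S
  naturality_naturality η := M.compat_map₂ hβ η
  naturality_id x := by
    have h := M.compat_one hβ x
    unfold Compat at h
    refine Eq.trans h.symm ?_
    simp [Comparison.id]
    rfl
  naturality_comp S T := by
    have h := M.compat_split hβ (𝟙 (S ≫ T))
    unfold Compat at h
    refine Eq.trans h.symm ?_
    simp only [Comparison.comp, Iso.trans_hom, whiskerRightIso_hom, whiskerLeftIso_hom,
      Iso.symm_hom, M.functor.map₂_id, id_whiskerRight, Category.id_comp]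
    rfl

end MackeyFunctor
end

/-! ### Cancelling equivalences -/

section
variable {K : Type u₂} [Bicategory.{w, v₂} K]

theorem unit_comp_whiskerRight {a b b' : K} {u : b ⟶ b'} {w : b' ⟶ b} {f g : a ⟶ b} (η : f ⟶ g)
    (i : 𝟙 b ⟶ u ≫ w) :
    η ≫ (ρ_ g).inv ≫ g ◁ i ≫ (α_ _ _ _).inv =
      ((ρ_ f).inv ≫ f ◁ i ≫ (α_ _ _ _).inv) ≫ η ▷ u ▷ w := by
  calc
    _ = 𝟙 _ ⊗≫ (η ▷ 𝟙 b ≫ g ◁ i) ⊗≫ 𝟙 _ := by bicategory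
    _ = _ := by rw [← whisker_exchange]; bicategory

theorem whiskerRight_comp_counit {a b b' : K} {u : b ⟶ b'} {w : b' ⟶ b} {f g : a ⟶ b'} (η : f ⟶ g)
    (i : w ≫ u ⟶ 𝟙 b') :
    η ▷ w ▷ u ≫ (α_ _ _ _).hom ≫ g ◁ i ≫ (ρ_ g).hom =
      ((α_ _ _ _).hom ≫ f ◁ i ≫ (ρ_ f).hom) ≫ η := by
  calc
    _ = 𝟙 _ ⊗≫ (η ▷ (w ≫ u) ≫ g ◁ i) ⊗≫ 𝟙 _ := by bicategory
    _ = _ := by rw [← whisker_exchange]; bicategory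

/-- Postcomposition with an equivalence is an equivalence of categories of 1-morphisms. -/
def postcompEquivalence (a : K) {b c : K} (e : Bicategory.Equivalence b c) : (a ⟶ b) ≌ (a ⟶ c) :=
  .mk (postcomp a e.hom) (postcomp a e.inv)
    (NatIso.ofComponents
      (fun f => (ρ_ f).symm ≪≫ whiskerLeftIso f e.unit ≪≫ (α_ _ _ _).symm)
      fun η => unit_comp_whiskerRight η e.unit.hom)
    (NatIso.ofComponents (fun f => α_ _ _ _ ≪≫ whiskerLeftIso f e.counit ≪≫ ρ_ f)
      fun η => whiskerRight_comp_counit η e.counit.hom)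

theorem whiskerRight_injective {a b c : K} (e : Bicategory.Equivalence b c) {f g : a ⟶ b}
    {η θ : f ⟶ g}
    (h : η ▷ e.hom = θ ▷ e.hom) : η = θ :=
  (postcompEquivalence a e).functor.map_injective h

/-- An isomorphism of composites with an equivalence comes from an isomorphism. -/
def whiskerRightPreimage {a b c : K} (e : Bicategory.Equivalence b c) {f g : a ⟶ b}
    (θ : f ≫ e.hom ≅ g ≫ e.hom) : f ≅ g :=
  (postcompEquivalence a e).functor.preimageIso θ

theorem whiskerRightPreimage_whiskerRight {a b c : K} (e : Bicategory.Equivalence b c) {f g : a ⟶ b}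
    (θ : f ≫ e.hom ≅ g ≫ e.hom) : (whiskerRightPreimage e θ).hom ▷ e.hom = θ.hom :=
  (postcompEquivalence a e).functor.map_preimage θ.hom

/-- The composite of an equivalence with the inverse of another one. -/
def quotient {a a' b : K} (e : Bicategory.Equivalence a b) (e' : Bicategory.Equivalence a' b) :
    Bicategory.Equivalence a a' :=
  .mkOfAdjointifyCounit (f := e.hom ≫ e'.inv) (g := e'.hom ≫ e.inv)
    (e.unit ≪≫ whiskerLeftIso _ ((λ_ _).symm ≪≫ whiskerRightIso e'.counit.symm _ ≪≫ α_ _ _ _) ≪≫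
      (α_ _ _ _).symm)
    (α_ _ _ _ ≪≫ whiskerLeftIso _ ((α_ _ _ _).symm ≪≫ whiskerRightIso e.counit _ ≪≫ λ_ _) ≪≫
      e'.unit.symm)

/-- The quotient of `e` by `e'`, followed by `e'`, is isomorphic to `e`. -/
def quotientIso {a a' b : K} (e : Bicategory.Equivalence a b) (e' : Bicategory.Equivalence a' b) :
    (quotient e e').hom ≫ e'.hom ≅ e.hom :=
  α_ _ _ _ ≪≫ whiskerLeftIso _ e'.counit ≪≫ ρ_ _

/-! ### The quotient of two equivalences with the same target -/

section

variable {B : Type u₁} [Bicategory.{v₃, v₁} B] {G G' F : B ⥤ᵖ K}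
  (γ : Pseudofunctor.StrongTrans G F) (γ' : Pseudofunctor.StrongTrans G' F)
  (t : ∀ x, G.obj x ⟶ G'.obj x) (ι : ∀ x, t x ≫ γ'.app x ≅ γ.app x)

/-- The naturality isomorphism of a transformation `t` with `t ≫ γ' ≅ γ`, composed with `γ'`: it is
determined by those of `γ` and `γ'`. If the components of `γ'` are equivalences, it can be lifted
through them, and the lifts `τ` satisfy the conditions on a transformation by the lemmas below. -/
def liftedNaturality {x y : B} (f : x ⟶ y) :
    (G.map f ≫ t y) ≫ γ'.app y ≅ (t x ≫ G'.map f) ≫ γ'.app y :=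
  α_ _ _ _ ≪≫ whiskerLeftIso _ (ι y) ≪≫ γ.naturality f ≪≫ whiskerRightIso (ι x).symm _ ≪≫
    α_ _ _ _ ≪≫ whiskerLeftIso _ (γ'.naturality f).symm ≪≫ (α_ _ _ _).symm

variable {γ γ' t ι} (τ : ∀ {x y : B} (f : x ⟶ y), G.map f ≫ t y ≅ t x ≫ G'.map f)
  (hτ : ∀ {x y : B} (f : x ⟶ y), (τ f).hom ▷ γ'.app y = (liftedNaturality γ γ' t ι f).hom)
include hτ

theorem lifted_eq {x y : B} (f : x ⟶ y) :
    (τ f).hom ▷ γ'.app y = 𝟙 _ ⊗≫ G.map f ◁ (ι y).hom ⊗≫ (γ.naturality f).hom ⊗≫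
      (ι x).inv ▷ F.map f ⊗≫ t x ◁ (γ'.naturality f).inv ⊗≫ 𝟙 _ := by
  rw [hτ, liftedNaturality]
  simp [bicategoricalComp]

theorem lifted_naturality {x y : B} {f g : x ⟶ y} (η : f ⟶ g) :
    (G.map₂ η ▷ t y ≫ (τ g).hom) ▷ γ'.app y = ((τ f).hom ≫ t x ◁ G'.map₂ η) ▷ γ'.app y := by
  have h₁ := γ.naturality_naturality η
  have h₂ : (γ'.naturality f).inv ≫ G'.map₂ η ▷ γ'.app y =
      γ'.app x ◁ F.map₂ η ≫ (γ'.naturality g).inv := by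
    rw [Iso.inv_comp_eq, ← Category.assoc, Iso.eq_comp_inv, γ'.naturality_naturality]
  rw [comp_whiskerRight, comp_whiskerRight, lifted_eq τ hτ, lifted_eq τ hτ]
  calc
    _ = 𝟙 _ ⊗≫ (G.map₂ η ▷ (t y ≫ γ'.app y) ≫ G.map g ◁ (ι y).hom) ⊗≫ (γ.naturality g).hom ⊗≫
      (ι x).inv ▷ F.map g ⊗≫ t x ◁ (γ'.naturality g).inv ⊗≫ 𝟙 _ := by bicategory
    _ = 𝟙 _ ⊗≫ G.map f ◁ (ι y).hom ⊗≫ (G.map₂ η ▷ _ ≫ (γ.naturality g).hom) ⊗≫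
      (ι x).inv ▷ F.map g ⊗≫ t x ◁ (γ'.naturality g).inv ⊗≫ 𝟙 _ := by
      rw [← whisker_exchange]; bicategory
    _ = 𝟙 _ ⊗≫ G.map f ◁ (ι y).hom ⊗≫ (γ.naturality f).hom ⊗≫ (γ.app x ◁ F.map₂ η ≫
      (ι x).inv ▷ F.map g) ⊗≫ t x ◁ (γ'.naturality g).inv ⊗≫ 𝟙 _ := by
      rw [h₁]; bicategory
    _ = 𝟙 _ ⊗≫ G.map f ◁ (ι y).hom ⊗≫ (γ.naturality f).hom ⊗≫ (ι x).inv ▷ F.map f ⊗≫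
      t x ◁ (γ'.app x ◁ F.map₂ η ≫ (γ'.naturality g).inv) ⊗≫ 𝟙 _ := by
      rw [whisker_exchange]; bicategory
    _ = _ := by
      rw [← h₂]; bicategory

theorem lifted_id (x : B) :
    ((τ (𝟙 x)).hom ≫ t x ◁ (G'.mapId x).hom) ▷ γ'.app x =
      ((G.mapId x).hom ▷ t x ≫ (λ_ (t x)).hom ≫ (ρ_ (t x)).inv) ▷ γ'.app x := by
  have h₁ := γ.naturality_id x
  have h₂ : (γ'.naturality (𝟙 x)).inv ≫ (G'.mapId x).hom ▷ γ'.app x =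
      γ'.app x ◁ (F.mapId x).hom ≫ (ρ_ _).hom ≫ (λ_ _).inv := by
    rw [Iso.inv_comp_eq, ← Category.assoc, γ'.naturality_id]; simp
  rw [comp_whiskerRight, lifted_eq τ hτ]
  calc
    _ = 𝟙 _ ⊗≫ G.map (𝟙 x) ◁ (ι x).hom ⊗≫ (γ.naturality (𝟙 x)).hom ⊗≫ (ι x).inv ▷ F.map (𝟙 x) ⊗≫
      t x ◁ ((γ'.naturality (𝟙 x)).inv ≫ (G'.mapId x).hom ▷ γ'.app x) ⊗≫ 𝟙 _ := by bicategory
    _ = 𝟙 _ ⊗≫ G.map (𝟙 x) ◁ (ι x).hom ⊗≫ (γ.naturality (𝟙 x)).hom ⊗≫ ((ι x).inv ▷ F.map (𝟙 x) ≫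
      (t x ≫ γ'.app x) ◁ (F.mapId x).hom) ⊗≫ 𝟙 _ := by
      rw [h₂]; bicategory
    _ = 𝟙 _ ⊗≫ G.map (𝟙 x) ◁ (ι x).hom ⊗≫ ((γ.naturality (𝟙 x)).hom ≫
      γ.app x ◁ (F.mapId x).hom) ⊗≫ (ι x).inv ⊗≫ 𝟙 _ := by
      rw [← whisker_exchange]; bicategory
    _ = 𝟙 _ ⊗≫ (G.map (𝟙 x) ◁ (ι x).hom ≫ (G.mapId x).hom ▷ γ.app x) ⊗≫ (ι x).inv ⊗≫ 𝟙 _ := by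
      rw [h₁]; bicategory
    _ = 𝟙 _ ⊗≫ (G.mapId x).hom ▷ (t x ≫ γ'.app x) ⊗≫ ((ι x).hom ≫ (ι x).inv) ⊗≫ 𝟙 _ := by
      rw [whisker_exchange]; bicategory
    _ = _ := by
      rw [Iso.hom_inv_id]; bicategory

theorem lifted_comp {x y z : B} (f : x ⟶ y) (g : y ⟶ z) :
    ((τ (f ≫ g)).hom ≫ t x ◁ (G'.mapComp f g).hom) ▷ γ'.app z =
      ((G.mapComp f g).hom ▷ t z ≫ (α_ _ _ _).hom ≫ G.map f ◁ (τ g).hom ≫ (α_ _ _ _).inv ≫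
        (τ f).hom ▷ G'.map g ≫ (α_ _ _ _).hom) ▷ γ'.app z := by
  have h₁ := γ.naturality_comp f g
  have h₂ : (γ'.naturality (f ≫ g)).inv ≫ (G'.mapComp f g).hom ▷ γ'.app z =
      γ'.app x ◁ (F.mapComp f g).hom ≫ (α_ _ _ _).inv ≫ (γ'.naturality f).inv ▷ F.map g ≫
        (α_ _ _ _).hom ≫ G'.map f ◁ (γ'.naturality g).inv ≫ (α_ _ _ _).inv := by
    rw [Iso.inv_comp_eq, ← Category.assoc, γ'.naturality_comp]
    simp only [Category.assoc, Iso.hom_inv_id_assoc, hom_inv_whiskerRight_assoc,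
      Iso.inv_hom_id_assoc, whiskerLeft_hom_inv_assoc, Iso.hom_inv_id, Category.comp_id]
  have hg := lifted_eq τ hτ g
  have hf := lifted_eq τ hτ f
  rw [comp_whiskerRight, lifted_eq τ hτ]
  symm
  calc
    _ = (G.mapComp f g).hom ▷ t z ▷ γ'.app z ⊗≫ G.map f ◁ ((τ g).hom ▷ γ'.app z) ⊗≫
      ((τ f).hom ▷ (G'.map g ≫ γ'.app z) ≫ (t x ≫ G'.map f) ◁ (γ'.naturality g).hom) ⊗≫
      t x ◁ G'.map f ◁ (γ'.naturality g).inv ⊗≫ 𝟙 _ := by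
      rw [show (G.mapComp f g).hom ▷ t z ▷ γ'.app z ⊗≫ G.map f ◁ ((τ g).hom ▷ γ'.app z) ⊗≫
        ((τ f).hom ▷ (G'.map g ≫ γ'.app z) ≫ (t x ≫ G'.map f) ◁ (γ'.naturality g).hom) ⊗≫
        t x ◁ G'.map f ◁ (γ'.naturality g).inv ⊗≫ 𝟙 ((t x ≫ G'.map f ≫ G'.map g) ≫ γ'.app z) =
        (G.mapComp f g).hom ▷ t z ▷ γ'.app z ⊗≫ G.map f ◁ ((τ g).hom ▷ γ'.app z) ⊗≫
        (τ f).hom ▷ (G'.map g ≫ γ'.app z) ⊗≫ t x ◁ G'.map f ◁ ((γ'.naturality g).hom ≫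
          (γ'.naturality g).inv) ⊗≫ 𝟙 _ by bicategory, Iso.hom_inv_id]
      bicategory
    _ = (G.mapComp f g).hom ▷ t z ▷ γ'.app z ⊗≫ G.map f ◁ ((τ g).hom ▷ γ'.app z ⊗≫
       t y ◁ (γ'.naturality g).hom) ⊗≫ (τ f).hom ▷ γ'.app y ▷ F.map g ⊗≫
      t x ◁ G'.map f ◁ (γ'.naturality g).inv ⊗≫ 𝟙 _ := by
      rw [← whisker_exchange]; bicategory
    _ = (G.mapComp f g).hom ▷ t z ▷ γ'.app z ⊗≫ G.map f ◁ (G.map g ◁ (ι z).hom ⊗≫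
      (γ.naturality g).hom ⊗≫ (ι y).inv ▷ F.map g ⊗≫ t y ◁ ((γ'.naturality g).inv ≫
        (γ'.naturality g).hom)) ⊗≫ (G.map f ◁ (ι y).hom ⊗≫ (γ.naturality f).hom ⊗≫
      (ι x).inv ▷ F.map f ⊗≫ t x ◁ (γ'.naturality f).inv) ▷ F.map g ⊗≫
      t x ◁ G'.map f ◁ (γ'.naturality g).inv ⊗≫ 𝟙 _ := by
      rw [hf, hg]; bicategory
    _ = 𝟙 _ ⊗≫ ((G.mapComp f g).hom ▷ (t z ≫ γ'.app z) ≫ (G.map f ≫ G.map g) ◁ (ι z).hom) ⊗≫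
      G.map f ◁ ((γ.naturality g).hom ⊗≫ ((ι y).inv ≫ (ι y).hom) ▷ F.map g) ⊗≫
      (γ.naturality f).hom ▷ F.map g ⊗≫ (ι x).inv ▷ F.map f ▷ F.map g ⊗≫
        t x ◁ (γ'.naturality f).inv ▷ F.map g ⊗≫
      t x ◁ G'.map f ◁ (γ'.naturality g).inv ⊗≫ 𝟙 _ := by
      rw [Iso.inv_hom_id]; bicategory
    _ = 𝟙 _ ⊗≫ G.map (f ≫ g) ◁ (ι z).hom ⊗≫ ((G.mapComp f g).hom ▷ γ.app z ≫ (α_ _ _ _).hom ≫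
        G.map f ◁ (γ.naturality g).hom ≫ (α_ _ _ _).inv ≫ (γ.naturality f).hom ▷ F.map g ≫
        (α_ _ _ _).hom) ⊗≫ (ι x).inv ▷ F.map f ▷ F.map g ⊗≫
        t x ◁ (γ'.naturality f).inv ▷ F.map g ⊗≫
      t x ◁ G'.map f ◁ (γ'.naturality g).inv ⊗≫ 𝟙 _ := by
      rw [Iso.inv_hom_id, ← whisker_exchange]; bicategory
    _ = 𝟙 _ ⊗≫ G.map (f ≫ g) ◁ (ι z).hom ⊗≫ (γ.naturality (f ≫ g)).hom ⊗≫
      (γ.app x ◁ (F.mapComp f g).hom ≫ (ι x).inv ▷ (F.map f ≫ F.map g)) ⊗≫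
        t x ◁ (γ'.naturality f).inv ▷ F.map g ⊗≫
      t x ◁ G'.map f ◁ (γ'.naturality g).inv ⊗≫ 𝟙 _ := by
      rw [← h₁]; bicategory
    _ = 𝟙 _ ⊗≫ G.map (f ≫ g) ◁ (ι z).hom ⊗≫ (γ.naturality (f ≫ g)).hom ⊗≫
      (ι x).inv ▷ F.map (f ≫ g) ⊗≫ t x ◁ (γ'.app x ◁ (F.mapComp f g).hom ≫ (α_ _ _ _).inv ≫
        (γ'.naturality f).inv ▷ F.map g ≫
        (α_ _ _ _).hom ≫ G'.map f ◁ (γ'.naturality g).inv ≫ (α_ _ _ _).inv) ⊗≫ 𝟙 _ := by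
      rw [whisker_exchange]; bicategory
    _ = _ := by
      rw [← h₂]; bicategory

theorem lifted_comm {x y : B} (f : x ⟶ y) :
    G.map f ◁ (ι y).hom ≫ (γ.naturality f).hom =
      (α_ _ _ _).inv ≫ (τ f).hom ▷ γ'.app y ≫ (α_ _ _ _).hom ≫
        t x ◁ (γ'.naturality f).hom ≫ (α_ _ _ _).inv ≫ (ι x).hom ▷ F.map f := by
  rw [hτ, liftedNaturality]
  simp

end

section

variable {B : Type u₁} [Bicategory.{v₃, v₁} B] {G G' F : B ⥤ᵖ K}
  (γ : Pseudofunctor.StrongTrans G F) (γ' : Pseudofunctor.StrongTrans G' F)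
  (e : ∀ x, Bicategory.Equivalence (G.obj x) (F.obj x)) (he : ∀ x, (e x).hom = γ.app x)
  (e' : ∀ x, Bicategory.Equivalence (G'.obj x) (F.obj x)) (he' : ∀ x, (e' x).hom = γ'.app x)

/-- The component of the quotient of `γ` by `γ'`, followed by that of `γ'`, is isomorphic to that of
`γ`. -/
def quotientAppIso (x : B) : (quotient (e x) (e' x)).hom ≫ γ'.app x ≅ γ.app x :=
  whiskerLeftIso _ (eqToIso (he' x).symm) ≪≫ quotientIso (e x) (e' x) ≪≫ eqToIso (he x)

include he' in
theorem exists_lift {x : B} {y : K} {f g : y ⟶ G'.obj x} (θ : f ≫ γ'.app x ≅ g ≫ γ'.app x) :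
    ∃ τ : f ≅ g, τ.hom ▷ γ'.app x = θ.hom := by
  have h := he' x
  generalize γ'.app x = u at h θ
  subst h
  exact ⟨whiskerRightPreimage (e' x) θ, whiskerRightPreimage_whiskerRight (e' x) θ⟩

include he' in
theorem whiskerRight_app_injective {x : B} {y : K} {f g : y ⟶ G'.obj x} {η θ : f ⟶ g}
    (h : η ▷ γ'.app x = θ ▷ γ'.app x) : η = θ := by
  have h' := he' x
  generalize γ'.app x = u at h h'
  subst h'
  exact whiskerRight_injective (e' x) h

/-- The quotient of `γ` by `γ'`, for transformations `γ` and `γ'` whose components are equivalences.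
-/
def quotientTrans : Pseudofunctor.StrongTrans G G' where
  app x := (quotient (e x) (e' x)).hom
  naturality f := (exists_lift γ' e' he'
    (liftedNaturality γ γ' _ (quotientAppIso γ γ' e he e' he') f)).choose
  naturality_naturality η := whiskerRight_app_injective γ' e' he'
    (lifted_naturality _ (fun f => (exists_lift γ' e' he' (liftedNaturality γ γ' _
      (quotientAppIso γ γ' e he e' he') f)).choose_spec) η)
  naturality_id x := whiskerRight_app_injective γ' e' he'
    (lifted_id _ (fun f => (exists_lift γ' e' he' (liftedNaturality γ γ' _
      (quotientAppIso γ γ' e he e' he') f)).choose_spec) x)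
  naturality_comp f g := whiskerRight_app_injective γ' e' he'
    (lifted_comp _ (fun f => (exists_lift γ' e' he' (liftedNaturality γ γ' _
      (quotientAppIso γ γ' e he e' he') f)).choose_spec) f g)

theorem quotientTrans_comm {x y : B} (f : x ⟶ y) :
    G.map f ◁ (quotientAppIso γ γ' e he e' he' y).hom ≫ (γ.naturality f).hom =
      (α_ _ _ _).inv ≫ ((quotientTrans γ γ' e he e' he').naturality f).hom ▷ γ'.app y ≫
        (α_ _ _ _).hom ≫ (quotientTrans γ γ' e he e' he').app x ◁ (γ'.naturality f).hom ≫
          (α_ _ _ _).inv ≫ (quotientAppIso γ γ' e he e' he' x).hom ▷ F.map f :=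
  lifted_comm _ (fun f => (exists_lift γ' e' he' (liftedNaturality γ γ' _
      (quotientAppIso γ γ' e he e' he') f)).choose_spec) f

end

/-! ### Uniqueness of Mackey functors -/

variable {C : Type u₁} [Category.{v₁} C] {obj : C → K} {P : TwoFunctor C obj}
  {N : TwoFunctor Cᵒᵖ (fun x => obj x.unop)} [HasPullbacks C]

namespace MackeyFunctor

variable {β : BaseChangeData P N} (M M' : MackeyFunctor P N β)

open Comparison

theorem isoP_eq {x y : C} (f : x ⟶ y) :
    (M.isoP f).hom = (M.compSpan (SpanCat.i.map f)).hom ≫ M.app x ◁ (forwardIso P N f).hom := by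
  have h := M.compat_forward f
  unfold Compat at h
  rw [← h]
  simp

theorem isoN_eq {x y : C} (f : x ⟶ y) :
    (M.isoN f).hom = (M.compSpan (SpanCat.j.map f.op)).hom ≫ M.app y ◁ (backwardIso P N f).hom := by
  have h := M.compat_backward f
  unfold Compat at h
  rw [← h]
  simp
  rfl

/-- A square which relates `c₁` and `c₂` remains commutative when both are composed with a
2-morphism `θ`. This passes from the comparisons of spans to those with `P` and `N`. -/
theorem comm_of_comm {a b c d a' b' : K} {g : a ⟶ c} {g' : a' ⟶ b'} {k k' : b ⟶ d}
    {t : a ⟶ a'} {u : c ⟶ b'} {m : a ⟶ b} {n : c ⟶ d} {m' : a' ⟶ b} {n' : b' ⟶ d}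
    {i : t ≫ m' ⟶ m} {i' : u ≫ n' ⟶ n} {τ : g ≫ u ⟶ t ≫ g'} {c₁ : g ≫ n ⟶ m ≫ k}
    {c₂ : g' ≫ n' ⟶ m' ≫ k} (θ : k ⟶ k')
    (h : g ◁ i' ≫ c₁ = (α_ _ _ _).inv ≫ τ ▷ n' ≫ (α_ _ _ _).hom ≫ t ◁ c₂ ≫ (α_ _ _ _).inv ≫
      i ▷ k) :
    g ◁ i' ≫ c₁ ≫ m ◁ θ = (α_ _ _ _).inv ≫ τ ▷ n' ≫ (α_ _ _ _).hom ≫ t ◁ (c₂ ≫ m' ◁ θ) ≫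
      (α_ _ _ _).inv ≫ i ▷ k' := by
  rw [← Category.assoc, h]
  simp [← whisker_exchange]

/-- Any two Mackey functors are equivalent, by the quotient of their equivalences with the canonical
pseudofunctor. -/
theorem exists_equiv (hβ : β.IsCoherent) : Nonempty (M.Equiv M') := by
  choose e he using fun x : SpanCat C => M.resP_equivalence x.of
  choose e' he' using fun x : SpanCat C => M'.resP_equivalence x.of
  exact ⟨{
    trans := quotientTrans (M.toCanonical hβ) (M'.toCanonical hβ) e he e' he'
    trans_equivalence := fun x => ⟨quotient (e x) (e' x), rfl⟩
    iso := fun x => quotientAppIso (M.toCanonical hβ) (M'.toCanonical hβ) e he e' he' ⟨x⟩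
    comm_P := fun f => by
      rw [isoP_eq, isoP_eq]
      exact comm_of_comm _ (quotientTrans_comm (M.toCanonical hβ) (M'.toCanonical hβ) e he e' he'
        (SpanCat.i.map f))
    comm_N := fun f => by
      rw [isoN_eq, isoN_eq]
      exact comm_of_comm _ (quotientTrans_comm (M.toCanonical hβ) (M'.toCanonical hβ) e he e' he'
        (SpanCat.j.map f.op)) }⟩

end MackeyFunctor

end

/-! ### The restrictions of the canonical pseudofunctor -/

section
variable {K : Type u₂} [Bicategory.{w, v₂} K]

theorem splitting_forward {a b c : K} {n : a ⟶ a} {n₂ : b ⟶ b} {p : a ⟶ c} {p₁ : a ⟶ b} {p₂ : b ⟶ c}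
    (ι : n ≅ 𝟙 a) (ι' : n₂ ≅ 𝟙 b) (π : p ⟶ p₁ ≫ p₂) :
    splitting ((λ_ n).inv ≫ ι.inv ▷ n) π (ι.hom ▷ p₁ ≫ (λ_ _).hom ≫ (ρ_ _).inv ≫ p₁ ◁ ι'.inv) ≫
      (ι.hom ▷ p₁ ≫ (λ_ _).hom) ▷ (n₂ ≫ p₂) ≫ p₁ ◁ (ι'.hom ▷ p₂ ≫ (λ_ _).hom) =
    (ι.hom ▷ p ≫ (λ_ _).hom) ≫ π := by
  rw [splitting_eq]
  calc
    _ = 𝟙 _ ⊗≫ ι.inv ▷ (n ≫ p) ⊗≫ n ◁ (n ◁ π ≫ ι.hom ▷ (p₁ ≫ p₂)) ⊗≫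
        (n ◁ (p₁ ◁ ι'.inv ▷ p₂) ≫ ι.hom ▷ (p₁ ≫ n₂ ≫ p₂)) ⊗≫ p₁ ◁ ι'.hom ▷ p₂ ⊗≫ 𝟙 _ := by
      bicategory
    _ = 𝟙 _ ⊗≫ ι.inv ▷ (n ≫ p) ⊗≫ n ◁ ι.hom ▷ p ⊗≫ n ◁ π ⊗≫ ι.hom ▷ (p₁ ≫ p₂) ⊗≫
        p₁ ◁ (ι'.inv ≫ ι'.hom) ▷ p₂ ⊗≫ 𝟙 _ := by
      rw [whisker_exchange, whisker_exchange]; bicategory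
    _ = 𝟙 _ ⊗≫ ι.inv ▷ (n ≫ p) ⊗≫ n ◁ ι.hom ▷ p ⊗≫ (n ◁ π ≫ ι.hom ▷ (p₁ ≫ p₂)) ⊗≫ 𝟙 _ := by
      rw [Iso.inv_hom_id]; bicategory
    _ = 𝟙 _ ⊗≫ (ι.inv ▷ (n ≫ p) ≫ n ◁ (ι.hom ▷ p)) ⊗≫ ι.hom ▷ p ⊗≫ π := by
      rw [whisker_exchange]; bicategory
    _ = 𝟙 _ ⊗≫ ι.hom ▷ p ⊗≫ (ι.inv ≫ ι.hom) ▷ p ⊗≫ π := by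
      rw [← whisker_exchange]; bicategory
    _ = _ := by
      rw [Iso.inv_hom_id]; bicategory

theorem splitting_backward {a b c : K} {n : a ⟶ c} {n₁ : a ⟶ b} {n₂ : b ⟶ c} {p : c ⟶ c}
    {p₁ : b ⟶ b} (ι : p ≅ 𝟙 c) (ι' : p₁ ≅ 𝟙 b) (μ : n ⟶ n₁ ≫ n₂) :
    splitting μ ((λ_ p).inv ≫ ι.inv ▷ p) (n₂ ◁ ι.hom ≫ (ρ_ _).hom ≫ (λ_ _).inv ≫ ι'.inv ▷ n₂) ≫
      (n₁ ◁ ι'.hom ≫ (ρ_ _).hom) ▷ (n₂ ≫ p) ≫ n₁ ◁ (n₂ ◁ ι.hom ≫ (ρ_ _).hom) =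
    (n ◁ ι.hom ≫ (ρ_ _).hom) ≫ μ := by
  rw [splitting_eq]
  calc
    _ = μ ▷ p ⊗≫ n₁ ◁ n₂ ◁ (ι.inv ≫ ι.hom) ▷ p ⊗≫ n₁ ◁ (ι'.inv ≫ ι'.hom) ▷ (n₂ ≫ p) ⊗≫
        n₁ ◁ n₂ ◁ ι.hom ⊗≫ 𝟙 _ := by
      bicategory
    _ = (μ ▷ p ≫ (n₁ ≫ n₂) ◁ ι.hom) ⊗≫ 𝟙 _ := by
      rw [Iso.inv_hom_id, Iso.inv_hom_id]; bicategory
    _ = _ := by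
      rw [← whisker_exchange]; bicategory

theorem splitting_forward_backward {a b c d : K} {p : c ⟶ d} {h : d ⟶ b} {f : c ⟶ a} {g : a ⟶ b}
    {n : c ⟶ c} {q : b ⟶ b} (ι : n ≅ 𝟙 c) (ι' : q ≅ 𝟙 b) (β : f ≫ g ⟶ p ≫ h) :
    splitting ((λ_ f).inv ≫ ι.inv ▷ f) ((ρ_ g).inv ≫ g ◁ ι'.inv) β ≫
      (ι.hom ▷ p ≫ (λ_ _).hom) ▷ (h ≫ q) ≫ p ◁ (h ◁ ι'.hom ≫ (ρ_ _).hom) = β := by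
  rw [splitting_eq]
  calc
    _ = 𝟙 _ ⊗≫ ι.inv ▷ (f ≫ g) ⊗≫ n ◁ ((f ≫ g) ◁ ι'.inv ≫ β ▷ q) ⊗≫ ι.hom ▷ (p ≫ h ≫ q) ⊗≫
        p ◁ h ◁ ι'.hom ⊗≫ 𝟙 _ := by
      bicategory
    _ = 𝟙 _ ⊗≫ ι.inv ▷ (f ≫ g) ⊗≫ (n ◁ (β ▷ 𝟙 b ≫ (p ≫ h) ◁ ι'.inv) ≫ ι.hom ▷ ((p ≫ h) ≫ q)) ⊗≫
        p ◁ h ◁ ι'.hom ⊗≫ 𝟙 _ := by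
      rw [whisker_exchange β]; bicategory
    _ = 𝟙 _ ⊗≫ (ι.inv ≫ ι.hom) ▷ (f ≫ g) ⊗≫ β ⊗≫ p ◁ h ◁ (ι'.inv ≫ ι'.hom) ⊗≫ 𝟙 _ := by
      rw [whisker_exchange]; bicategory
    _ = _ := by
      rw [Iso.inv_hom_id, Iso.inv_hom_id]; bicategory

theorem splitting_backward_forward {a b c : K} {n : a ⟶ b} {p : b ⟶ c}
    {n' p' : b ⟶ b} (ι : n' ≅ 𝟙 b) (ι' : p' ≅ 𝟙 b) :
    splitting ((ρ_ n).inv ≫ n ◁ ι.inv) ((λ_ p).inv ≫ ι'.inv ▷ p)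
        (ι.hom ▷ p' ≫ (λ_ _).hom ≫ (ρ_ _).inv ≫ p' ◁ ι.inv) ≫
      (n ◁ ι'.hom ≫ (ρ_ _).hom) ▷ (n' ≫ p) ≫ n ◁ (ι.hom ▷ p ≫ (λ_ _).hom) = 𝟙 _ := by
  rw [splitting_eq]
  calc
    _ = 𝟙 _ ⊗≫ n ◁ (ι.inv ▷ p ≫ n' ◁ ((λ_ p).inv ≫ ι'.inv ▷ p) ≫ ι.hom ▷ (p' ≫ p)) ⊗≫
        n ◁ (p' ◁ ι.inv ≫ ι'.hom ▷ n') ▷ p ⊗≫ n ◁ ι.hom ▷ p ⊗≫ 𝟙 _ := by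
      bicategory
    _ = 𝟙 _ ⊗≫ n ◁ (ι.inv ≫ ι.hom) ▷ p ⊗≫ n ◁ (ι'.inv ≫ ι'.hom) ▷ p ⊗≫
        n ◁ (ι.inv ≫ ι.hom) ▷ p ⊗≫ 𝟙 _ := by
      rw [whisker_exchange, whisker_exchange]; bicategory
    _ = _ := by
      rw [Iso.inv_hom_id, Iso.inv_hom_id]; bicategory

theorem CompositionSystem.split_postcomp {B : Type u₁} [Bicategory.{v₃, v₁} B]
    (F : CompositionSystem B K) {a b b' c : B} {U : a ⟶ c} {S : a ⟶ b} {T : b ⟶ c} {S' : a ⟶ b'}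
    {T' : b' ⟶ c} (φ : U ⟶ S ≫ T) (ψ : S ≫ T ⟶ S' ≫ T') :
    F.split (φ ≫ ψ) =
      F.split φ ≫ (F.mapComp S T).inv ≫ F.map₂ ψ ≫ (F.mapComp S' T').hom := by
  rw [split_precomp, split_eq _ ψ, split_eq _ φ]
  simp

theorem hom_comp_eq_comp_hom {A : Type u₁} [Category.{v₁} A] {Q R T V : A} (σ : R ≅ T) (β : Q ≅ V)
    (x : T ≅ V) {k : V ⟶ T} {y : R ⟶ Q} (h₁ : k ≫ x.hom = 𝟙 V)
    (h₂ : (k ≫ σ.inv) ≫ y = β.inv) : σ.hom ≫ x.hom = y ≫ β.hom := by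
  obtain rfl : k = x.inv := by rw [← Category.id_comp x.inv, ← h₁]; simp
  rw [← cancel_epi σ.inv, ← cancel_epi x.inv, ← Category.assoc, ← Category.assoc σ.inv,
    ← Category.assoc x.inv, ← Category.assoc x.inv, h₂]
  simp

/-- A 2-morphism `φ : A ⟶ p`, seen as a naturality constraint for identity 1-morphisms. -/
def naturalityOfId {a b : K} {A p : a ⟶ b} (φ : A ≅ p) : A ≫ 𝟙 b ≅ 𝟙 a ≫ p :=
  ρ_ _ ≪≫ φ ≪≫ (λ_ _).symm

theorem naturalityOfId_id {a : K} {A p : a ⟶ a} (φ : A ≅ p) {m : p ⟶ 𝟙 a} {m' : A ⟶ 𝟙 a}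
    (h : φ.hom ≫ m = m') :
    (naturalityOfId φ).hom ≫ 𝟙 a ◁ m = m' ▷ 𝟙 a ≫ (λ_ _).hom ≫ (ρ_ _).inv := by
  subst h
  simp only [naturalityOfId, Iso.trans_hom, Iso.symm_hom]
  bicategory

theorem naturalityOfId_comp {a b c : K} {A₁ p₁ : a ⟶ b} {A₂ p₂ : b ⟶ c} (φ₁ : A₁ ≅ p₁)
    (φ₂ : A₂ ≅ p₂) :
    (α_ _ _ _).hom ≫ A₁ ◁ (naturalityOfId φ₂).hom ≫ (α_ _ _ _).inv ≫
      (naturalityOfId φ₁).hom ▷ p₂ ≫ (α_ _ _ _).hom =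
    (naturalityOfId (whiskerRightIso φ₁ A₂ ≪≫ whiskerLeftIso p₁ φ₂)).hom := by
  simp only [naturalityOfId, Iso.trans_hom, Iso.symm_hom, whiskerRightIso_hom, whiskerLeftIso_hom]
  rw [← whisker_exchange]
  bicategory

theorem naturalityOfId_naturality {a b : K} {A A' p p' : a ⟶ b} (φ : A ≅ p) (φ' : A' ≅ p')
    {σ : A ⟶ A'} {m : p ⟶ p'} (h : σ ≫ φ'.hom = φ.hom ≫ m) :
    σ ▷ 𝟙 b ≫ (naturalityOfId φ').hom = (naturalityOfId φ).hom ≫ 𝟙 a ◁ m := by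
  have h' : σ = φ.hom ≫ m ≫ φ'.inv := by rw [← Category.assoc, ← h]; simp
  subst h'
  simp [naturalityOfId]

theorem naturality_of_locallyDiscrete {C : Type u₁} [Category.{v₁} C]
    {G G' : LocallyDiscrete C ⥤ᵖ K} {a b : LocallyDiscrete C} {u : G.obj a ⟶ G'.obj a}
    {v : G.obj b ⟶ G'.obj b} (nat : ∀ f : a ⟶ b, G.map f ≫ v ≅ u ≫ G'.map f) {f g : a ⟶ b}
    (η : f ⟶ g) : G.map₂ η ▷ v ≫ (nat g).hom = (nat f).hom ≫ u ◁ G'.map₂ η := by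
  obtain rfl : f = g := LocallyDiscrete.eq_of_hom η
  obtain rfl : η = 𝟙 f := Subsingleton.elim _ _
  simp

variable {C : Type u₁} [Category.{v₁} C] {obj : C → K} {P : TwoFunctor C obj}
  {N : TwoFunctor Cᵒᵖ (fun x => obj x.unop)}

open SpanCat

theorem forwardIso_id (x : C) :
    (forwardIso P N (𝟙 x)).hom ≫ (P.mapId x).hom =
      (N.mapId (op x)).hom ▷ P.map (𝟙 x) ≫ 𝟙 (obj x) ◁ (P.mapId x).hom ≫ (λ_ _).hom := by
  simp [forwardIso]

theorem backwardIso_id (x : C) :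
    (backwardIso P N (𝟙 x)).hom ≫ (N.mapId (op x)).hom =
      (N.mapId (op x)).hom ▷ P.map (𝟙 x) ≫ 𝟙 (obj x) ◁ (P.mapId x).hom ≫ (λ_ _).hom := by
  rw [← whisker_exchange_assoc]
  simp [backwardIso]

variable [HasPullbacks C]

namespace BaseChangeData.IsCoherent

variable {β : BaseChangeData P N} (hβ : β.IsCoherent)

theorem compositionSystem_split {x y z : SpanCat C} {U : x ⟶ z} {S : x ⟶ y} {T : y ⟶ z}
    (φ : U ⟶ S ≫ T) {u : U.apex ⟶ S.apex} {v : U.apex ⟶ T.apex} (h : IsPullback u v S.r T.l)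
    (hl : u ≫ S.l = U.l) (hr : v ≫ T.r = U.r) (e₁ : splitFst φ = u) (e₂ : splitSnd φ = v) :
    hβ.compositionSystem.split φ = β.split u v h hl hr :=
  β.split_congr _ (splitFst_l φ) (splitSnd_r φ) e₁ e₂

/-- The composition constraints of the canonical pseudofunctor restrict to those of `P`. -/
theorem split_forward {x y z : C} (f : x ⟶ y) (g : y ⟶ z) :
    hβ.compositionSystem.split (S := i.map f) (T := i.map g) (i.mapComp f g).hom ≫
      (forwardIso P N f).hom ▷ (N.map (𝟙 (op y)) ≫ P.map g) ≫
        P.map f ◁ (forwardIso P N g).hom =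
    (forwardIso P N (f ≫ g)).hom ≫ (P.mapComp f g).hom := by
  have Q : IsPullback (𝟙 x) f f (𝟙 y) := IsPullback.of_horiz_isIso ⟨by simp⟩
  have h : hβ.compositionSystem.split (S := i.map f) (T := i.map g) (i.mapComp f g).hom =
      β.split (U := i.map (f ≫ g)) (S := i.map f) (T := i.map g) (𝟙 x) f Q (Category.comp_id _)
        rfl :=
    hβ.compositionSystem_split _ _ _ _ (forwardComp_hom_fst f g) (forwardComp_hom_snd f g)
  rw [h, ← P.mapComp'_eq]
  have := splitting_forward (N.mapId (op x)) (N.mapId (op y)) (P.mapComp f g).hom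
  rw [← N.mapComp'_id_left_hom, ← hβ.horiz_id Q, ← P.mapComp'_eq] at this
  exact this

/-- The composition constraints of the canonical pseudofunctor restrict to those of `N`. -/
theorem split_backward {x y z : C} (f : x ⟶ y) (g : y ⟶ z) :
    hβ.compositionSystem.split (S := j.map g.op) (T := j.map f.op) (j.mapComp g.op f.op).hom ≫
      (backwardIso P N g).hom ▷ (N.map f.op ≫ P.map (𝟙 x)) ≫
        N.map g.op ◁ (backwardIso P N f).hom =
    (backwardIso P N (f ≫ g)).hom ≫ (N.mapComp g.op f.op).hom := by
  have Q : IsPullback f (𝟙 x) (𝟙 y) f := IsPullback.of_vert_isIso ⟨by simp⟩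
  have h : hβ.compositionSystem.split (S := j.map g.op) (T := j.map f.op)
      (j.mapComp g.op f.op).hom =
      β.split (U := j.map (g.op ≫ f.op)) (S := j.map g.op) (T := j.map f.op) f (𝟙 x) Q
        rfl (Category.comp_id _) :=
    hβ.compositionSystem_split _ _ _ _ (backwardComp_hom_fst f g) (backwardComp_hom_snd f g)
  rw [h, ← N.mapComp'_eq]
  have h' : (β Q).inv = N.map f.op ◁ (P.mapId x).hom ≫ (ρ_ _).hom ≫ (λ_ _).inv ≫
      (P.mapId y).inv ▷ N.map f.op := by
    rw [← cancel_epi (β Q).hom, Iso.hom_inv_id, hβ.vert_id Q]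
    simp
  have := splitting_backward (P.mapId x) (P.mapId y) (N.mapComp g.op f.op).hom
  rw [← P.mapComp'_id_left_hom, ← h', ← N.mapComp'_eq] at this
  exact this

/-- Both composites which `SpanCat.square` relates are isomorphic to the span `(f, a, g)`. This
lemma and `split_factor_square` compute the splittings which belong to the two isomorphisms. -/
theorem split_factor {a b c : C} (f : a ⟶ c) (g : a ⟶ b) :
    hβ.compositionSystem.split (factor (Roof.mk a f g : (⟨c⟩ : SpanCat C) ⟶ ⟨b⟩)) ≫
      (backwardIso P N f).hom ▷ (N.map (𝟙 (op a)) ≫ P.map g) ≫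
        N.map f.op ◁ (forwardIso P N g).hom = 𝟙 _ := by
  have Q : IsPullback (𝟙 a) (𝟙 a) (𝟙 a) (𝟙 a) := IsPullback.of_id_fst
  have h : hβ.compositionSystem.split (factor (Roof.mk a f g : (⟨c⟩ : SpanCat C) ⟶ ⟨b⟩)) =
      β.split (x := ⟨c⟩) (z := ⟨b⟩) (U := Roof.mk a f g) (S := j.map f.op) (T := i.map g) (𝟙 a)
        (𝟙 a) Q (Category.id_comp _) (Category.id_comp _) :=
    hβ.compositionSystem_split _ _ _ _ (splitFst_factor _) (splitSnd_factor _)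
  rw [h]
  have := splitting_backward_forward (n := N.map f.op) (p := P.map g) (N.mapId (op a)) (P.mapId a)
  rw [← P.mapComp'_id_left_hom, ← N.mapComp'_id_right_hom, ← hβ.horiz_id Q] at this
  exact this

theorem split_factor_square {a b c d : C} {f : a ⟶ c} {g : a ⟶ b} {p : c ⟶ d} {h : b ⟶ d}
    (Q : IsPullback f g p h) :
    hβ.compositionSystem.split
        (factor (Roof.mk a f g : (⟨c⟩ : SpanCat C) ⟶ ⟨b⟩) ≫ (square Q).inv) ≫
      (forwardIso P N p).hom ▷ (N.map h.op ≫ P.map (𝟙 b)) ≫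
        P.map p ◁ (backwardIso P N h).hom = (β Q).inv := by
  have h : hβ.compositionSystem.split
        (factor (Roof.mk a f g : (⟨c⟩ : SpanCat C) ⟶ ⟨b⟩) ≫ (square Q).inv) =
      β.split (x := ⟨c⟩) (z := ⟨b⟩) (U := Roof.mk a f g) (S := i.map p) (T := j.map h.op) f
        g Q (Category.comp_id _) (Category.comp_id _) := by
    refine hβ.compositionSystem_split _ _ _ _ ?_ ?_
    · refine (Category.assoc _ _ _).trans ((congrArg (_ ≫ ·) (square_inv_pfst Q)).trans ?_)
      exact factor_pfst_assoc (Roof.mk a f g : (⟨c⟩ : SpanCat C) ⟶ ⟨b⟩) f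
    · refine (Category.assoc _ _ _).trans ((congrArg (_ ≫ ·) (square_inv_psnd Q)).trans ?_)
      exact factor_pfst_assoc (Roof.mk a f g : (⟨c⟩ : SpanCat C) ⟶ ⟨b⟩) g
  rw [h]
  have := splitting_forward_backward (N.mapId (op c)) (P.mapId b) (β Q).inv
  rw [← N.mapComp'_id_left_hom, ← P.mapComp'_id_right_hom] at this
  exact this

/-- The canonical pseudofunctor on spans with the identifications of its restrictions, whose
components on objects are identities. -/
def spanExtension : SpanExtension P N where
  functor := hβ.compositionSystem.toPseudofunctor
  resP :=
    { app x := 𝟙 (obj x.as)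
      naturality f := naturalityOfId (forwardIso P N f.as)
      naturality_naturality η := naturality_of_locallyDiscrete
        (G := i.toPseudofunctor.comp hβ.compositionSystem.toPseudofunctor) (G' := P.toPseudofunctor)
        (fun f => naturalityOfId (forwardIso P N f.as)) η
      naturality_id x := naturalityOfId_id (forwardIso P N (𝟙 x.as)) (by
        have h : hβ.compositionSystem.map₂ (𝟙 (i.map (𝟙 x.as))) = 𝟙 _ :=
          hβ.compositionSystem.map₂_id _
        refine Eq.trans ?_ ((congrArg (· ≫ (hβ.compositionSystem.mapId ⟨x.as⟩).hom) h).trans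
          (Category.id_comp _)).symm
        exact forwardIso_id x.as)
      naturality_comp f g := by
        have h := hβ.split_forward f.as g.as
        rw [hβ.compositionSystem.split_eq] at h
        have h' := naturalityOfId_naturality (forwardIso P N (f.as ≫ g.as))
          (whiskerRightIso (forwardIso P N f.as) _ ≪≫ whiskerLeftIso _ (forwardIso P N g.as)) h
        rw [← naturalityOfId_comp] at h'
        exact h'.symm }
  resP_equivalence x := ⟨Equivalence.id _, rfl⟩
  resN :=
    { app x := 𝟙 (obj x.as.unop)
      naturality f := naturalityOfId (backwardIso P N f.as.unop)
      naturality_naturality η := naturality_of_locallyDiscrete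
        (G := j.toPseudofunctor.comp hβ.compositionSystem.toPseudofunctor) (G' := N.toPseudofunctor)
        (fun f => naturalityOfId (backwardIso P N f.as.unop)) η
      naturality_id x := naturalityOfId_id (backwardIso P N (𝟙 x.as.unop)) (by
        have h : hβ.compositionSystem.map₂ (𝟙 (j.map (𝟙 x.as))) = 𝟙 _ :=
          hβ.compositionSystem.map₂_id _
        refine Eq.trans ?_ ((congrArg (· ≫ (hβ.compositionSystem.mapId ⟨x.as.unop⟩).hom) h).trans
          (Category.id_comp _)).symm
        exact backwardIso_id x.as.unop)
      naturality_comp f g := by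
        have h := hβ.split_backward g.as.unop f.as.unop
        rw [hβ.compositionSystem.split_eq] at h
        have h' := naturalityOfId_naturality (backwardIso P N (g.as.unop ≫ f.as.unop))
          (whiskerRightIso (backwardIso P N f.as.unop) _ ≪≫
            whiskerLeftIso _ (backwardIso P N g.as.unop)) h
        rw [← naturalityOfId_comp] at h'
        exact h'.symm }
  resN_equivalence x := ⟨Equivalence.id _, rfl⟩
  appIso x := Iso.refl _

theorem spanExtension_isoN {x y : C} (f : x ⟶ y) :
    hβ.spanExtension.isoN f = naturalityOfId (backwardIso P N f) := by
  apply Iso.ext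
  refine (congrArg₂ (· ≫ _ ≫ ·) (whiskerLeft_id _ _) (id_whiskerRight _ _)).trans ?_
  exact (Category.id_comp _).trans (Category.comp_id _)

/-- The base change isomorphism of the canonical pseudofunctor corresponds to `β`. -/
theorem map₂_square {a b c d : C} {f : a ⟶ c} {g : a ⟶ b} {p : c ⟶ d} {h : b ⟶ d}
    (Q : IsPullback f g p h) :
    (hβ.spanExtension.squareIso Q).hom ≫
        (backwardIso P N f).hom ▷ (N.map (𝟙 (op a)) ≫ P.map g) ≫
          N.map f.op ◁ (forwardIso P N g).hom =
      ((forwardIso P N p).hom ▷ (N.map h.op ≫ P.map (𝟙 b)) ≫ P.map p ◁ (backwardIso P N h).hom) ≫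
        (β Q).hom := by
  have h₁ := hβ.split_factor f g
  have h₂ := hβ.split_factor_square Q
  have h : hβ.compositionSystem.split
        (factor (Roof.mk a f g : (⟨c⟩ : SpanCat C) ⟶ ⟨b⟩) ≫ (square Q).inv) =
      hβ.compositionSystem.split (factor (Roof.mk a f g : (⟨c⟩ : SpanCat C) ⟶ ⟨b⟩)) ≫
        (hβ.spanExtension.squareIso Q).inv :=
    (hβ.compositionSystem.split_postcomp (S := j.map f.op) (T := i.map g) (S' := i.map p)
      (T' := j.map h.op) _ (square Q).inv).trans (congrArg (_ ≫ ·) (Category.assoc _ _ _).symm)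
  rw [h] at h₂
  exact hom_comp_eq_comp_hom (hβ.spanExtension.squareIso Q) (β Q)
    (whiskerRightIso (backwardIso P N f) (N.map (𝟙 (op a)) ≫ P.map g) ≪≫
      whiskerLeftIso _ (forwardIso P N g)) h₁ h₂

/-- The canonical pseudofunctor on spans is a Mackey functor. -/
def mackeyFunctor : MackeyFunctor P N β where
  __ := hβ.spanExtension
  baseChange {a b c d f g p h} Q := by
    have h' := naturalityOfId_naturality
      (whiskerRightIso (forwardIso P N p) _ ≪≫ whiskerLeftIso _ (backwardIso P N h))
      (whiskerRightIso (backwardIso P N f) _ ≪≫ whiskerLeftIso _ (forwardIso P N g))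
      (hβ.map₂_square Q)
    rw [← naturalityOfId_comp, ← naturalityOfId_comp, ← spanExtension_isoN,
      ← spanExtension_isoN] at h'
    exact h'

end BaseChangeData.IsCoherent

end

/-! ### Mates and conjugates -/

section Mates

variable {K : Type u₂} [Bicategory.{w, v₂} K] {c d e f : K}

theorem mateEquiv_whisker {g g' : c ⟶ e} {h h' : d ⟶ f} {l₁ : c ⟶ d} {r₁ : d ⟶ c}
    {l₂ : e ⟶ f} {r₂ : f ⟶ e} (adj₁ : l₁ ⊣ r₁) (adj₂ : l₂ ⊣ r₂) (θ : g' ⟶ g)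
    (α : g ≫ l₂ ⟶ l₁ ≫ h) (κ : h ⟶ h') :
    mateEquiv adj₁ adj₂ (θ ▷ l₂ ≫ α ≫ l₁ ◁ κ) =
      r₁ ◁ θ ≫ mateEquiv adj₁ adj₂ α ≫ κ ▷ r₂ := by
  simp only [mateEquiv_apply']
  calc
    _ = 𝟙 _ ⊗≫ r₁ ◁ (g' ◁ adj₂.unit ≫ θ ▷ (l₂ ≫ r₂)) ⊗≫ r₁ ◁ α ▷ r₂ ⊗≫
        ((r₁ ≫ l₁) ◁ κ ≫ adj₁.counit ▷ h') ▷ r₂ ⊗≫ 𝟙 _ := by bicategory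
    _ = _ := by
      rw [whisker_exchange, whisker_exchange]
      bicategory

/-- Mates are compatible with a change of the adjunctions. -/
theorem mateEquiv_conjugate {g : c ⟶ e} {h : d ⟶ f} {l₁ l₁' : c ⟶ d} {r₁ r₁' : d ⟶ c}
    {l₂ l₂' : e ⟶ f} {r₂ r₂' : f ⟶ e} (adj₁ : l₁ ⊣ r₁) (adj₁' : l₁' ⊣ r₁') (adj₂ : l₂ ⊣ r₂)
    (adj₂' : l₂' ⊣ r₂') (x : l₂' ⟶ l₂) (α : g ≫ l₂ ⟶ l₁ ≫ h) (y : l₁ ⟶ l₁') :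
    mateEquiv adj₁' adj₂' (g ◁ x ≫ α ≫ y ▷ h) =
      conjugateEquiv adj₁' adj₁ y ▷ g ≫ mateEquiv adj₁ adj₂ α ≫
        h ◁ conjugateEquiv adj₂ adj₂' x := by
  have h₁ := conjugateEquiv_mateEquiv_vcomp adj₁' adj₁ adj₂ y α
  have h₂ := mateEquiv_conjugateEquiv_vcomp adj₁' adj₂ adj₂'
    (leftAdjointConjugateSquare.vcomp y α) x
  simp only [leftAdjointConjugateSquare.vcomp, rightAdjointConjugateSquare.vcomp,
    leftAdjointSquareConjugate.vcomp, rightAdjointSquareConjugate.vcomp] at h₁ h₂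
  rw [h₂, h₁]
  simp

theorem conjugateEquiv_iso_inv {l₁ l₂ : c ⟶ d} {r₁ r₂ : d ⟶ c} (adj₁ : l₁ ⊣ r₁)
    (adj₂ : l₂ ⊣ r₂) (x : l₂ ≅ l₁) (y : r₂ ≅ r₁)
    (hxy : conjugateEquiv adj₁ adj₂ x.hom = y.inv) : conjugateEquiv adj₂ adj₁ x.inv = y.hom := by
  rw [← cancel_mono y.inv, Iso.hom_inv_id, ← hxy, Bicategory.conjugateEquiv_comp, Iso.hom_inv_id,
    Bicategory.conjugateEquiv_id]

end Mates

/-! ### Operations on coherent base change isomorphisms -/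

section Closure

variable {K : Type u₂} [Bicategory.{w, v₂} K] {C : Type u₁} [Category.{v₁} C] {obj : C → K}
  {P P' : TwoFunctor C obj} {N : TwoFunctor Cᵒᵖ (fun x => obj x.unop)}

namespace BaseChangeData

/-- Base change isomorphisms in the bicategory with reversed 1-morphisms, between `N` and `P`,
obtained by reflecting the squares. -/
def flipOp (β : BaseChangeData P N) : BaseChangeData N.opContra P.opCov :=
  fun _ _ _ _ _ _ _ _ Q => (β Q.flip).op2

theorem IsCoherent.flipOp {β : BaseChangeData P N} (hβ : β.IsCoherent) :
    β.flipOp.IsCoherent where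
  vert Q Q' R := by
    have := congrArg Bicategory.Opposite.op2 (hβ.horiz Q.flip Q'.flip R.flip)
    refine this.trans ?_
    simp
    rfl
  horiz Q Q' R := by
    have := congrArg Bicategory.Opposite.op2 (hβ.vert Q.flip Q'.flip R.flip)
    refine this.trans ?_
    simp
    rfl

/-- Base change isomorphisms for `P'`, where `P'` is isomorphic to `P`. -/
def transport (β : BaseChangeData P N) (e : ∀ {x y : C} (f : x ⟶ y), P'.map f ≅ P.map f) :
    BaseChangeData P' N :=
  fun _ _ _ _ f g p h Q =>
    whiskerRightIso (e p) (N.map h.op) ≪≫ β Q ≪≫ whiskerLeftIso (N.map f.op) (e g).symm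

theorem IsCoherent.transport {β : BaseChangeData P N} (hβ : β.IsCoherent)
    (e : ∀ {x y : C} (f : x ⟶ y), P'.map f ≅ P.map f)
    (he : ∀ {x y z : C} (f : x ⟶ y) (g : y ⟶ z), (e (f ≫ g)).hom ≫ (P.mapComp f g).hom =
      (P'.mapComp f g).hom ≫ (e f).hom ▷ P'.map g ≫ P.map f ◁ (e g).hom) :
    (β.transport e).IsCoherent where
  vert {a b c d b' d' f g p h g' p' h'} Q Q' R := by
    have he' : (P.mapComp g g').inv ≫ (e (g ≫ g')).inv =
        P.map g ◁ (e g').inv ≫ (e g).inv ▷ P'.map g' ≫ (P'.mapComp g g').inv := by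
      rw [← cancel_epi (e (g ≫ g') ≪≫ P.mapComp g g').hom]
      simp [reassoc_of% he g g']
    simp only [BaseChangeData.transport, Iso.trans_hom, whiskerRightIso_hom, whiskerLeftIso_hom,
      Iso.symm_hom, hβ.vert Q Q' R]
    calc
      _ = 𝟙 _ ⊗≫ ((e (p ≫ p')).hom ≫ (P.mapComp p p').hom) ▷ N.map h'.op ⊗≫
          P.map p ◁ (β Q').hom ⊗≫ (β Q).hom ▷ P.map g' ⊗≫
            N.map f.op ◁ ((P.mapComp g g').inv ≫ (e (g ≫ g')).inv) ⊗≫ 𝟙 _ := by bicategory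
      _ = 𝟙 _ ⊗≫ (P'.mapComp p p').hom ▷ N.map h'.op ⊗≫
          ((e p).hom ▷ (P'.map p' ≫ N.map h'.op) ≫
            P.map p ◁ ((e p').hom ▷ N.map h'.op ≫ (β Q').hom)) ⊗≫
          ((β Q).hom ▷ P.map g' ≫ (N.map f.op ≫ P.map g) ◁ (e g').inv) ⊗≫
            N.map f.op ◁ (e g).inv ▷ P'.map g' ⊗≫ N.map f.op ◁ (P'.mapComp g g').inv ⊗≫ 𝟙 _ := by
        rw [he, he']; bicategory
      _ = 𝟙 _ ⊗≫ (P'.mapComp p p').hom ▷ N.map h'.op ⊗≫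
          P'.map p ◁ (e p').hom ▷ N.map h'.op ⊗≫ P'.map p ◁ (β Q').hom ⊗≫
          ((e p).hom ▷ (N.map h.op ≫ P.map g') ≫ P.map p ◁ N.map h.op ◁ (e g').inv) ⊗≫
          (β Q).hom ▷ P'.map g' ⊗≫
            N.map f.op ◁ (e g).inv ▷ P'.map g' ⊗≫ N.map f.op ◁ (P'.mapComp g g').inv ⊗≫ 𝟙 _ := by
        rw [← whisker_exchange, ← whisker_exchange]; bicategory
      _ = _ := by
        rw [← whisker_exchange]; bicategory
  horiz {a b c d e₁ e₂ f g p h f' q h'} Q Q' R := by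
    -- The composites are generalized because `(f ≫ f').op` and `f'.op ≫ f.op` agree only
    -- definitionally.
    have key {ff' : a ⟶ e₁} {hh' : b ⟶ e₂} (R : IsPullback ff' g q hh') (hf : f ≫ f' = ff')
        (hh : h ≫ h' = hh') :
        (β.transport e R).hom =
          P'.map q ◁ (N.mapComp' h'.op h.op hh'.op (by rw [← hh]; rfl)).hom ≫ (α_ _ _ _).inv ≫
            (β.transport e Q').hom ▷ N.map h.op ≫ (α_ _ _ _).hom ≫
              N.map f'.op ◁ (β.transport e Q).hom ≫ (α_ _ _ _).inv ≫
                (N.mapComp' f'.op f.op ff'.op (by rw [← hf]; rfl)).inv ▷ P'.map g := by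
      simp only [BaseChangeData.transport, Iso.trans_hom, whiskerRightIso_hom, whiskerLeftIso_hom,
        Iso.symm_hom, hβ.horiz' Q Q' R hf hh]
      generalize_proofs hN hN'
      calc
        _ = 𝟙 _ ⊗≫ ((e q).hom ▷ N.map hh'.op ≫ P.map q ◁ (N.mapComp' h'.op h.op _ hN).hom) ⊗≫
            (β Q').hom ▷ N.map h.op ⊗≫ N.map f'.op ◁ (β Q).hom ⊗≫
              ((N.mapComp' f'.op f.op _ hN').inv ▷ P.map g ≫ N.map ff'.op ◁ (e g).inv) ⊗≫
                𝟙 _ := by bicategory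
        _ = 𝟙 _ ⊗≫ P'.map q ◁ (N.mapComp' h'.op h.op _ hN).hom ⊗≫
            (e q).hom ▷ (N.map h'.op ≫ N.map h.op) ⊗≫ (β Q').hom ▷ N.map h.op ⊗≫
            N.map f'.op ◁ ((e p).inv ≫ (e p).hom) ▷ N.map h.op ⊗≫ N.map f'.op ◁ (β Q).hom ⊗≫
              (N.map f'.op ≫ N.map f.op) ◁ (e g).inv ⊗≫
                (N.mapComp' f'.op f.op _ hN').inv ▷ P'.map g ⊗≫ 𝟙 _ := by
          rw [← whisker_exchange, ← whisker_exchange, Iso.inv_hom_id]; bicategory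
        _ = _ := by bicategory
    simpa only [TwoFunctor.mapComp'_eq, op_comp] using key R rfl rfl

end BaseChangeData

end Closure

/-! ### The base change isomorphisms of a cross functor -/

namespace CrossFunctor

variable {C : Type u₁} [Category.{v₁} C] {K : Type u₂} [Bicategory.{w, v₂} K]
  (H : CrossFunctor C K (cartesianSquares C))

theorem adjStar_comp_inv {x y z : C} (f : x ⟶ y) (g : y ⟶ z) :
    conjugateEquiv (H.adjStar (f ≫ g)) ((H.adjStar g).comp (H.adjStar f))
      (H.upperStar.mapComp g.op f.op).inv = (H.lowerStar.mapComp f g).hom :=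
  conjugateEquiv_iso_inv _ _ (H.upperStar.mapComp g.op f.op) (H.lowerStar.mapComp f g)
    (H.adjStar_comp f g)

/-- The base change isomorphisms `h^* p_! ≅ g_! f^*`. -/
def leftData : BaseChangeData H.lowerShriek H.upperStar :=
  fun _ _ _ _ _ _ _ _ Q => H.baseChange Q

/-- The base change isomorphisms `h^! p_* ≅ g_* f^!`, obtained from `p^! h_* ≅ f_* g^!` by
reflecting the square. -/
def rightData : BaseChangeData H.lowerStar H.upperShriek :=
  fun _ _ _ _ _ _ _ _ Q => H.baseChangeRight Q.flip

theorem leftData_isCoherent : H.leftData.IsCoherent where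
  vert {a b c d b' d' f g p h g' p' h'} Q Q' R := by
    apply (mateEquiv (H.adjStar f) (H.adjStar h')).injective
    have hv := mateEquiv_vcomp (H.adjStar f) (H.adjStar h) (H.adjStar h')
      (H.baseChange Q).hom (H.baseChange Q').hom
    have hw := mateEquiv_whisker (H.adjStar f) (H.adjStar h') (H.lowerShriek.mapComp p p').hom
      (leftAdjointSquare.vcomp (H.baseChange Q).hom (H.baseChange Q').hom)
      (H.lowerShriek.mapComp g g').inv
    rw [hv] at hw
    have hx := H.lowerExchange_vert Q Q' R
    simp only [CrossFunctor.baseChange, Equiv.apply_symm_apply, rightAdjointSquare.vcomp,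
      leftAdjointSquare.vcomp, leftData, Category.assoc] at hw hx ⊢
    rw [hw, ← hx]
  horiz {a b c d e e' f g p h f' q h'} Q Q' R := by
    apply (mateEquiv (H.adjStar (f ≫ f')) (H.adjStar (h ≫ h'))).injective
    have hv := mateEquiv_hcomp (H.adjStar f') (H.adjStar h') (H.adjStar f) (H.adjStar h)
      (H.baseChange Q').hom (H.baseChange Q).hom
    have hw := mateEquiv_conjugate ((H.adjStar f').comp (H.adjStar f)) (H.adjStar (f ≫ f'))
      ((H.adjStar h').comp (H.adjStar h)) (H.adjStar (h ≫ h'))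
      (H.upperStar.mapComp h'.op h.op).hom
      (leftAdjointSquare.hcomp (H.baseChange Q').hom (H.baseChange Q).hom)
      (H.upperStar.mapComp f'.op f.op).inv
    rw [hv, H.adjStar_comp_inv, H.adjStar_comp] at hw
    have hx := H.lowerExchange_horiz Q Q' R
    simp only [CrossFunctor.baseChange, Equiv.apply_symm_apply, rightAdjointSquare.hcomp,
      leftAdjointSquare.hcomp, leftData, Category.assoc] at hw hx ⊢
    rw [hw, ← hx]

/-- Conjugates are iterated mates, and the inverse of `baseChange` is a mate of the upper exchange.
-/
theorem baseChangeRight_hom {a b c d : C} {f : a ⟶ c} {g : a ⟶ b} {p : c ⟶ d} {h : b ⟶ d}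
    (Q : IsPullback f g p h) :
    (H.baseChangeRight Q).hom = mateEquiv (H.adjStar h) (H.adjStar f) (H.upperExchange Q) := by
  have := iterated_mateEquiv_conjugateEquiv (H.adjShriek p) (H.adjShriek g) (H.adjStar f)
    (H.adjStar h) (H.baseChange Q).inv
  refine this.symm.trans ?_
  simp [CrossFunctor.baseChange]

theorem rightData_isCoherent : H.rightData.IsCoherent where
  vert {a b c d b' d' f g p h g' p' h'} Q Q' R := by
    have hv := mateEquiv_hcomp (H.adjStar p') (H.adjStar g') (H.adjStar p) (H.adjStar g)
      (H.upperExchange Q'.flip) (H.upperExchange Q.flip)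
    have hw := mateEquiv_conjugate ((H.adjStar p').comp (H.adjStar p)) (H.adjStar (p ≫ p'))
      ((H.adjStar g').comp (H.adjStar g)) (H.adjStar (g ≫ g'))
      (H.upperStar.mapComp g'.op g.op).hom
      (leftAdjointSquare.hcomp (H.upperExchange Q'.flip) (H.upperExchange Q.flip))
      (H.upperStar.mapComp p'.op p.op).inv
    rw [hv, H.adjStar_comp_inv, H.adjStar_comp] at hw
    have hx := H.upperExchange_horiz Q.flip Q'.flip R.flip
    simp only [rightAdjointSquare.hcomp,
      leftAdjointSquare.hcomp, rightData, Category.assoc, baseChangeRight_hom] at hw hx ⊢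
    rw [hx, hw]
  horiz {a b c d e e' f g p h f' q h'} Q Q' R := by
    have hv := mateEquiv_vcomp (H.adjStar q) (H.adjStar p) (H.adjStar g)
      (H.upperExchange Q'.flip) (H.upperExchange Q.flip)
    have hw := mateEquiv_whisker (H.adjStar q) (H.adjStar g)
      (H.upperShriek.mapComp h'.op h.op).hom
      (leftAdjointSquare.vcomp (H.upperExchange Q'.flip) (H.upperExchange Q.flip))
      (H.upperShriek.mapComp f'.op f.op).inv
    rw [hv] at hw
    have hx := H.upperExchange_vert Q.flip Q'.flip R.flip
    simp only [rightAdjointSquare.vcomp,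
      leftAdjointSquare.vcomp, rightData, Category.assoc, baseChangeRight_hom] at hw hx ⊢
    rw [hx, hw]

end CrossFunctor

namespace GrothendieckCrossFunctor

variable {D : Type u₁} [Category.{v₁} D]
  {E : RingedDTopos.{w, v₁, v₂, u₁, u₂} D} (H : GrothendieckCrossFunctor.{w, v₁, v₂, v₃} E)

theorem baseChangeStarShriek_isCoherent : H.baseChangeStarShriek.IsCoherent :=
  H.leftData_isCoherent

theorem baseChangeShriekStar_isCoherent : H.baseChangeShriekStar.IsCoherent :=
  H.rightData_isCoherent.flipOp

theorem baseChangeStarStar_isCoherent : H.baseChangeStarStar.IsCoherent := by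
  refine (H.leftData_isCoherent.transport (fun f => (H.lowerIso f).symm) fun f g => ?_).flipOp
  simp only [Iso.symm_hom, Iso.inv_comp_eq]
  rw [← Category.assoc, H.lowerIso_comp f g]
  simp only [Category.assoc]
  rw [whisker_exchange_assoc]
  simp

theorem baseChangeShriekShriek_isCoherent : H.baseChangeShriekShriek.IsCoherent :=
  H.rightData_isCoherent.transport H.lowerIso H.lowerIso_comp

end GrothendieckCrossFunctor

end CrossFunctors

end

theorem propositionp4p3p1 {D : Type u₁} [Category.{v₁} D] [HasPushouts D]
    (E : CrossFunctors.RingedDTopos.{w, v₁, v₂, u₁, u₂} D)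
    (H : CrossFunctors.GrothendieckCrossFunctor.{w, v₁, v₂, v₃, u₁, u₂, u₃} E) :
    (Nonempty H.MackeyStarShriek ∧
      ∀ M M' : H.MackeyStarShriek, Nonempty (M.Equiv M')) ∧
    (Nonempty H.MackeyShriekStar ∧
      ∀ M M' : H.MackeyShriekStar, Nonempty (M.Equiv M')) ∧
    (Nonempty H.MackeyStarStar ∧
      ∀ M M' : H.MackeyStarStar, Nonempty (M.Equiv M')) ∧
    (Nonempty H.MackeyShriekShriek ∧
      ∀ M M' : H.MackeyShriekShriek, Nonempty (M.Equiv M')) := by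
  have h₁ := H.baseChangeStarShriek_isCoherent
  have h₂ := H.baseChangeShriekStar_isCoherent
  have h₃ := H.baseChangeStarStar_isCoherent
  have h₄ := H.baseChangeShriekShriek_isCoherent
  exact ⟨⟨⟨h₁.mackeyFunctor⟩, fun M M' => M.exists_equiv M' h₁⟩,
    ⟨⟨h₂.mackeyFunctor⟩, fun M M' => M.exists_equiv M' h₂⟩,
    ⟨⟨h₃.mackeyFunctor⟩, fun M M' => M.exists_equiv M' h₃⟩,
    ⟨⟨h₄.mackeyFunctor⟩, fun M M' => M.exists_equiv M' h₄⟩⟩
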